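/- **Construction.** For $k=1,2,\dots$ define an even integer $N_k$ and positive numbers $r_k,t_k,\delta_k$ as follows. Put $N_1=2$, $r_1=\frac{1000}{4001}$, $\delta_1=\frac{1}{4001}$, $t_1=\frac{1}{400100}$ (that is, $4r_1+\delta_1=1$ and $t_1=\frac{\delta_1}{100}=\frac{r_1}{10^5}$). For $k\ge 2$ put $h_{k-1}=r_{k-1}-\frac{\delta_{k-1}}2$, $\hat\epsilon_{k-1}=t_{k-1}/h_{k-1}$, $N_k=2\lceil 100/\hat\epsilon_{k-1}\rceil$, let $s_k,a_k>0$ be determined by $N_ks_k+(\frac{N_k}{2}-1)a_k=1$ and $a_k/s_k=\exp(-(2N_k)^{2k})$, let $\epsilon_k=\min\{\frac{\hat\epsilon_{k-1}}{100},\frac{a_k}{100}\}$, and put $(r_k,\delta_k,t_k)=h_{k-1}\cdot(s_k,a_k,\epsilon_k)$. Let $\mathcal W_k$ be the set of pairs $w=(\tilde m,\tilde n)$ of words $\tilde m=m_1\cdots m_k$, $m_j\in\{\mathrm{Le},\mathrm{Ri}\}$, and $\tilde n=n_1\cdots n_k$, $n_j\in\{1,\dots,N_j\}$. Write $\sigma(\mathrm{Le})=-1$,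 $\sigma(\mathrm{Ri})=1$. Define $x^{m_1}=2\sigma(m_1)$, $y^{n_1}=(n_1-1)(2r_1+\delta_1)+r_1$, and for $k\ge2$, with $\tilde m,\tilde n$ now denoting words of length $k-1$, $$x^{\tilde m m_k}=x^{\tilde m}+\sigma(m_k)\tfrac{t_{k-1}}{2},$$ $$y^{\tilde n n_k}=\begin{cases} y^{\tilde n}-r_{k-1}+(n_k-1)(2r_k+\delta_k)+r_k, & n_k\le \frac{N_k}{2},\\ y^{\tilde n}+\frac{\delta_{k-1}}{2}+(n_k-\frac{N_k}{2}-1)(2r_k+\delta_k)+r_k, & n_k>\frac{N_k}{2}.\end{cases}$$ For $w=(\tilde m,\tilde n)\in\mathcal W_k$ let $R^w=[x^{\tilde m}-t_k,x^{\tilde m}+t_k]\times[y^{\tilde n}-r_k,y^{\tilde n}+r_k]\subset\mathbb C$, and let $D^w(\mathrm{Le})$ and $D^w(\mathrm{Ri})$ be the closed disks of radius $r_k$ with centers $x^{\tilde m}-(2t_k+r_k)+iy^{\tilde n}$ and $x^{\tilde m}+(2t_k+r_k)+iy^{\tilde n}$, respectively. Put $$E\times F=\bigcap_{k\ge1}\bigcup_{w\in\mathcal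 W_k}R^w,\qquad \Omega=\hat{\mathbb C}\setminus\Big((E\times F)\cup\bigcup_{k\ge1}\bigcup_{w\in\mathcal W_k}\big(D^w(\mathrm{Le})\cup D^w(\mathrm{Ri})\big)\Big).$$ **Neighbors.** Let $z\in E\times F$ and $k\ge1$, and let $w=(\tilde m,n_1\cdots n_k)\in\mathcal W_k$ be the pair with $z\in R^w$; let $w\pm1$ be $w$ with the last letter $n_k$ replaced by $n_k\pm1$. Call $w$ a bottom if $n_k=1$ or ($k\ge2$ and $n_k=\frac{N_k}{2}+1$), and a top if $n_k=N_k$ or ($k\ge2$ and $n_k=\frac{N_k}{2}$). The collection $\mathfrak N_k(z)$ of $k$-th level neighbors of $z$ consists of the disks $D^{v}(\mathrm{Le}),D^{v}(\mathrm{Ri})$ with $v\in\{w-1,w,w+1\}$ if $w$ is neither a bottom nor a top, with $v\in\{w,w+1\}$ if $w$ is a bottom, and with $v\in\{w-1,w\}$ if $w$ is a top. **Notation.** A circle domain is a domain in $\hat{\mathbb C}$ all of whose boundary components are circles or points. For a domain $G\subset\hat{\mathbb C}$ let $\hat G$ be the quotient space of $\hat{\mathbb C}$ in which every connected component of $\hat{\mathbb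 C}\setminus G$ is collapsed to a point. For a closed disk $D$ with center $c$ and radius $r$ and for $\tau>0$, $\tau D$ is the closed disk with center $c$ and radius $\tau r$. **Proposition 3.4.** Let $f:\Omega\to\Omega'$ be a conformal map onto a circle domain $\Omega'$ with $f(\infty)=\infty$. Then $f$ has a homeomorphic extension $\hat f:\hat\Omega\to\hat\Omega'$, and for every such $\hat f$ the following holds, where the images $\hat f(D)$ and $\hat f(\{z\})$ of complementary components of $\Omega$ are regarded as subsets of $\hat{\mathbb C}$. For every $z\in E\times F$ and every integer $k\ge1$ there is $D\in\mathfrak N_k(z)$ such that $z\in 4D$, the set $\hat f(D)$ is a closed disk of positive radius in $\mathbb C$, and $$\hat f(\{z\})\subset 10^{30}\,\hat f(D).$$ -/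

import Mathlib

open scoped Topology ComplexConjugate

noncomputable section

namespace RigidCircle

/-! ### The Riemann sphere, circle domains, conformal maps

The Riemann sphere is the one-point compactification `OnePoint ℂ`. -/

/-- The inversion `z ↦ 1 / z` of the Riemann sphere (the chart at infinity). -/
def sphereInv : OnePoint ℂ → OnePoint ℂ
  | none => ((0 : ℂ) : OnePoint ℂ)
  | some z => if z = 0 then OnePoint.infty else ((z⁻¹ : ℂ) : OnePoint ℂ)

/-- The finite coordinate of a point of the sphere (with the value `0` at infinity). -/
def toComplex : OnePoint ℂ → ℂ
  | none => 0
  | some z => z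

open Classical in
/-- The chart change used at the point `x`: the inversion if `x = ∞`, the identity otherwise. -/
def chartMap (x : OnePoint ℂ) : OnePoint ℂ → OnePoint ℂ :=
  if x = OnePoint.infty then sphereInv else id

/-- `f` is holomorphic at the point `x` of the Riemann sphere: it is continuous there, and its
expression in the charts `z` and `1 / z` is holomorphic near the point. -/
def HolomorphicAt (f : OnePoint ℂ → OnePoint ℂ) (x : OnePoint ℂ) : Prop :=
  ContinuousAt f x ∧
    AnalyticAt ℂ (fun ζ : ℂ => toComplex (chartMap (f x) (f (chartMap x (ζ : OnePoint ℂ)))))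
      (toComplex (chartMap x x))

/-- `f` restricts to a conformal map of `G` onto `G'`: a holomorphic bijection. -/
def IsConformalOnto (f : OnePoint ℂ → OnePoint ℂ) (G G' : Set (OnePoint ℂ)) : Prop :=
  Set.BijOn f G G' ∧ ∀ x ∈ G, HolomorphicAt f x

/-- Circles of the Riemann sphere: Euclidean circles, and straight lines together with `∞`. -/
def IsSphereCircle (C : Set (OnePoint ℂ)) : Prop :=
  (∃ (c : ℂ) (r : ℝ), 0 < r ∧ C = (fun z : ℂ => (z : OnePoint ℂ)) '' Metric.sphere c r) ∨
    ∃ (u : ℂ) (b : ℝ), u ≠ 0 ∧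
      C = insert OnePoint.infty ((fun z : ℂ => (z : OnePoint ℂ)) '' {z | (conj u * z).re = b})

/-- A circle domain: a subdomain of the sphere all of whose boundary components are circles or
points. -/
def IsCircleDomain (G : Set (OnePoint ℂ)) : Prop :=
  IsOpen G ∧ IsConnected G ∧
    ∀ x ∈ frontier G, IsSphereCircle (connectedComponentIn (frontier G) x) ∨
      connectedComponentIn (frontier G) x = {x}

/-! ### The quotient collapsing the complementary components -/

/-- The connected components of the complement of `G`. -/
def complComponents (G : Set (OnePoint ℂ)) : Set (Set (OnePoint ℂ)) :=
  {p | ∃ x ∈ Gᶜ, p = connectedComponentIn Gᶜ x}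

/-- `x ∼ y` if `x = y ∈ G`, or if `x` and `y` lie in the same complementary component of `G`. -/
def CollapseRel (G : Set (OnePoint ℂ)) (x y : OnePoint ℂ) : Prop :=
  (x = y ∧ x ∈ G) ∨ ∃ p ∈ complComponents G, x ∈ p ∧ y ∈ p

theorem collapseRel_equivalence (G : Set (OnePoint ℂ)) : Equivalence (CollapseRel G) where
  refl x := by
    by_cases hx : x ∈ G
    · exact Or.inl ⟨rfl, hx⟩
    · have hx' : x ∈ Gᶜ := hx
      exact Or.inr ⟨_, ⟨x, hx', rfl⟩, mem_connectedComponentIn hx', mem_connectedComponentIn hx'⟩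
  symm := by
    rintro x y (⟨rfl, h⟩ | ⟨p, hp, h1, h2⟩)
    · exact Or.inl ⟨rfl, h⟩
    · exact Or.inr ⟨p, hp, h2, h1⟩
  trans := by
    rintro x y z (⟨rfl, h⟩ | ⟨p, hp, h1, h2⟩) (⟨rfl, h'⟩ | ⟨q, hq, h3, h4⟩)
    · exact Or.inl ⟨rfl, h⟩
    · exact Or.inr ⟨q, hq, h3, h4⟩
    · exact Or.inr ⟨p, hp, h1, h2⟩
    · obtain ⟨a, -, rfl⟩ := hp
      obtain ⟨b, -, rfl⟩ := hq
      refine Or.inr ⟨_, ⟨a, ?_, rfl⟩, h1, ?_⟩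
      · exact connectedComponentIn_nonempty_iff.1 ⟨x, h1⟩
      · rw [connectedComponentIn_eq h2, ← connectedComponentIn_eq h3]
        rwa [connectedComponentIn_eq h3] at h4 ⊢

/-- The equivalence relation collapsing each complementary component of `G` to a point. -/
def collapseSetoid (G : Set (OnePoint ℂ)) : Setoid (OnePoint ℂ) :=
  ⟨CollapseRel G, collapseRel_equivalence G⟩

/-- The space `Ĝ`: the sphere with every complementary component of `G` collapsed to a point,
with the quotient topology. -/
abbrev Collapse (G : Set (OnePoint ℂ)) : Type := Quotient (collapseSetoid G)

/-- The quotient map `π_G` of the sphere onto `Ĝ`. -/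
def collapseMap (G : Set (OnePoint ℂ)) (x : OnePoint ℂ) : Collapse G :=
  Quotient.mk (collapseSetoid G) x

/-- `F : Ĝ → Ĝ'` is a homeomorphic extension of `f : G → G'`. -/
def Extends {G G' : Set (OnePoint ℂ)} (f : OnePoint ℂ → OnePoint ℂ)
    (F : Collapse G ≃ₜ Collapse G') : Prop :=
  ∀ x ∈ G, F (collapseMap G x) = collapseMap G' (f x)

/-- The image under `F : Ĝ → Ĝ'` of a set `p` (for instance of a complementary component of `G`,
that is, of a point of `Ĝ`), as a subset of the sphere. -/
def hatImage {G G' : Set (OnePoint ℂ)} (F : Collapse G ≃ₜ Collapse G') (p : Set (OnePoint ℂ)) :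
    Set (OnePoint ℂ) :=
  collapseMap G' ⁻¹' (F '' (collapseMap G '' p))

/-! ### Disks -/

/-- A center and a radius. -/
structure Disk where
  center : ℂ
  radius : ℝ

/-- The closed disk with the given center and radius, as a subset of the plane. -/
def Disk.toSet (D : Disk) : Set ℂ := Metric.closedBall D.center D.radius

/-- The disk `τ D` with the same center and `τ` times the radius. -/
def Disk.dilate (τ : ℝ) (D : Disk) : Disk := ⟨D.center, τ * D.radius⟩

/-- A subset of the plane as a subset of the sphere. -/
def onSphere (A : Set ℂ) : Set (OnePoint ℂ) := (fun z : ℂ => (z : OnePoint ℂ)) '' A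

/-! ### The numerical parameters of the construction -/

/-- The parameters of one level: `N`, `s`, `a`, `ε` are the parameters of the building block, which
lives over the unit segment `i[0,1]`, and `L` is the factor by which the block is scaled. -/
structure Level where
  N : ℕ
  s : ℝ
  a : ℝ
  ε : ℝ
  L : ℝ

/-- Half the height of the rectangles, and the radius of the disks. -/
def Level.r (P : Level) : ℝ := P.L * P.s

/-- Half the width of the rectangles. -/
def Level.t (P : Level) : ℝ := P.L * P.ε

/-- The length of the removed segments. -/
def Level.δ (P : Level) : ℝ := P.L * P.a

/-- The height of each of the two halves `J(Do)`, `J(Up)` of a vertical side of a rectangle, which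
remain when the middle open segment of length `δ` is removed. -/
def Level.half (P : Level) : ℝ := P.r - P.δ / 2

/-- The half width `t` of a rectangle, in the scale in which `J(Do)` and `J(Up)` have length `1`. -/
def Level.epsHat (P : Level) : ℝ := P.t / P.half

/-- The first level: two segments of length `2 s` and one gap of length `a` fill `[0,1]`, and
`ε = a / 100 = s / 10 ^ 5`. -/
def firstLevel : Level where
  N := 2
  s := 1000 / 4001
  a := 1 / 4001
  ε := 1 / 400100
  L := 1

/-- The parameter `N` of the level that follows the level `P`. -/
def nextN (P : Level) : ℕ := 2 * ⌈100 / P.epsHat⌉₊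

/-- The ratio `a / s` of level `k` if `N` is its number of letters. -/
def gapRatio (k N : ℕ) : ℝ := 1 / Real.exp ((2 * (N : ℝ)) ^ (2 * k))

/-- The half length `s` of the segments of level `k`: the numbers `s` and `a = gapRatio k N * s`
satisfy `(N / 2) * (2 * s) + (N / 2 - 1) * a = 1`. -/
def nextS (k N : ℕ) : ℝ := 1 / ((N : ℝ) + ((N : ℝ) / 2 - 1) * gapRatio k N)

/-- The level `k`, if `P` is the level `k - 1` (`2 ≤ k`). -/
def nextLevel (k : ℕ) (P : Level) : Level where
  N := nextN P
  s := nextS k (nextN P)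
  a := gapRatio k (nextN P) * nextS k (nextN P)
  ε := min (P.epsHat / 100) (gapRatio k (nextN P) * nextS k (nextN P) / 100)
  L := P.half

/-- The parameters of level `k` for `k = 1, 2, …` (the value at `k = 0` is not used). -/
def level : ℕ → Level
  | 0 => firstLevel
  | 1 => firstLevel
  | k + 2 => nextLevel (k + 2) (level (k + 1))

/-- The center of the `n`-th (`n = 1, 2, …`) of the segments of length `2 s` that are separated by
gaps of length `a` and start at `0`. -/
def blockCenter (s a : ℝ) (n : ℕ) : ℝ := ((n : ℝ) - 1) * (2 * s + a) + s

/-! ### Words, rectangles and disks -/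

inductive Side
  | Le
  | Ri

/-- `-1` on the left, `1` on the right. -/
def Side.sign : Side → ℝ
  | Side.Le => -1
  | Side.Ri => 1

/-- A pair `(m̃, ñ)`. The words are stored with their last letter first: the word
`n₁ n₂ ⋯ n_k` is the list `[n_k, …, n₂, n₁]`. -/
structure Word where
  m : List Side
  n : List ℕ

/-- All letters satisfy `1 ≤ n_j ≤ N_j`. -/
def ValidLetters : List ℕ → Prop
  | [] => True
  | n :: ns => (1 ≤ n ∧ n ≤ (level (ns.length + 1)).N) ∧ ValidLetters ns

/-- The set `W_k` of pairs of words of length `k`. -/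
def words (k : ℕ) : Set Word := {w | w.m.length = k ∧ w.n.length = k ∧ ValidLetters w.n}

/-- The first coordinate of the center of the rectangle. At the first level it is `-2` or `2`;
afterwards the block is moved by `± ε̂ / 2` and scaled by the height of `J(Do)` and `J(Up)`. -/
def xCoord : List Side → ℝ
  | [] => 0
  | [m] => m.sign * 2
  | m :: m' :: ms =>
      xCoord (m' :: ms) +
        (level (ms.length + 1)).half * (m.sign * ((level (ms.length + 1)).epsHat / 2))

/-- The second coordinate of the center of the rectangle. The first `N_k / 2` children sit over the
lower half `J(Do)` of the side of the parent, the other ones over the upper half `J(Up)`; in both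
cases the block over `[0,1]` is carried there by the homothety. -/
def yCoord : List ℕ → ℝ
  | [] => 0
  | [n] => blockCenter (level 1).s (level 1).a n
  | n :: n' :: ns =>
      let P := level (ns.length + 1)
      let Q := level (ns.length + 2)
      if n ≤ Q.N / 2 then
        yCoord (n' :: ns) - P.r + P.half * blockCenter Q.s Q.a n
      else
        yCoord (n' :: ns) + P.δ / 2 + P.half * blockCenter Q.s Q.a (n - Q.N / 2)

/-- The closed rectangle `R^w` of a word `w` of length `k`. -/
def rect (k : ℕ) (w : Word) : Set ℂ :=
  Set.Icc (xCoord w.m - (level k).t) (xCoord w.m + (level k).t) ×ℂ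
    Set.Icc (yCoord w.n - (level k).r) (yCoord w.n + (level k).r)

/-- The disks `D^w(Le)` and `D^w(Ri)` of a word `w` of length `k`. -/
def disk (k : ℕ) (w : Word) (σ : Side) : Disk where
  center := ⟨xCoord w.m + σ.sign * (2 * (level k).t + (level k).r), yCoord w.n⟩
  radius := (level k).r

/-- The set `E × F`. -/
def cantorProduct : Set ℂ := ⋂ k ∈ Set.Ici 1, ⋃ w ∈ words k, rect k w

/-- The union of all the disks. -/
def diskUnion : Set ℂ := ⋃ k ∈ Set.Ici 1, ⋃ w ∈ words k, ⋃ σ : Side, (disk k w σ).toSet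

/-- The domain `Ω`, whose complement consists of the disks and of `E × F`. -/
def Omega : Set (OnePoint ℂ) := (onSphere (diskUnion ∪ cantorProduct))ᶜ

/-! ### Neighboring disks -/

/-- The last letter `n` of a word of length `k` is the lowest one in its block. (At the first level
there is only one block; later the blocks are `1, …, N_k / 2` and `N_k / 2 + 1, …, N_k`.) -/
def IsBottom (k n : ℕ) : Prop := n = 1 ∨ (2 ≤ k ∧ n = (level k).N / 2 + 1)

/-- The last letter `n` of a word of length `k` is the highest one in its block. -/
def IsTop (k n : ℕ) : Prop := (2 ≤ k ∧ n = (level k).N / 2) ∨ n = (level k).N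

open Classical in
/-- The ordered list of the neighbors belonging to the word `w = (m̃, ñ n_k)` of length `k`;
`w ± 1` is the word with `n_k ± 1` in place of `n_k`. -/
def neighborList (k : ℕ) (w : Word) : List Disk :=
  match w.n with
  | [] => []
  | n :: ns =>
      let up : Word := ⟨w.m, (n + 1) :: ns⟩
      let dn : Word := ⟨w.m, (n - 1) :: ns⟩
      if IsBottom k n then
        [disk k w Side.Ri, disk k up Side.Ri, disk k up Side.Le, disk k w Side.Le]
      else if IsTop k n then
        [disk k dn Side.Ri, disk k w Side.Ri, disk k w Side.Le, disk k dn Side.Le]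
      else
        [disk k dn Side.Ri, disk k w Side.Ri, disk k up Side.Ri,
          disk k up Side.Le, disk k w Side.Le, disk k dn Side.Le]

/-- The collection of the `k`-th level neighbors of `z`: the neighbors belonging to the word
`w ∈ W_k` with `z ∈ R^w`. -/
def neighbors (k : ℕ) (z : ℂ) : Set Disk :=
  {D | ∃ w ∈ words k, z ∈ rect k w ∧ D ∈ neighborList k w}

end RigidCircle

end

/-! ### Continuous logarithms and integer-valued functions on the sphere. -/

noncomputable section
namespace RigidCircle
open Set Filter OnePoint

/-! ### Continuous logarithms on the sphere -/

/-! The argument has a topological half and a metric half.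

Topology. A continuous function on the sphere that is integer valued off a compact subset of a
domain `G` is constant on every complementary component of `G`, and such functions separate the
points of the collapsed space (`exists_separating_function`). Let χ be such a function for the
target domain. Then χ ∘ f is again integer valued off a compact subset of the source, so exp(2πi χ ∘
f), set equal to 1 off the source, is continuous. It has a continuous logarithm because the sphere
is simply connected (`exists_continuous_exp_eq`). Thus χ ∘ f extends continuously to the sphere, f
has a single cluster value at each point of the collapsed space, and f and its inverse both extend
(`exists_homeomorph_collapse_extension`). The same logarithm shows that the frontier of a
complementary component is connected; hence the complementary components of a circle domain
containing ∞ are closed disks or points (`exists_eq_closedBall_of_isCircleDomain`).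

Metric. Let an injective holomorphic map be given on a region swept out by parallel segments at most
three times as long as the family is wide. If the images of all the segments meet a disk of radius
r, then the image of some segment stays in the concentric disk of radius e^20 r
(`shortFamily_vertical`). Otherwise every image crosses the annulus between the two circles, so it
has length at least 20 in the metric |dw|/|w - c|. The annulus has area only 40π in this metric, too
little for so many long curves. Such families run through the channels of Ω: between the two disks
of a word, between the disks of consecutive words, and in the free space beyond a bottom or a top.
Since segments end on disks or cross each other, they transport estimates from one image disk to the
next.

Conclusion. A point z of E × F in R^w avoids the middle gap of R^w. It is therefore enclosed by a
box whose boundary consists of segments from these families and of parts of the disks of w and w ±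
1, or of w alone at a bottom or a top. Starting from the disk with the largest image, the estimates
put the image of the whole boundary into 10^30 times that image. The extension is a homeomorphism
and ∞ lies outside the box, so the image of z lies there too
(`ConformalExtension.preimage_subset_of_box`, `controls_of_box`). -/

theorem isPreconnected_constant_of_int {X : Type*} [TopologicalSpace X] {S : Set X}
    (hS : IsPreconnected S) {φ : X → ℝ} (hφ : ContinuousOn φ S)
    (hZ : ∀ x ∈ S, ∃ n : ℤ, φ x = n) {x y : X} (hx : x ∈ S) (hy : y ∈ S) : φ x = φ y := by
  exact hS.constant_of_mapsTo (T := range ((↑) : ℤ → ℝ))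
    Int.isClosedEmbedding_coe_real.isInducing.isDiscrete_range hφ
    (fun z hz => by obtain ⟨n, hn⟩ := hZ z hz; exact ⟨n, hn.symm⟩) hx hy

/-- Two continuous logarithms of the same function differ by an integer multiple of 2πi, and this
integer cannot jump on a preconnected set. -/
theorem isPreconnected_sub_eq_of_exp_eq {X : Type*} [TopologicalSpace X] {S : Set X}
    (hS : IsPreconnected S) {φ ψ : X → ℂ} (hφ : ContinuousOn φ S) (hψ : ContinuousOn ψ S)
    (h : ∀ x ∈ S, Complex.exp (φ x) = Complex.exp (ψ x)) {x y : X} (hx : x ∈ S) (hy : y ∈ S) :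
    φ x - ψ x = φ y - ψ y := by
  have key : ∀ z ∈ S, ∃ n : ℤ, φ z - ψ z = n * (2 * Real.pi * Complex.I) := by
    intro z hz
    obtain ⟨n, hn⟩ := Complex.exp_eq_exp_iff_exists_int.1 (h z hz)
    exact ⟨n, by rw [hn]; ring⟩
  have hpi : (2 * Real.pi * Complex.I : ℂ) ≠ 0 := by simp [Real.pi_ne_zero]
  have h1 : ((φ x - ψ x) / (2 * Real.pi * Complex.I)).re =
      ((φ y - ψ y) / (2 * Real.pi * Complex.I)).re := by
    refine isPreconnected_constant_of_int (φ := fun z =>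
      ((φ z - ψ z) / (2 * Real.pi * Complex.I)).re) hS ?_ ?_ hx hy
    · exact Complex.continuous_re.comp_continuousOn ((hφ.sub hψ).div_const _)
    · intro z hz
      obtain ⟨n, hn⟩ := key z hz
      refine ⟨n, ?_⟩
      simp only [hn]
      rw [mul_div_cancel_right₀ _ hpi]
      simp
  obtain ⟨n, hn⟩ := key x hx
  obtain ⟨m, hm⟩ := key y hy
  rw [hn, hm, mul_div_cancel_right₀ _ hpi, mul_div_cancel_right₀ _ hpi] at h1
  have h2 : n = m := by simpa using h1
  rw [hn, hm, h2]

theorem isPreconnected_norm_gt (M : ℝ) (hM : 0 < M) : IsPreconnected {z : ℂ | M < ‖z‖} := by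
  have : {z : ℂ | M < ‖z‖} = Complex.exp '' {z : ℂ | Real.log M < z.re} := by
    ext z
    constructor
    · intro hz
      have hz' : M < ‖z‖ := hz
      have h0 : z ≠ 0 := by
        rintro rfl
        simp at hz'
        linarith
      refine ⟨Complex.log z, ?_, Complex.exp_log h0⟩
      simp only [mem_ofPred_eq, Complex.log_re]
      exact Real.log_lt_log hM hz'
    · rintro ⟨w, hw, rfl⟩
      simp only [mem_ofPred_eq, Complex.norm_exp] at hw ⊢
      rwa [← Real.log_lt_iff_lt_exp hM]
  rw [this]
  exact (convex_halfSpace_re_gt _).isPreconnected.image _ Complex.continuous_exp.continuousOn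

/-- The plane is simply connected, so a logarithm `g` exists there. Near ∞ the quotient `E / E ∞` is
close to 1 and the principal branch gives another logarithm. On the connected set |z| > M the two
differ by a constant, so `g` has a limit at ∞. -/
theorem exists_continuous_exp_eq {E : OnePoint ℂ → ℂ} (hE : Continuous E) (h0 : ∀ x, E x ≠ 0) :
    ∃ ψ : OnePoint ℂ → ℂ, Continuous ψ ∧ ∀ x, Complex.exp (ψ x) = E x := by
  have hsc : IsSimplyConnected (univ : Set ℂ) := by
    have : ContractibleSpace (univ : Set ℂ) := (Homeomorph.Set.univ ℂ).contractibleSpace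
    exact (inferInstance : SimplyConnectedSpace (univ : Set ℂ))
  obtain ⟨g, hg, hgE⟩ := Complex.exists_continuousOn_eqOn_exp_comp hsc isOpen_univ
    (g := fun z : ℂ => E (z : OnePoint ℂ)) (hE.comp continuous_coe).continuousOn
    (by rintro ⟨z, -, hz⟩; exact h0 _ hz)
  rw [continuousOn_univ] at hg
  have hgE' : ∀ z : ℂ, Complex.exp (g z) = E z := fun z => hgE (mem_univ z)
  -- near infinity compare with the principal logarithm
  set F : ℂ → ℂ := fun z => Complex.log (E z / E ∞) + Complex.log (E ∞) with hF
  have hslit : ∀ᶠ x in 𝓝 (∞ : OnePoint ℂ), E x / E ∞ ∈ Complex.slitPlane := by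
    have hc : ContinuousAt (fun x => E x / E ∞) ∞ := (hE.div_const _).continuousAt
    refine hc.eventually_mem (Complex.isOpen_slitPlane.mem_nhds ?_)
    rw [div_self (h0 _)]
    exact Complex.one_mem_slitPlane
  have hcob : ∀ᶠ z : ℂ in Bornology.cobounded ℂ, E (z : OnePoint ℂ) / E ∞ ∈ Complex.slitPlane := by
    have := tendsto_coe_infty (X := ℂ)
    rw [Metric.cobounded_eq_cocompact, ← coclosedCompact_eq_cocompact]
    exact this.eventually hslit
  obtain ⟨M, hM⟩ : ∃ M : ℝ, 0 < M ∧ ∀ z : ℂ, M < ‖z‖ → E z / E ∞ ∈ Complex.slitPlane := by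
    rw [← comap_norm_atTop, eventually_comap] at hcob
    obtain ⟨M, hM⟩ := eventually_atTop.1 hcob
    exact ⟨max M 1, by positivity, fun z hz => hM ‖z‖ ((le_max_left _ _).trans hz.le) z rfl⟩
  obtain ⟨hM0, hM⟩ := hM
  set S : Set ℂ := {z : ℂ | M < ‖z‖}
  have hFc : ContinuousOn F S := by
    refine ContinuousOn.add (ContinuousOn.clog ?_ fun z hz => hM z hz) continuousOn_const
    exact ((hE.comp continuous_coe).div_const _).continuousOn
  have hexp : ∀ z ∈ S, Complex.exp (g z) = Complex.exp (F z) := by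
    intro z hz
    rw [hgE', hF]
    simp only
    rw [Complex.exp_add, Complex.exp_log (div_ne_zero (h0 _) (h0 _)), Complex.exp_log (h0 _),
      div_mul_cancel₀ _ (h0 _)]
  set p : ℂ := ((M + 1 : ℝ) : ℂ)
  have hp : p ∈ S := by
    simp only [S, p, mem_ofPred_eq, Complex.norm_real]
    exact (lt_add_one M).trans_le (le_abs_self _)
  have hconst : ∀ z ∈ S, g z = F z + (g p - F p) := by
    intro z hz
    have := isPreconnected_sub_eq_of_exp_eq (isPreconnected_norm_gt M hM0) hg.continuousOn hFc
      hexp hz hp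
    linear_combination this
  have hlim : Tendsto g (coclosedCompact ℂ) (𝓝 (Complex.log (E ∞) + (g p - F p))) := by
    have h1 : Tendsto (fun z : ℂ => F z + (g p - F p)) (coclosedCompact ℂ)
        (𝓝 (Complex.log (E ∞) + (g p - F p))) := by
      have h2 : ContinuousAt (fun x => Complex.log (E x / E ∞)) ∞ := by
        refine ContinuousAt.clog (hE.div_const _).continuousAt ?_
        rw [div_self (h0 _)]
        exact Complex.one_mem_slitPlane
      have h3 := (h2.tendsto.comp (tendsto_coe_infty (X := ℂ)))
      rw [div_self (h0 _), Complex.log_one] at h3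
      have h4 := (h3.add_const (Complex.log (E ∞))).add_const (g p - F p)
      rw [zero_add] at h4
      exact h4
    refine h1.congr' ?_
    rw [coclosedCompact_eq_cocompact, ← Metric.cobounded_eq_cocompact, ← comap_norm_atTop]
    refine eventually_comap.2 ((eventually_gt_atTop M).mono ?_)
    rintro b hb z rfl
    exact (hconst z hb).symm
  have hpE : Complex.exp (Complex.log (E ∞) + (g p - F p)) = E ∞ := by
    have : Complex.exp (g p - F p) = 1 := by
      rw [Complex.exp_sub, hexp p hp, div_self (Complex.exp_ne_zero _)]
    rw [Complex.exp_add, this, Complex.exp_log (h0 _), mul_one]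
  refine ⟨fun x => x.elim (Complex.log (E ∞) + (g p - F p)) g,
    ?_, ?_⟩
  · rw [OnePoint.continuous_iff]
    exact ⟨hlim, hg⟩
  · intro x
    induction x using OnePoint.rec with
    | infty => exact hpE
    | coe z => exact hgE' z

/-! ### Functions that are integer valued near the complement of a domain -/

theorem exp_two_pi_eq_one_iff (t : ℝ) :
    Complex.exp (t * (2 * Real.pi * Complex.I)) = 1 ↔ ∃ n : ℤ, t = n := by
  rw [Complex.exp_eq_one_iff]
  have hpi : (2 * Real.pi * Complex.I : ℂ) ≠ 0 := by simp [Real.pi_ne_zero]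
  refine exists_congr fun n => ?_
  rw [mul_left_inj' hpi]
  norm_cast

/-- A continuous function on a domain `G` of the sphere which is integer valued off a compact
subset of `G` extends continuously to the sphere, with integer values off `G`. -/
theorem exists_extension_of_int_valued {G L : Set (OnePoint ℂ)} (hGo : IsOpen G)
    (hGc : IsConnected G) {χ : OnePoint ℂ → ℝ} (hχ : ContinuousOn χ G) (hL : IsCompact L)
    (hLG : L ⊆ G) (hZ : ∀ x ∈ G \ L, ∃ n : ℤ, χ x = n) :
    ∃ ψ : OnePoint ℂ → ℝ, Continuous ψ ∧ EqOn ψ χ G ∧ ∀ x ∉ G, ∃ n : ℤ, ψ x = n := by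
  classical
  set e : ℝ → ℂ := fun t => Complex.exp (t * (2 * Real.pi * Complex.I)) with he
  have hec : Continuous e := by fun_prop
  have hpi : (2 * Real.pi * Complex.I : ℂ) ≠ 0 := by simp [Real.pi_ne_zero]
  -- Near a point off `G` the compact set `L` is avoided, so χ is an integer at the nearby points of
  -- `G` and both branches of the definition equal 1.
  set E : OnePoint ℂ → ℂ := fun x => if x ∈ G then e (χ x) else 1 with hEdef
  have hE : Continuous E := by
    rw [continuous_iff_continuousAt]
    intro x
    by_cases hx : x ∈ G
    · have h1 : ContinuousAt (fun x => e (χ x)) x :=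
        hec.continuousAt.comp (hχ.continuousAt (hGo.mem_nhds hx))
      refine h1.congr ?_
      filter_upwards [hGo.mem_nhds hx] with y hy
      simp [hEdef, hy]
    · have h1 : Lᶜ ∈ 𝓝 x := hL.isClosed.isOpen_compl.mem_nhds fun h => hx (hLG h)
      refine (continuousAt_const (y := (1 : ℂ))).congr ?_
      filter_upwards [h1] with y hy
      by_cases hyG : y ∈ G
      · simp only [hEdef, hyG, if_true]
        exact ((exp_two_pi_eq_one_iff _).2 (hZ y ⟨hyG, hy⟩)).symm
      · simp [hEdef, hyG]
  have hE0 : ∀ x, E x ≠ 0 := by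
    intro x
    by_cases hx : x ∈ G <;> simp [hEdef, hx, he, Complex.exp_ne_zero]
  obtain ⟨ψ, hψ, hψE⟩ := exists_continuous_exp_eq hE hE0
  obtain ⟨x₀, hx₀⟩ := hGc.nonempty
  have hconst : ∀ x ∈ G, ψ x - χ x * (2 * Real.pi * Complex.I) =
      ψ x₀ - χ x₀ * (2 * Real.pi * Complex.I) := by
    intro x hx
    refine isPreconnected_sub_eq_of_exp_eq hGc.isPreconnected hψ.continuousOn
      (ψ := fun x => (χ x : ℂ) * (2 * Real.pi * Complex.I)) ?_ ?_ hx hx₀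
    · exact (Complex.continuous_ofReal.comp_continuousOn hχ).mul continuousOn_const
    · intro y hy
      rw [hψE]
      simp [hEdef, hy, he]
  -- The logarithm is fixed only up to 2πi ℤ; subtracting this `n` normalizes it to agree with χ on
  -- `G`.
  obtain ⟨n, hn⟩ : ∃ n : ℤ, ψ x₀ - χ x₀ * (2 * Real.pi * Complex.I) =
      n * (2 * Real.pi * Complex.I) := by
    have : Complex.exp (ψ x₀) = Complex.exp (χ x₀ * (2 * Real.pi * Complex.I)) := by
      rw [hψE]; simp [hEdef, hx₀, he]
    obtain ⟨n, hn⟩ := Complex.exp_eq_exp_iff_exists_int.1 this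
    exact ⟨n, by rw [hn]; ring⟩
  refine ⟨fun x => (ψ x / (2 * Real.pi * Complex.I)).re - n, ?_, ?_, ?_⟩
  · exact (Complex.continuous_re.comp (hψ.div_const _)).sub continuous_const
  · intro x hx
    have h1 := hconst x hx
    rw [hn] at h1
    have h2 : ψ x / (2 * Real.pi * Complex.I) = χ x + n := by
      rw [div_eq_iff hpi]
      linear_combination h1
    simp [h2]
  · intro x hx
    have h1 : Complex.exp (ψ x) = 1 := by rw [hψE]; simp [hEdef, hx]
    obtain ⟨m, hm⟩ := Complex.exp_eq_one_iff.1 h1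
    refine ⟨m - n, ?_⟩
    simp only [hm]
    rw [mul_div_cancel_right₀ _ hpi]
    simp

end RigidCircle
end

/-! ### The collapsed spaces and the extension of homeomorphisms to them. -/

noncomputable section
namespace RigidCircle
open Set Filter OnePoint

/-! ### Components of compact sets -/

/-- In a compact Hausdorff space a component is the intersection of the clopen sets containing it,
and by compactness one of these already lies in `V`. -/
theorem exists_closed_split {X : Type*} [TopologicalSpace X] [T2Space X] {K V : Set X}
    (hK : IsCompact K) {x : X} (hx : x ∈ K) (hV : IsOpen V)
    (hxV : connectedComponentIn K x ⊆ V) :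
    ∃ A B : Set X, IsClosed A ∧ IsClosed B ∧ Disjoint A B ∧ A ∪ B = K ∧ x ∈ A ∧ A ⊆ V := by
  have : CompactSpace K := isCompact_iff_compactSpace.1 hK
  rw [connectedComponentIn_eq_image hx, image_subset_iff, connectedComponent_eq_iInter_isClopen]
    at hxV
  have : Nonempty {s : Set K // IsClopen s ∧ (⟨x, hx⟩ : K) ∈ s} :=
    ⟨⟨univ, isClopen_univ, trivial⟩⟩
  obtain ⟨⟨Z, hZ, hxZ⟩, hZV⟩ := exists_subset_nhds_of_isCompact'
    (ι := {s : Set K // IsClopen s ∧ (⟨x, hx⟩ : K) ∈ s}) (V := fun s => s.1)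
    (U := ((↑) : K → X) ⁻¹' V)
    (by
      rintro ⟨s, hs, hxs⟩ ⟨t, ht, hxt⟩
      exact ⟨⟨s ∩ t, hs.inter ht, hxs, hxt⟩, inter_subset_left, inter_subset_right⟩)
    (fun s => s.2.1.1.isCompact) (fun s => s.2.1.1)
    (fun y hy => (hV.preimage continuous_subtype_val).mem_nhds (hxV hy))
  refine ⟨(↑) '' Z, (↑) '' Zᶜ, (hZ.1.isCompact.image continuous_subtype_val).isClosed,
    (hZ.compl.1.isCompact.image continuous_subtype_val).isClosed, ?_, ?_, ⟨_, hxZ, rfl⟩,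
    image_subset_iff.2 hZV⟩
  · exact (disjoint_image_iff Subtype.val_injective).2 disjoint_compl_right
  · rw [← image_union, union_compl_self, image_univ, Subtype.range_coe]

/-! ### The collapsed space -/

variable {G : Set (OnePoint ℂ)}

theorem continuous_collapseMap (G : Set (OnePoint ℂ)) : Continuous (collapseMap G) :=
  continuous_quotient_mk'

theorem surjective_collapseMap (G : Set (OnePoint ℂ)) : Function.Surjective (collapseMap G) :=
  Quotient.mk_surjective

theorem collapseMap_eq_iff {x y : OnePoint ℂ} :
    collapseMap G x = collapseMap G y ↔ CollapseRel G x y :=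
  Quotient.eq (r := collapseSetoid G)

theorem mem_complComponents_subset {p : Set (OnePoint ℂ)} (hp : p ∈ complComponents G) :
    p ⊆ Gᶜ := by
  obtain ⟨x, -, rfl⟩ := hp
  exact connectedComponentIn_subset _ _

theorem eq_of_mem_complComponents {p : Set (OnePoint ℂ)} (hp : p ∈ complComponents G)
    {x : OnePoint ℂ} (hx : x ∈ p) : p = connectedComponentIn Gᶜ x := by
  obtain ⟨y, -, rfl⟩ := hp
  exact connectedComponentIn_eq hx

theorem collapseRel_iff_of_mem {x y : OnePoint ℂ} (hx : x ∈ G) : CollapseRel G x y ↔ x = y := by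
  refine ⟨?_, fun h => Or.inl ⟨h, hx⟩⟩
  rintro (⟨h, -⟩ | ⟨p, hp, h1, -⟩)
  · exact h
  · exact absurd hx (mem_complComponents_subset hp h1)

theorem collapseRel_iff_of_notMem {x y : OnePoint ℂ} (hx : x ∉ G) :
    CollapseRel G x y ↔ y ∈ connectedComponentIn Gᶜ x := by
  constructor
  · rintro (⟨-, h⟩ | ⟨p, hp, h1, h2⟩)
    · exact absurd h hx
    · rwa [← eq_of_mem_complComponents hp h1]
  · intro h
    exact Or.inr ⟨_, ⟨x, hx, rfl⟩, mem_connectedComponentIn hx, h⟩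

theorem preimage_collapseMap_singleton {x : OnePoint ℂ} (hx : x ∉ G) :
    collapseMap G ⁻¹' {collapseMap G x} = connectedComponentIn Gᶜ x := by
  ext y
  rw [mem_preimage, mem_singleton_iff, eq_comm, collapseMap_eq_iff, collapseRel_iff_of_notMem hx]

theorem preimage_image_collapseMap_of_subset {U : Set (OnePoint ℂ)} (hU : U ⊆ G) :
    collapseMap G ⁻¹' (collapseMap G '' U) = U := by
  refine Subset.antisymm ?_ (subset_preimage_image _ _)
  rintro y ⟨x, hx, hxy⟩
  rw [collapseMap_eq_iff, collapseRel_iff_of_mem (hU hx)] at hxy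
  exact hxy ▸ hx

theorem isOpen_collapse_iff {s : Set (Collapse G)} :
    IsOpen s ↔ IsOpen (collapseMap G ⁻¹' s) := Iff.rfl

/-- A function which is continuous on the sphere and integer valued off `G` is constant on the
fibers of the quotient map. -/
theorem eq_of_collapseRel {χ : OnePoint ℂ → ℝ} (hχ : Continuous χ)
    (hZ : ∀ x ∉ G, ∃ n : ℤ, χ x = n) {x y : OnePoint ℂ} (h : CollapseRel G x y) : χ x = χ y := by
  rcases h with ⟨h, -⟩ | ⟨p, hp, hx, hy⟩
  · rw [h]
  · have hpre : IsPreconnected p := by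
      obtain ⟨z, -, rfl⟩ := hp
      exact isPreconnected_connectedComponentIn
    exact isPreconnected_constant_of_int hpre hχ.continuousOn
      (fun z hz => hZ z (mem_complComponents_subset hp hz)) hx hy

/-- Points of the collapsed space are separated by functions which are integer valued off a compact
subset of `G`. -/
theorem exists_separating_function (hG : IsOpen G) {x y : OnePoint ℂ}
    (h : ¬ CollapseRel G x y) :
    ∃ (χ : OnePoint ℂ → ℝ) (L : Set (OnePoint ℂ)), Continuous χ ∧ IsCompact L ∧ L ⊆ G ∧
      (∀ z ∉ L, ∃ n : ℤ, χ z = n) ∧ χ x ≠ χ y := by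
  -- If one of the points lies in `G`, a Urysohn function truncated below 1/2 works: it vanishes
  -- outside a compact subset of `G`.
  have bump : ∀ x y : OnePoint ℂ, x ∈ G → x ≠ y →
    ∃ (χ : OnePoint ℂ → ℝ) (L : Set (OnePoint ℂ)), Continuous χ ∧ IsCompact L ∧ L ⊆ G ∧
      (∀ z ∉ L, ∃ n : ℤ, χ z = n) ∧ χ x ≠ χ y := by
    intro x y hx hxy
    obtain ⟨u, hu0, hu1, -⟩ := exists_continuous_zero_one_of_isClosed
      (s := {y} ∪ Gᶜ) (t := {x}) (isClosed_singleton.union hG.isClosed_compl) isClosed_singleton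
      (by
        rw [disjoint_singleton_right]
        rintro (h | h)
        · exact hxy h
        · exact h hx)
    refine ⟨fun z => max 0 (2 * u z - 1), {z | 1 / 2 ≤ u z}, by fun_prop,
      (isClosed_le continuous_const u.continuous).isCompact, ?_, ?_, ?_⟩
    · intro z hz
      by_contra hzG
      have h1 : u z = 0 := hu0 (Or.inr hzG)
      have h2 : (1 / 2 : ℝ) ≤ u z := hz
      rw [h1] at h2
      norm_num at h2
    · intro z hz
      have h2 : u z < 1 / 2 := not_le.1 hz
      exact ⟨0, by simp; linarith⟩
    · have h1 : u x = 1 := hu1 rfl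
      have h2 : u y = 0 := hu0 (Or.inl rfl)
      simp [h1, h2]
      norm_num
  by_cases hx : x ∈ G
  · exact bump x y hx fun hxy => h ((collapseRel_iff_of_mem hx).2 hxy)
  by_cases hy : y ∈ G
  · obtain ⟨χ, L, h1, h2, h3, h4, h5⟩ := bump y x hy fun hxy => hx (hxy ▸ hy)
    exact ⟨χ, L, h1, h2, h3, h4, h5.symm⟩
  have hK : IsCompact Gᶜ := hG.isClosed_compl.isCompact
  rw [collapseRel_iff_of_notMem hx] at h
  obtain ⟨A, B, hA, hB, hAB, hU, hxA, hAy⟩ := exists_closed_split hK hx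
    (isClosed_singleton (x := y)).isOpen_compl (by
      intro z hz hzy
      exact h (hzy ▸ hz))
  have hyB : y ∈ B := by
    have : y ∈ A ∪ B := hU ▸ hy
    exact this.resolve_left fun hyA => hAy hyA rfl
  obtain ⟨u, hu0, hu1, -⟩ := exists_continuous_zero_one_of_isClosed hA hB hAB
  -- The truncation is 0 where u < 1/3 and 1 where u > 2/3. The remaining collar misses `A ∪ B`, the
  -- whole complement of `G`, because u is 0 on `A` and 1 on `B`.
  refine ⟨fun z => max 0 (min 1 (3 * u z - 1)), {z | 1 / 3 ≤ u z ∧ u z ≤ 2 / 3}, by fun_prop,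
    ((isClosed_le continuous_const u.continuous).inter
      (isClosed_le u.continuous continuous_const)).isCompact, ?_, ?_, ?_⟩
  · rintro z ⟨hz1, hz2⟩
    by_contra hzG
    have : z ∈ A ∪ B := hU ▸ hzG
    rcases this with hz | hz
    · have h1 : u z = 0 := hu0 hz
      rw [h1] at hz1; norm_num at hz1
    · have h1 : u z = 1 := hu1 hz
      rw [h1] at hz2; norm_num at hz2
  · intro z hz
    by_cases hz1 : 1 / 3 ≤ u z
    · have hz2 : 2 / 3 < u z := not_le.1 fun h2 => hz ⟨hz1, h2⟩
      refine ⟨1, ?_⟩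
      simp only
      rw [min_eq_left (by linarith)]
      simp
    · refine ⟨0, ?_⟩
      push Not at hz1
      simp only
      rw [min_eq_right (by linarith), max_eq_left (by linarith)]
      simp
  · have h1 : u x = 0 := hu0 hxA
    have h2 : u y = 1 := hu1 hyB
    simp [h1, h2]
    norm_num

theorem continuous_collapse_lift {Y : Type*} [TopologicalSpace Y] {χ : OnePoint ℂ → Y}
    (hχ : Continuous χ) (h : ∀ x y, CollapseRel G x y → χ x = χ y) :
    ∃ χ' : Collapse G → Y, Continuous χ' ∧ ∀ x, χ' (collapseMap G x) = χ x :=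
  ⟨Quotient.lift χ h, hχ.quotient_lift h, fun _ => rfl⟩

/-- The separating functions are constant on the fibers of the quotient map, so they descend and
separate the classes. -/
theorem collapse_t2Space (hG : IsOpen G) : T2Space (Collapse G) := by
  refine ⟨fun a b hab => ?_⟩
  obtain ⟨x, rfl⟩ := surjective_collapseMap G a
  obtain ⟨y, rfl⟩ := surjective_collapseMap G b
  obtain ⟨χ, L, hχ, -, hLG, hZ, hxy⟩ := exists_separating_function hG
    fun h => hab (collapseMap_eq_iff.2 h)
  obtain ⟨χ', hχ', hχ'e⟩ := continuous_collapse_lift hχ fun x y h =>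
    eq_of_collapseRel hχ (fun z hz => hZ z fun hzL => hz (hLG hzL)) h
  exact separated_by_continuous hχ' (by rwa [hχ'e, hχ'e])

theorem isClosedMap_collapseMap (hG : IsOpen G) : IsClosedMap (collapseMap G) := by
  have := collapse_t2Space hG
  exact (continuous_collapseMap G).isClosedMap

/-- An open set of classes that misses `G` would contain a closed piece `A` of the complement that
is split off from the rest. Such a piece is also open in the sphere, against the connectedness of
the sphere. -/
theorem dense_image_collapseMap (hG : IsOpen G) (hne : G.Nonempty) :
    Dense (collapseMap G '' G) := by
  have := collapse_t2Space hG
  rw [dense_iff_inter_open]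
  rintro O hO ⟨a, ha⟩
  obtain ⟨x, rfl⟩ := surjective_collapseMap G a
  by_contra hemp
  rw [not_nonempty_iff_eq_empty] at hemp
  have hV : IsOpen (collapseMap G ⁻¹' O) := hO.preimage (continuous_collapseMap G)
  have hVK : collapseMap G ⁻¹' O ⊆ Gᶜ := fun z hz hzG =>
    (eq_empty_iff_forall_notMem.1 hemp) _ ⟨hz, mem_image_of_mem _ hzG⟩
  have hxG : x ∈ Gᶜ := hVK ha
  obtain ⟨A, B, hA, hB, hAB, hU, hxA, hAV⟩ := exists_closed_split hG.isClosed_compl.isCompact hxG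
    hV (by
      rw [← preimage_collapseMap_singleton hxG]
      exact preimage_mono (singleton_subset_iff.2 ha))
  have hAo : IsOpen A := by
    have : A = (collapseMap G ⁻¹' O) ∩ Bᶜ := by
      ext z
      refine ⟨fun hz => ⟨hAV hz, disjoint_left.1 hAB hz⟩, fun hz => ?_⟩
      have : z ∈ A ∪ B := hU ▸ hVK hz.1
      exact this.resolve_right hz.2
    rw [this]
    exact hV.inter hB.isOpen_compl
  have hAu : A = univ := IsClopen.eq_univ ⟨hA, hAo⟩ ⟨x, hxA⟩
  obtain ⟨y, hy⟩ := hne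
  exact hVK (hAV (hAu ▸ mem_univ y)) hy

theorem isDenseInducing_collapseMap (hG : IsOpen G) (hne : G.Nonempty) :
    IsDenseInducing (fun x : G => collapseMap G x) := by
  have h : Topology.IsOpenEmbedding (fun x : G => collapseMap G x) := by
    refine Topology.IsOpenEmbedding.of_continuous_injective_isOpenMap
      ((continuous_collapseMap G).comp continuous_subtype_val) ?_ ?_
    · intro x y hxy
      exact Subtype.ext ((collapseRel_iff_of_mem x.2).1 (collapseMap_eq_iff.1 hxy))
    · intro U hU
      rw [isOpen_collapse_iff]
      have h1 : IsOpen ((↑) '' U : Set (OnePoint ℂ)) := hG.isOpenMap_subtype_val _ hU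
      have h2 : (fun x : G => collapseMap G x) '' U = collapseMap G '' ((↑) '' U) := by
        rw [image_image]
      rw [h2, preimage_image_collapseMap_of_subset (by simp)]
      exact h1
  refine ⟨h.isInducing, ?_⟩
  have h2 : range (fun x : G => collapseMap G x) = collapseMap G '' G := by
    rw [image_eq_range]
  rw [DenseRange, h2]
  exact dense_image_collapseMap hG hne

/-- A proper continuous map between domains extends continuously to the collapsed spaces. -/
theorem exists_continuous_collapse_extension {G G' : Set (OnePoint ℂ)} (hG : IsOpen G)
    (hGc : IsConnected G) (hG' : IsOpen G') {f : OnePoint ℂ → OnePoint ℂ} (hf : ContinuousOn f G)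
    (hproper : ∀ L : Set (OnePoint ℂ), IsCompact L → L ⊆ G' → IsCompact (G ∩ f ⁻¹' L)) :
    ∃ F : Collapse G → Collapse G', Continuous F ∧
      ∀ x ∈ G, F (collapseMap G x) = collapseMap G' (f x) := by
  have := collapse_t2Space hG
  have := collapse_t2Space hG'
  have di := isDenseInducing_collapseMap hG hGc.nonempty
  set φ : G → Collapse G' := fun x => collapseMap G' (f x) with hφdef
  -- The target is compact, so it suffices that there is only one cluster point. Two of them would
  -- be separated by some χ', while χ' ∘ φ has the limit ψ' b because χ ∘ f extends continuously.
  have hφ : ∀ b, ∃ c, Tendsto φ (comap (fun x : G => collapseMap G x) (𝓝 b)) (𝓝 c) := by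
    intro b
    have := di.comap_nhds_neBot b
    obtain ⟨c, hc⟩ := exists_clusterPt_of_compactSpace
      (map φ (comap (fun x : G => collapseMap G x) (𝓝 b)))
    refine ⟨c, le_nhds_of_unique_clusterPt fun c' hc' => ?_⟩
    by_contra hne
    obtain ⟨x, rfl⟩ := surjective_collapseMap G' c
    obtain ⟨y, rfl⟩ := surjective_collapseMap G' c'
    obtain ⟨χ, L, hχ, hL, hLG, hZ, hxy⟩ := exists_separating_function hG'
      fun h => hne (collapseMap_eq_iff.2 h)
    obtain ⟨χ', hχ', hχ'e⟩ := continuous_collapse_lift hχ fun x y h =>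
      eq_of_collapseRel hχ (fun z hz => hZ z fun hzL => hz (hLG hzL)) h
    obtain ⟨ψ, hψ, hψe, hψZ⟩ := exists_extension_of_int_valued hG hGc
      (χ := fun x => χ (f x)) (hχ.comp_continuousOn hf) (hproper L hL hLG) inter_subset_left
      (fun z hz => hZ _ fun hzL => hz.2 ⟨hz.1, hzL⟩)
    obtain ⟨ψ', hψ', hψ'e⟩ := continuous_collapse_lift hψ fun x y h =>
      eq_of_collapseRel hψ hψZ h
    have hlim : map χ' (map φ (comap (fun x : G => collapseMap G x) (𝓝 b))) ≤ 𝓝 (ψ' b) := by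
      have h1 : χ' ∘ φ = ψ' ∘ (fun x : G => collapseMap G x) := by
        ext z
        simp only [Function.comp_apply, hφdef, hχ'e, hψ'e]
        exact (hψe z.2).symm
      rw [map_map, h1, ← map_map]
      exact (map_mono map_comap_le).trans hψ'.continuousAt
    have hval : ∀ c, ClusterPt c (map φ (comap (fun x : G => collapseMap G x) (𝓝 b))) →
        χ' c = ψ' b := by
      intro c hc
      have h1 : ClusterPt (χ' c) (𝓝 (ψ' b)) :=
        (hc.map hχ'.continuousAt tendsto_map).mono hlim
      exact eq_of_nhds_neBot h1
    apply hxy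
    rw [← hχ'e, ← hχ'e, hval _ hc, hval _ hc']
  refine ⟨di.extend φ, di.continuous_extend hφ, fun x hx => ?_⟩
  exact di.extend_eq' hφ ⟨x, hx⟩

/-- A homeomorphism between domains of the sphere extends to a homeomorphism of the collapsed
spaces. -/
theorem exists_homeomorph_collapse_extension {G G' : Set (OnePoint ℂ)} (hG : IsOpen G)
    (hGc : IsConnected G) (hG' : IsOpen G') (hGc' : IsConnected G')
    {f g : OnePoint ℂ → OnePoint ℂ} (hf : ContinuousOn f G) (hg : ContinuousOn g G')
    (hfm : MapsTo f G G') (hgm : MapsTo g G' G) (hgf : LeftInvOn g f G) (hfg : LeftInvOn f g G') :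
    ∃ F : Collapse G ≃ₜ Collapse G', Extends f F := by
  have := collapse_t2Space hG
  have := collapse_t2Space hG'
  obtain ⟨F, hF, hFe⟩ := exists_continuous_collapse_extension hG hGc hG' hf (by
    intro L hL hLG
    have : G ∩ f ⁻¹' L = g '' L := by
      ext x
      refine ⟨fun hx => ⟨f x, hx.2, hgf hx.1⟩, ?_⟩
      rintro ⟨y, hy, rfl⟩
      exact ⟨hgm (hLG hy), by rw [mem_preimage, hfg (hLG hy)]; exact hy⟩
    rw [this]
    exact hL.image_of_continuousOn (hg.mono hLG))
  obtain ⟨H, hH, hHe⟩ := exists_continuous_collapse_extension hG' hGc' hG hg (by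
    intro L hL hLG
    have : G' ∩ g ⁻¹' L = f '' L := by
      ext x
      refine ⟨fun hx => ⟨g x, hx.2, hfg hx.1⟩, ?_⟩
      rintro ⟨y, hy, rfl⟩
      exact ⟨hfm (hLG hy), by rw [mem_preimage, hgf (hLG hy)]; exact hy⟩
    rw [this]
    exact hL.image_of_continuousOn (hf.mono hLG))
  refine ⟨⟨⟨F, H, ?_, ?_⟩, hF, hH⟩, hFe⟩
  · have : H ∘ F = id := by
      refine Continuous.ext_on (dense_image_collapseMap hG hGc.nonempty) (hH.comp hF)
        continuous_id ?_
      rintro _ ⟨x, hx, rfl⟩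
      simp [hFe x hx, hHe _ (hfm hx), hgf hx]
    exact congrFun this
  · have : F ∘ H = id := by
      refine Continuous.ext_on (dense_image_collapseMap hG' hGc'.nonempty) (hF.comp hH)
        continuous_id ?_
      rintro _ ⟨x, hx, rfl⟩
      simp [hHe x hx, hFe _ (hgm hx), hfg hx]
    exact congrFun this

end RigidCircle
end

/-! ### Complementary components of domains, and of circle domains in particular. -/

noncomputable section
namespace RigidCircle
open Set Filter OnePoint

/-! ### Complementary components of domains -/

variable {G : Set (OnePoint ℂ)}

theorem isClosed_of_mem_complComponents (hG : IsOpen G) {q : Set (OnePoint ℂ)}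
    (hq : q ∈ complComponents G) : IsClosed q := by
  obtain ⟨x, hx, rfl⟩ := hq
  have := collapse_t2Space hG
  rw [← preimage_collapseMap_singleton hx]
  exact isClosed_singleton.preimage (continuous_collapseMap G)

theorem isPreconnected_of_mem_complComponents {q : Set (OnePoint ℂ)}
    (hq : q ∈ complComponents G) : IsPreconnected q := by
  obtain ⟨x, hx, rfl⟩ := hq
  exact isPreconnected_connectedComponentIn

/-- Density of `G` in the collapsed space says that each other component meets the closure of `G`,
so it can be joined to `G` through such a point. -/
theorem isPreconnected_compl_component (hG : IsOpen G) (hGc : IsConnected G)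
    {q : Set (OnePoint ℂ)} (hq : q ∈ complComponents G) : IsPreconnected qᶜ := by
  have := collapse_t2Space hG
  obtain ⟨x₀, hx₀⟩ := hGc.nonempty
  have hGq : G ⊆ qᶜ := fun y hy hyq => mem_complComponents_subset hq hyq hy
  refine isPreconnected_of_forall x₀ fun y hy => ?_
  by_cases hyG : y ∈ G
  · exact ⟨G, hGq, hx₀, hyG, hGc.isPreconnected⟩
  have hdense : collapseMap G y ∈ collapseMap G '' closure G := by
    have h1 : IsClosed (collapseMap G '' closure G) :=
      isClosedMap_collapseMap hG _ isClosed_closure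
    have h2 := (dense_image_collapseMap hG hGc.nonempty).closure_eq
    have h3 : closure (collapseMap G '' G) ⊆ collapseMap G '' closure G :=
      closure_minimal (image_mono subset_closure) h1
    rw [h2] at h3
    exact h3 (mem_univ _)
  obtain ⟨z, hz, hzy⟩ := hdense
  rw [eq_comm, collapseMap_eq_iff, collapseRel_iff_of_notMem hyG] at hzy
  refine ⟨insert z G ∪ connectedComponentIn Gᶜ y, ?_, Or.inl (Or.inr hx₀),
    Or.inr (mem_connectedComponentIn hyG), ?_⟩
  · have h1 : connectedComponentIn Gᶜ y ⊆ qᶜ := by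
      intro w hw hwq
      apply hy
      rw [eq_of_mem_complComponents hq hwq, ← connectedComponentIn_eq hw]
      exact mem_connectedComponentIn hyG
    rintro w ((rfl | hw) | hw)
    · exact h1 hzy
    · exact hGq hw
    · exact h1 hw
  · refine IsPreconnected.union z (mem_insert _ _) hzy ?_ isPreconnected_connectedComponentIn
    exact hGc.isPreconnected.subset_closure (subset_insert _ _)
      (insert_subset hz subset_closure)

/-- This is unicoherence of the sphere. If the frontier splits, take `w₀` equal to 0 on one part and
1 on the other. The function exp(2πi w₀) on `q`, continued by 1, has a logarithm ψ. On `q` the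
difference ψ - 2πi w₀ is constant, and on the closure of the complement ψ is constant. Evaluating at
a point of each part gives 2πi = 0. -/
theorem isPreconnected_frontier_component (hG : IsOpen G) (hGc : IsConnected G)
    {q : Set (OnePoint ℂ)} (hq : q ∈ complComponents G) : IsPreconnected (frontier q) := by
  classical
  have hqcl := isClosed_of_mem_complComponents hG hq
  rw [isPreconnected_iff_subset_of_fully_disjoint_closed isClosed_frontier]
  intro u v hu hv huv hd
  by_contra! hcon
  obtain ⟨⟨b, hbF, hbu⟩, ⟨a, haF, hav⟩⟩ := And.imp not_subset.1 not_subset.1 hcon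
  have hau : a ∈ u := (huv haF).resolve_right hav
  have hbv : b ∈ v := (huv hbF).resolve_left hbu
  obtain ⟨w₀, hw0, hw1, -⟩ := exists_continuous_zero_one_of_isClosed hu hv hd
  set e : ℝ → ℂ := fun t => Complex.exp (t * (2 * Real.pi * Complex.I)) with he
  have hec : Continuous e := by fun_prop
  set E : OnePoint ℂ → ℂ := q.piecewise (fun x => e (w₀ x)) (fun _ => 1) with hEdef
  have hE : Continuous E := by
    refine Continuous.piecewise ?_ (hec.comp w₀.continuous) continuous_const
    intro x hx
    rcases huv hx with h | h
    · have : w₀ x = 0 := hw0 h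
      simp [he, this]
    · have : w₀ x = 1 := hw1 h
      simp only [he, this]
      exact (exp_two_pi_eq_one_iff 1).2 ⟨1, by simp⟩
  have hE0 : ∀ x, E x ≠ 0 := by
    intro x
    by_cases hx : x ∈ q <;> simp [hEdef, hx, he, Complex.exp_ne_zero]
  obtain ⟨ψ, hψ, hψE⟩ := exists_continuous_exp_eq hE hE0
  have hF : ∀ x ∈ frontier q, x ∈ q ∧ x ∈ closure qᶜ := fun x hx =>
    ⟨hqcl.frontier_subset hx, (frontier_eq_closure_inter_closure (s := q) ▸ hx).2⟩
  have h1 := isPreconnected_sub_eq_of_exp_eq (isPreconnected_of_mem_complComponents hq)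
    hψ.continuousOn (ψ := fun x => (w₀ x : ℂ) * (2 * Real.pi * Complex.I))
    (by fun_prop) (fun x hx => by rw [hψE]; simp [hEdef, hx, he]) (hF a haF).1 (hF b hbF).1
  have hone : ∀ x ∈ closure qᶜ, Complex.exp (ψ x) = Complex.exp 0 := by
    intro x hx
    have hcl : IsClosed {x | Complex.exp (ψ x) = Complex.exp 0} :=
      isClosed_eq (Complex.continuous_exp.comp hψ) continuous_const
    refine closure_minimal (fun y hy => ?_) hcl hx
    have hy' : y ∉ q := hy
    rw [mem_ofPred_eq, hψE, Complex.exp_zero]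
    simp [hEdef, hy']
  have h2 := isPreconnected_sub_eq_of_exp_eq (isPreconnected_compl_component hG hGc hq).closure
    hψ.continuousOn (ψ := fun _ => 0) continuousOn_const hone (hF a haF).2 (hF b hbF).2
  have h3 : w₀ a = 0 := hw0 hau
  have h4 : w₀ b = 1 := hw1 hbv
  simp only [h3, h4, sub_zero] at h1 h2
  rw [h2] at h1
  have h5 : (2 * Real.pi * Complex.I : ℂ) = 0 := by
    simp only [Complex.ofReal_one, Complex.ofReal_zero] at h1
    linear_combination h1
  simp [Real.pi_ne_zero] at h5

theorem subset_or_subset_compl_of_disjoint_frontier {X : Type*} [TopologicalSpace X] {S q : Set X}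
    (hS : IsPreconnected S) (h : Disjoint S (frontier q)) : S ⊆ q ∨ S ⊆ qᶜ := by
  have hcov : S ⊆ interior q ∪ (closure q)ᶜ := by
    intro x hx
    by_contra hcon
    rw [mem_union, not_or, notMem_compl_iff] at hcon
    exact disjoint_left.1 h hx ⟨hcon.2, hcon.1⟩
  have hdis : Disjoint (interior q) (closure q)ᶜ :=
    disjoint_left.2 fun x hx hx' => hx' (subset_closure (interior_subset hx))
  rcases hS.subset_or_subset isOpen_interior isClosed_closure.isOpen_compl hdis hcov with h | h
  · exact Or.inl (h.trans interior_subset)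
  · exact Or.inr (h.trans (compl_subset_compl.2 subset_closure))

theorem mem_closure_coe_image_infty {S : Set ℂ} (hS : ∀ M : ℝ, ∃ z ∈ S, M ≤ ‖z‖) :
    (∞ : OnePoint ℂ) ∈ closure ((↑) '' S : Set (OnePoint ℂ)) := by
  rw [mem_closure_iff_frequently]
  intro h
  have h1 : ∀ᶠ z : ℂ in coclosedCompact ℂ, z ∉ S :=
    (tendsto_coe_infty (X := ℂ)).eventually (h.mono fun x hx => hx) |>.mono
      fun z hz hzS => hz ⟨z, hzS, rfl⟩
  rw [coclosedCompact_eq_cocompact, ← Metric.cobounded_eq_cocompact, ← comap_norm_atTop,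
    eventually_comap] at h1
  obtain ⟨M, hM⟩ := eventually_atTop.1 h1
  obtain ⟨z, hz, hzM⟩ := hS M
  exact hM _ hzM z rfl hz

/-- The exterior of a closed disk, with the point at infinity. -/
theorem isPreconnected_exterior (c : ℂ) {r : ℝ} (hr : 0 ≤ r) :
    IsPreconnected (onSphere (Metric.closedBall c r))ᶜ := by
  rcases hr.eq_or_lt with rfl | hr
  · have h1 : IsPreconnected ((↑) '' ({c}ᶜ : Set ℂ) : Set (OnePoint ℂ)) :=
      (isConnected_compl_singleton_of_one_lt_rank (by simp) c).isPreconnected.image _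
        continuous_coe.continuousOn
    refine h1.subset_closure ?_ ?_
    · rintro _ ⟨z, hz, rfl⟩ ⟨w, hw, hwz⟩
      rw [OnePoint.coe_eq_coe] at hwz
      rw [Metric.closedBall_zero] at hw
      exact hz (hwz ▸ hw)
    · intro x hx
      induction x using OnePoint.rec with
      | infty =>
        refine mem_closure_coe_image_infty fun M => ?_
        refine ⟨((max M (‖c‖ + 1) : ℝ) : ℂ), ?_, ?_⟩
        · intro h
          have h2 : ‖((max M (‖c‖ + 1) : ℝ) : ℂ)‖ = ‖c‖ := by rw [h]
          rw [Complex.norm_real, Real.norm_eq_abs] at h2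
          have := le_abs_self (max M (‖c‖ + 1))
          have := le_max_right M (‖c‖ + 1)
          linarith
        · rw [Complex.norm_real]
          exact (le_max_left _ _).trans (le_abs_self _)
      | coe z =>
        refine subset_closure ⟨z, fun h => hx ⟨z, ?_, rfl⟩, rfl⟩
        rw [Metric.closedBall_zero]
        exact h
  · have h0 : IsPreconnected ((fun z => z + c) '' {z : ℂ | r < ‖z‖}) :=
      (isPreconnected_norm_gt r hr).image _ (by fun_prop)
    have h1 : IsPreconnected ((↑) '' ((fun z => z + c) '' {z : ℂ | r < ‖z‖}) : Set (OnePoint ℂ)) :=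
      h0.image _ continuous_coe.continuousOn
    refine h1.subset_closure ?_ ?_
    · rintro _ ⟨_, ⟨z, hz, rfl⟩, rfl⟩ ⟨w, hw, hwz⟩
      rw [OnePoint.coe_eq_coe] at hwz
      rw [hwz, mem_closedBall_iff_norm, add_sub_cancel_right] at hw
      exact absurd hz (not_lt.2 hw)
    · intro x hx
      induction x using OnePoint.rec with
      | infty =>
        refine mem_closure_coe_image_infty fun M => ?_
        refine ⟨((|M| + ‖c‖ + r + 1 : ℝ) : ℂ) + c, ⟨_, ?_, rfl⟩, ?_⟩
        · simp only [mem_ofPred_eq, Complex.norm_real, Real.norm_eq_abs]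
          rw [abs_of_nonneg (by positivity)]
          have := abs_nonneg M
          have := norm_nonneg c
          linarith
        · have h2 := norm_sub_norm_le ((|M| + ‖c‖ + r + 1 : ℝ) : ℂ) (-c)
          rw [sub_neg_eq_add, norm_neg, Complex.norm_real, Real.norm_eq_abs,
            abs_of_nonneg (by positivity)] at h2
          have := le_abs_self M
          linarith
      | coe z =>
        refine subset_closure ⟨z, ⟨z - c, ?_, by ring⟩, rfl⟩
        by_contra h
        exact hx ⟨z, by rw [mem_closedBall_iff_norm]; exact not_lt.1 h, rfl⟩

theorem infty_notMem_onSphere (A : Set ℂ) : (∞ : OnePoint ℂ) ∉ onSphere A := by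
  rintro ⟨z, -, hz⟩
  exact OnePoint.coe_ne_infty z hz

theorem coe_mem_onSphere {A : Set ℂ} {z : ℂ} : (z : OnePoint ℂ) ∈ onSphere A ↔ z ∈ A := by
  constructor
  · rintro ⟨w, hw, h⟩
    rwa [← OnePoint.coe_eq_coe.1 h]
  · exact fun h => ⟨z, h, rfl⟩

/-- This carries the hypothesis on components of the frontier of `G` over to frontiers of
complementary components. A point of `q` away from the closure of `G` has a small disk in the
complement, which by connectedness lies in `q`, so it is interior to `q`. -/
theorem frontier_component_eq (hG : IsOpen G) (hGc : IsConnected G) (hinf : ∞ ∈ G)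
    {q : Set (OnePoint ℂ)} (hq : q ∈ complComponents G) {x : OnePoint ℂ} (hx : x ∈ frontier q) :
    x ∈ frontier G ∧ frontier q = connectedComponentIn (frontier G) x := by
  have hqcl := isClosed_of_mem_complComponents hG hq
  have hsub : frontier q ⊆ frontier G := by
    intro y hy
    have hyq := hqcl.frontier_subset hy
    have hyG := mem_complComponents_subset hq hyq
    rw [hG.frontier_eq]
    refine ⟨?_, hyG⟩
    by_contra hcl
    have hyinf : y ≠ ∞ := fun h => hyG (h ▸ hinf)
    lift y to ℂ using hyinf
    have hnhds : ((↑) : ℂ → OnePoint ℂ) ⁻¹' (closure G)ᶜ ∈ 𝓝 y :=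
      continuous_coe.continuousAt.preimage_mem_nhds (isClosed_closure.isOpen_compl.mem_nhds hcl)
    obtain ⟨ε, hε, hball⟩ := Metric.mem_nhds_iff.1 hnhds
    have hpre : IsPreconnected ((↑) '' Metric.ball y ε : Set (OnePoint ℂ)) :=
      (convex_ball y ε).isPreconnected.image _ continuous_coe.continuousOn
    have hsubq : ((↑) '' Metric.ball y ε : Set (OnePoint ℂ)) ⊆ q := by
      rw [eq_of_mem_complComponents hq hyq]
      refine hpre.subset_connectedComponentIn ⟨y, Metric.mem_ball_self hε, rfl⟩ ?_
      rintro _ ⟨z, hz, rfl⟩ hzG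
      exact hball hz (subset_closure hzG)
    have : (y : OnePoint ℂ) ∈ interior q :=
      mem_interior.2 ⟨_, hsubq, isOpenMap_coe _ Metric.isOpen_ball, y, Metric.mem_ball_self hε, rfl⟩
    exact hy.2 this
  refine ⟨hsub hx, Subset.antisymm
    ((isPreconnected_frontier_component hG hGc hq).subset_connectedComponentIn hx hsub) ?_⟩
  intro y hy
  have hCq : connectedComponentIn (frontier G) x ⊆ q := by
    rw [eq_of_mem_complComponents hq (hqcl.frontier_subset hx)]
    refine isPreconnected_connectedComponentIn.subset_connectedComponentIn
      (mem_connectedComponentIn (hsub hx)) ?_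
    refine (connectedComponentIn_subset _ _).trans ?_
    rw [hG.frontier_eq]
    exact fun z hz => hz.2
  rw [frontier_eq_closure_inter_closure]
  refine ⟨subset_closure (hCq hy), ?_⟩
  have hyG : y ∈ closure G := frontier_subset_closure (connectedComponentIn_subset _ _ hy)
  exact closure_mono (fun z hz hzq => mem_complComponents_subset hq hzq hz) hyG

/-- The complementary components of a circle domain containing `∞` are closed disks or points. -/
theorem exists_eq_closedBall_of_isCircleDomain (hG : IsCircleDomain G) (hinf : ∞ ∈ G)
    {q : Set (OnePoint ℂ)} (hq : q ∈ complComponents G) :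
    ∃ (c : ℂ) (r : ℝ), 0 ≤ r ∧ q = onSphere (Metric.closedBall c r) := by
  obtain ⟨hGo, hGc, hcirc⟩ := hG
  have hqcl := isClosed_of_mem_complComponents hGo hq
  have hinfq : ∞ ∉ q := fun h => mem_complComponents_subset hq h hinf
  have hqne : q.Nonempty := by
    obtain ⟨x, hx, rfl⟩ := hq
    exact ⟨x, mem_connectedComponentIn hx⟩
  obtain ⟨x, hx⟩ : (frontier q).Nonempty :=
    nonempty_frontier_iff.2 ⟨hqne, fun h => hinfq (h ▸ mem_univ _)⟩
  obtain ⟨hxG, hfr⟩ := frontier_component_eq hGo hGc hinf hq hx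
  have hxq := hqcl.frontier_subset hx
  -- The exterior of the disk is connected, misses the frontier of `q` and contains ∞, which is not
  -- in `q`; so it misses `q`.
  have hout : ∀ (c : ℂ) (r : ℝ), 0 ≤ r → frontier q ⊆ onSphere (Metric.closedBall c r) →
      q ⊆ onSphere (Metric.closedBall c r) := by
    intro c r hr hsub
    rcases subset_or_subset_compl_of_disjoint_frontier (q := q) (isPreconnected_exterior c hr)
      (disjoint_left.2 fun y hy hy' => hy (hsub hy')) with h | h
    · exact absurd (h (infty_notMem_onSphere _)) hinfq
    · exact compl_subset_compl.1 h
  rcases hcirc x hxG with (⟨c, r, hr, hC⟩ | ⟨u, b, -, hC⟩) | hC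
  · rw [← hfr] at hC
    refine ⟨c, r, hr.le, Subset.antisymm (hout c r hr.le ?_) ?_⟩
    · rw [hC]
      exact image_mono Metric.sphere_subset_closedBall
    have hball : IsPreconnected (onSphere (Metric.ball c r)) :=
      (convex_ball c r).isPreconnected.image _ continuous_coe.continuousOn
    rcases subset_or_subset_compl_of_disjoint_frontier (q := q) hball (by
      rw [hC, disjoint_left]
      rintro _ ⟨z, hz, rfl⟩ ⟨w, hw, hwz⟩
      rw [OnePoint.coe_eq_coe] at hwz
      rw [hwz] at hw
      exact absurd (Metric.mem_sphere.1 hw) (Metric.mem_ball.1 hz).ne) with h | h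
    · rw [← Metric.ball_union_sphere, onSphere, image_union]
      refine union_subset h ?_
      change onSphere _ ⊆ _ at h
      rw [← hC]
      exact hqcl.frontier_subset
    -- Here `q` would be the bare circle, whose complement separates `c` from ∞, although the
    -- complement of a component is connected.
    · exfalso
      have hqc := isPreconnected_compl_component hGo hGc hq
      have hcov : qᶜ ⊆ onSphere (Metric.ball c r) ∪ (onSphere (Metric.closedBall c r))ᶜ := by
        intro y hy
        by_contra hcon
        rw [mem_union, not_or, notMem_compl_iff] at hcon
        obtain ⟨z, hz, rfl⟩ := hcon.2
        apply hy
        apply hqcl.frontier_subset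
        rw [hC]
        refine ⟨z, ?_, rfl⟩
        rw [Metric.mem_sphere]
        refine le_antisymm hz (not_lt.1 fun hlt => hcon.1 ⟨z, hlt, rfl⟩)
      rcases hqc.subset_or_subset (isOpenMap_coe _ Metric.isOpen_ball)
        (isCompact_closedBall c r |>.image continuous_coe).isClosed.isOpen_compl
        (disjoint_left.2 fun y hy hy' =>
          hy' (image_mono Metric.ball_subset_closedBall hy)) hcov with h' | h'
      · exact infty_notMem_onSphere _ (h' hinfq)
      · have hc : (c : OnePoint ℂ) ∈ onSphere (Metric.ball c r) :=
          ⟨c, Metric.mem_ball_self hr, rfl⟩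
        exact h' (h hc) (image_mono Metric.ball_subset_closedBall hc)
  -- A straight line passes through ∞, which belongs to `G`.
  · exfalso
    have : ∞ ∈ frontier q := by
      rw [hfr, hC]
      exact mem_insert _ _
    exact hinfq (hqcl.frontier_subset this)
  · rw [← hfr] at hC
    have hxinf : x ≠ ∞ := fun h => hinfq (h ▸ hxq)
    lift x to ℂ using hxinf
    have h1 : onSphere (Metric.closedBall x 0) = {(x : OnePoint ℂ)} := by
      rw [Metric.closedBall_zero, onSphere, image_singleton]
    refine ⟨x, 0, le_rfl, Subset.antisymm (hout x 0 le_rfl (by rw [hC, h1])) ?_⟩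
    rw [h1]
    exact singleton_subset_iff.2 hxq

/-! ### Images of complementary components -/

theorem image_collapseMap_component {p : Set (OnePoint ℂ)} (hp : p ∈ complComponents G)
    {x : OnePoint ℂ} (hx : x ∈ p) : collapseMap G '' p = {collapseMap G x} := by
  refine Subset.antisymm ?_ (singleton_subset_iff.2 (mem_image_of_mem _ hx))
  rintro _ ⟨y, hy, rfl⟩
  exact collapseMap_eq_iff.2 (Or.inr ⟨p, hp, hy, hx⟩)

variable {G' : Set (OnePoint ℂ)} {f : OnePoint ℂ → OnePoint ℂ} {F : Collapse G ≃ₜ Collapse G'}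

theorem preimage_extension_mem_complComponents (hF : Extends f F) (hf : BijOn f G G')
    {x : OnePoint ℂ} (hx : x ∉ G) :
    collapseMap G' ⁻¹' {F (collapseMap G x)} ∈ complComponents G' := by
  obtain ⟨y, hy⟩ := surjective_collapseMap G' (F (collapseMap G x))
  have hyG : y ∉ G' := by
    intro hyG
    obtain ⟨z, hz, rfl⟩ := hf.surjOn hyG
    rw [← hF z hz, F.injective.eq_iff, collapseMap_eq_iff, collapseRel_iff_of_mem hz] at hy
    exact hx (hy ▸ hz)
  rw [← hy, preimage_collapseMap_singleton hyG]
  exact ⟨y, hyG, rfl⟩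

theorem hatImage_component {p : Set (OnePoint ℂ)} (hp : p ∈ complComponents G)
    {x : OnePoint ℂ} (hx : x ∈ p) :
    hatImage F p = collapseMap G' ⁻¹' {F (collapseMap G x)} := by
  rw [hatImage, image_collapseMap_component hp hx, image_singleton]

/-- Near a complementary component, `f` is close to the image of the component. -/
theorem eventually_mem_of_extends (hG' : IsOpen G') (hF : Extends f F) {x : OnePoint ℂ}
    {V : Set (OnePoint ℂ)} (hV : IsOpen V)
    (hx : collapseMap G' ⁻¹' {F (collapseMap G x)} ⊆ V) :
    ∀ᶠ y in 𝓝 x, y ∈ G → f y ∈ V := by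
  have hcl : IsClosed (collapseMap G' '' Vᶜ) := isClosedMap_collapseMap hG' _ hV.isClosed_compl
  have hcont : Continuous fun y => F (collapseMap G y) :=
    F.continuous.comp (continuous_collapseMap G)
  have hnhds : (fun y => F (collapseMap G y)) ⁻¹' (collapseMap G' '' Vᶜ)ᶜ ∈ 𝓝 x := by
    refine (hcl.isOpen_compl.preimage hcont).mem_nhds ?_
    rintro ⟨y, hy, hyx⟩
    exact hy (hx hyx)
  filter_upwards [hnhds] with y hy hyG
  by_contra hyV
  exact hy ⟨f y, hyV, (hF y hyG).symm⟩

end RigidCircle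
end

/-! ### Length and area in the logarithmic metric of an annulus. -/

noncomputable section
namespace RigidCircle
open Set Filter MeasureTheory

/-! ### The length-area estimate -/

theorem lintegral_annulus_le (c : ℂ) {r R : ℝ} (hr : 0 < r) (hrR : r < R) :
    ∫⁻ w in {w : ℂ | r < ‖w - c‖ ∧ ‖w - c‖ < R}, ENNReal.ofReal (1 / ‖w - c‖ ^ 2) ≤
      ENNReal.ofReal (2 * Real.pi * Real.log (R / r)) := by
  have hmeas : MeasurableSet {w : ℂ | r < ‖w - c‖ ∧ ‖w - c‖ < R} :=
    (measurableSet_lt (f := fun _ => r) (g := fun w : ℂ => ‖w - c‖) (by fun_prop)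
      (by fun_prop)).inter
      (measurableSet_lt (f := fun w : ℂ => ‖w - c‖) (g := fun _ => R) (by fun_prop) (by fun_prop))
  rw [← lintegral_indicator hmeas]
  set k : ℂ → ENNReal := fun w =>
    {w : ℂ | r < ‖w‖ ∧ ‖w‖ < R}.indicator (fun w => ENNReal.ofReal (1 / ‖w‖ ^ 2)) w with hk
  have h1 : ∀ w, {w : ℂ | r < ‖w - c‖ ∧ ‖w - c‖ < R}.indicator
      (fun w => ENNReal.ofReal (1 / ‖w - c‖ ^ 2)) w = k (w - c) := by
    intro w
    simp only [hk, indicator, mem_ofPred_eq]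
  simp_rw [h1]
  rw [lintegral_sub_right_eq_self k c, ← Complex.lintegral_comp_polarCoord_symm]
  have h2 : ∀ p ∈ polarCoord.target, ENNReal.ofReal p.1 • k (Complex.polarCoord.symm p) =
      (Ioo r R).indicator (fun x => ENNReal.ofReal (1 / x)) p.1 * 1 := by
    intro p hp
    have hp1 : 0 < p.1 := by
      rw [polarCoord_target] at hp
      exact hp.1
    rw [mul_one]
    by_cases h : r < p.1 ∧ p.1 < R
    · rw [indicator_of_mem (show p.1 ∈ Ioo r R from h)]
      simp only [hk]
      rw [indicator_of_mem (by simpa [abs_of_pos hp1] using h), Complex.norm_polarCoord_symm,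
        abs_of_pos hp1, smul_eq_mul, ← ENNReal.ofReal_mul hp1.le]
      congr 1
      field_simp
    · rw [indicator_of_notMem (show p.1 ∉ Ioo r R from h)]
      simp only [hk]
      rw [indicator_of_notMem (by simpa [abs_of_pos hp1] using h), smul_zero]
  rw [setLIntegral_congr_fun polarCoord.open_target.measurableSet h2, polarCoord_target,
    Measure.volume_eq_prod, ← Measure.prod_restrict]
  have hm : Measurable ((Ioo r R).indicator (fun x : ℝ => ENNReal.ofReal (1 / x))) :=
    Measurable.indicator (by fun_prop) measurableSet_Ioo
  rw [lintegral_prod_mul (f := (Ioo r R).indicator (fun x : ℝ => ENNReal.ofReal (1 / x)))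
    (g := fun _ => 1) hm.aemeasurable aemeasurable_const]
  have h3 : ∫⁻ x in Ioi (0 : ℝ), (Ioo r R).indicator (fun x => ENNReal.ofReal (1 / x)) x ≤
      ENNReal.ofReal (Real.log (R / r)) := by
    refine (setLIntegral_le_lintegral _ _).trans ?_
    rw [lintegral_indicator measurableSet_Ioo, ← integral_one_div_of_pos hr (hr.trans hrR),
      intervalIntegral.integral_of_le hrR.le, restrict_Ioo_eq_restrict_Ioc,
      ofReal_integral_eq_lintegral_ofReal]
    · change IntegrableOn (fun x : ℝ => 1 / x) (Ioc r R) volume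
      rw [← intervalIntegrable_iff_integrableOn_Ioc_of_le hrR.le]
      exact intervalIntegral.intervalIntegrable_one_div (fun x hx => by
        rw [uIcc_of_le hrR.le] at hx
        exact (hr.trans_le hx.1).ne') continuousOn_id
    · refine (ae_restrict_mem measurableSet_Ioc).mono fun x hx => ?_
      have : 0 < x := hr.trans hx.1
      simp only [Pi.zero_apply]
      positivity
  have h4 : ∫⁻ _x in Ioo (-Real.pi) Real.pi, (1 : ENNReal) = ENNReal.ofReal (2 * Real.pi) := by
    rw [setLIntegral_one, Real.volume_Ioo]
    congr 1
    ring
  rw [h4, mul_comm, ENNReal.ofReal_mul (p := 2 * Real.pi) (by positivity)]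
  exact mul_le_mul_right h3 _

/-- A crossing of an annulus contains a crossing inside the annulus. -/
theorem exists_crossing {N : ℝ → ℝ} {y₁ y₂ r R : ℝ} (hy : y₁ ≤ y₂) (hrR : r < R)
    (hN : ContinuousOn N (Icc y₁ y₂)) (h1 : N y₁ ≤ r) (h2 : R ≤ N y₂) :
    ∃ a b, a < b ∧ Icc a b ⊆ Icc y₁ y₂ ∧ N a = r ∧ N b = R ∧ ∀ y ∈ Ioo a b, r < N y ∧ N y < R := by
  -- `b` will be the first parameter with N ≥ R, and `a` the last one before `b` with N ≤ r.
  have hc1 : IsCompact (Icc y₁ y₂ ∩ N ⁻¹' Ici R) :=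
    isCompact_Icc.of_isClosed_subset (hN.preimage_isClosed_of_isClosed isClosed_Icc isClosed_Ici)
      inter_subset_left
  obtain ⟨b, ⟨hb, hbR⟩, hbm⟩ := hc1.exists_isLeast ⟨y₂, right_mem_Icc.2 hy, h2⟩
  have hsub : Icc y₁ b ⊆ Icc y₁ y₂ := Icc_subset_Icc_right hb.2
  have hc2 : IsCompact (Icc y₁ b ∩ N ⁻¹' Iic r) :=
    isCompact_Icc.of_isClosed_subset
      ((hN.mono hsub).preimage_isClosed_of_isClosed isClosed_Icc isClosed_Iic) inter_subset_left
  obtain ⟨a, ⟨ha, har⟩, ham⟩ := hc2.exists_isGreatest ⟨y₁, left_mem_Icc.2 hb.1, h1⟩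
  have hab : a < b := by
    refine lt_of_le_of_ne ha.2 fun h => ?_
    have h3 : N a ≤ r := har
    have h4 : R ≤ N b := hbR
    rw [h] at h3
    linarith
  have hin : ∀ y ∈ Ioo a b, r < N y ∧ N y < R := by
    intro y hy'
    constructor
    · by_contra h
      exact absurd (ham ⟨⟨ha.1.trans hy'.1.le, hy'.2.le⟩, not_lt.1 h⟩) (not_le.2 hy'.1)
    · by_contra h
      exact absurd (hbm ⟨⟨ha.1.trans hy'.1.le, hy'.2.le.trans hb.2⟩, not_lt.1 h⟩)
        (not_le.2 hy'.2)
  have hsub2 : Icc a b ⊆ Icc y₁ y₂ := Icc_subset_Icc ha.1 hb.2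
  have hcl : closure (Ioo a b) = Icc a b := closure_Ioo hab.ne
  have hNc : ContinuousOn N (closure (Ioo a b)) := hcl ▸ hN.mono hsub2
  refine ⟨a, b, hab, hsub2, le_antisymm har ?_, le_antisymm ?_ hbR, hin⟩
  · exact le_on_closure (f := fun _ => r) (fun y hy' => (hin y hy').1.le) continuousOn_const hNc
      (hcl ▸ left_mem_Icc.2 hab.le)
  · exact le_on_closure (g := fun _ => R) (fun y hy' => (hin y hy').2.le) hNc continuousOn_const
      (hcl ▸ right_mem_Icc.2 hab.le)

/-- The derivative of log ‖h‖ is ⟨h, h'⟩ / ‖h‖², which Cauchy-Schwarz bounds by ‖h'‖ / ‖h‖. -/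
theorem abs_log_norm_sub_le {h h' : ℝ → ℂ} {a b : ℝ} (hab : a ≤ b)
    (hd : ∀ y ∈ Icc a b, HasDerivAt h (h' y) y) (hc : ContinuousOn h' (Icc a b))
    (h0 : ∀ y ∈ Icc a b, h y ≠ 0) :
    ENNReal.ofReal |Real.log ‖h b‖ - Real.log ‖h a‖| ≤
      ∫⁻ y in Ioo a b, ENNReal.ofReal (‖h' y‖ / ‖h y‖) := by
  have hcont : ContinuousOn h (Icc a b) := fun y hy => (hd y hy).continuousAt.continuousWithinAt
  set L' : ℝ → ℝ := fun y => inner ℝ (h y) (h' y) / ‖h y‖ ^ 2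
  have hL : ∀ y ∈ uIcc a b, HasDerivAt (fun y => Real.log ‖h y‖) (L' y) y := by
    rw [uIcc_of_le hab]
    intro y hy
    have hne : ‖h y‖ ≠ 0 := norm_ne_zero_iff.2 (h0 y hy)
    have h1 := ((hd y hy).norm_sq.log (pow_ne_zero 2 hne)).div_const 2
    have h2 : (fun y => Real.log ‖h y‖) = fun y => Real.log (‖h y‖ ^ 2) / 2 := by
      ext y
      rw [Real.log_pow]
      push_cast
      ring
    have h3 : L' y = 2 * inner ℝ (h y) (h' y) / ‖h y‖ ^ 2 / 2 := by
      change inner ℝ (h y) (h' y) / ‖h y‖ ^ 2 = _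
      ring
    rw [h2, h3]
    exact h1
  have hL'c : ContinuousOn L' (Icc a b) :=
    (ContinuousOn.inner (𝕜 := ℝ) hcont hc).div (hcont.norm.pow 2)
      fun y hy => pow_ne_zero 2 (norm_ne_zero_iff.2 (h0 y hy))
  have hφc : ContinuousOn (fun y => ‖h' y‖ / ‖h y‖) (Icc a b) :=
    hc.norm.div hcont.norm fun y hy => norm_ne_zero_iff.2 (h0 y hy)
  have hint : IntervalIntegrable L' volume a b :=
    (hL'c.mono (by rw [uIcc_of_le hab])).intervalIntegrable
  have hφint : IntervalIntegrable (fun y => ‖h' y‖ / ‖h y‖) volume a b :=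
    (hφc.mono (by rw [uIcc_of_le hab])).intervalIntegrable
  rw [← intervalIntegral.integral_eq_sub_of_hasDerivAt hL hint]
  have hle : |∫ y in a..b, L' y| ≤ ∫ y in a..b, ‖h' y‖ / ‖h y‖ := by
    refine intervalIntegral.abs_integral_le_integral_abs hab |>.trans ?_
    refine intervalIntegral.integral_mono_on hab hint.abs hφint fun y hy => ?_
    have hpos : 0 < ‖h y‖ := norm_pos_iff.2 (h0 y hy)
    rw [abs_div, abs_of_nonneg (by positivity : 0 ≤ ‖h y‖ ^ 2), div_le_div_iff₀ (by positivity) hpos]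
    have := abs_real_inner_le_norm (h y) (h' y)
    nlinarith [norm_nonneg (h' y)]
  refine (ENNReal.ofReal_le_ofReal hle).trans ?_
  rw [intervalIntegral.integral_of_le hab, restrict_Ioo_eq_restrict_Ioc,
    ofReal_integral_eq_lintegral_ofReal]
  · rwa [intervalIntegrable_iff_integrableOn_Ioc_of_le hab] at hφint
  · exact Eventually.of_forall fun y => by
      simp only [Pi.zero_apply]
      positivity

/-- Only the part of the curve inside the annulus is measured, so that the area integral can be
confined to the annulus as well. A curve that meets the outer circle first is traversed backwards.
-/
theorem log_div_le_lintegral_of_crossing {h h' : ℝ → ℂ} {l u r R : ℝ} (hr : 0 < r) (hrR : r < R)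
    (hd : ∀ y ∈ Ioo l u, HasDerivAt h (h' y) y) (hc : ContinuousOn h' (Ioo l u))
    {y₁ y₂ : ℝ} (hy₁ : y₁ ∈ Ioo l u) (hy₂ : y₂ ∈ Ioo l u) (h1 : ‖h y₁‖ ≤ r) (h2 : R ≤ ‖h y₂‖) :
    ENNReal.ofReal (Real.log (R / r)) ≤ ∫⁻ y in Ioo l u,
      {y | r < ‖h y‖ ∧ ‖h y‖ < R}.indicator (fun y => ENNReal.ofReal (‖h' y‖ / ‖h y‖)) y := by
  have hcont : ContinuousOn h (Ioo l u) := fun y hy => (hd y hy).continuousAt.continuousWithinAt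
  have key : ∃ a b, a < b ∧ Icc a b ⊆ Ioo l u ∧ Real.log (R / r) ≤
      |Real.log ‖h b‖ - Real.log ‖h a‖| ∧ (∀ y ∈ Ioo a b, r < ‖h y‖ ∧ ‖h y‖ < R) ∧
      0 < ‖h a‖ ∧ 0 < ‖h b‖ := by
    have hR : 0 < R := hr.trans hrR
    rcases le_total y₁ y₂ with hy | hy
    · have hsub : Icc y₁ y₂ ⊆ Ioo l u := Icc_subset_Ioo hy₁.1 hy₂.2
      obtain ⟨a, b, hab, hs, ha, hb, hin⟩ := exists_crossing (N := fun y => ‖h y‖) hy hrR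
        (hcont.mono hsub).norm h1 h2
      refine ⟨a, b, hab, hs.trans hsub, ?_, hin, ?_, ?_⟩
      · rw [ha, hb, Real.log_div hR.ne' hr.ne']
        exact le_abs_self _
      · rwa [ha]
      · rwa [hb]
    · have hsub : Icc y₂ y₁ ⊆ Ioo l u := Icc_subset_Ioo hy₂.1 hy₁.2
      have hneg : ContinuousOn (fun y => ‖h (-y)‖) (Icc (-y₁) (-y₂)) := by
        refine ((hcont.mono hsub).norm).comp continuous_neg.continuousOn fun y hy => ?_
        exact ⟨by linarith [hy.2], by linarith [hy.1]⟩
      obtain ⟨a, b, hab, hs, ha, hb, hin⟩ := exists_crossing (N := fun y => ‖h (-y)‖)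
        (neg_le_neg hy) hrR hneg (by simpa using h1) (by simpa using h2)
      refine ⟨-b, -a, neg_lt_neg hab, fun y hy' => hsub ?_, ?_, fun y hy' => ?_, ?_, ?_⟩
      · have := hs (show -y ∈ Icc a b from ⟨by linarith [hy'.2], by linarith [hy'.1]⟩)
        exact ⟨by linarith [this.2], by linarith [this.1]⟩
      · rw [ha, hb, Real.log_div hR.ne' hr.ne', abs_sub_comm]
        exact le_abs_self _
      · have := hin (-y) ⟨by linarith [hy'.2], by linarith [hy'.1]⟩
        simpa using this
      · rwa [hb]
      · rwa [ha]
  obtain ⟨a, b, hab, hsub, hlog, hin, ha0, hb0⟩ := key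
  have hne : ∀ y ∈ Icc a b, h y ≠ 0 := by
    intro y hy
    rcases eq_endpoints_or_mem_Ioo_of_mem_Icc hy with rfl | rfl | hy'
    · exact norm_pos_iff.1 ha0
    · exact norm_pos_iff.1 hb0
    · exact norm_pos_iff.1 (hr.trans (hin y hy').1)
  refine (ENNReal.ofReal_le_ofReal hlog).trans ((abs_log_norm_sub_le hab.le
    (fun y hy => hd y (hsub hy)) (hc.mono hsub) hne).trans ?_)
  rw [setLIntegral_congr_fun measurableSet_Ioo (fun y hy => (indicator_of_mem
    (s := {y | r < ‖h y‖ ∧ ‖h y‖ < R}) (hin y hy)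
    (fun y => ENNReal.ofReal (‖h' y‖ / ‖h y‖))).symm)]
  exact lintegral_mono_set (Ioo_subset_Icc_self.trans hsub)

end RigidCircle
end

/-! ### Short families of segments. -/

noncomputable section
namespace RigidCircle
open Set Filter MeasureTheory

/-- The dilation factor in the length-area estimates. -/
def dilFactor : ℝ := Real.exp 20

theorem one_lt_dilFactor : 1 < dilFactor := Real.one_lt_exp_iff.2 (by norm_num)

/-- A family of sets (curves) is short for `g` if, whenever all the images come near a disk, one of
them stays in a fixed multiple of the disk. -/
def ShortFamily (g : ℂ → ℂ) (I : Set ℝ) (γ : ℝ → Set ℂ) : Prop :=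
  ∀ (c : ℂ) (r : ℝ), 0 < r → (∀ s ∈ I, ∃ p ∈ γ s, ‖g p - c‖ ≤ r) →
    ∃ s ∈ I, ∀ p ∈ γ s, ‖g p - c‖ ≤ dilFactor * r

theorem abs_det_restrictScalars_smulRight (w : ℂ) :
    |(((ContinuousLinearMap.toSpanSingleton ℂ w).restrictScalars ℝ)).det| = ‖w‖ ^ 2 := by
  have : (((ContinuousLinearMap.toSpanSingleton ℂ w).restrictScalars ℝ)).det = ‖w‖ ^ 2 := by
    simp [ContinuousLinearMap.det, LinearMap.det_restrictScalars, Algebra.norm_complex_apply,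
      Complex.normSq_eq_norm_sq]
  rw [this, abs_of_nonneg (by positivity)]

/-- Vertical segments filling a region whose height is at most three times its width. -/
theorem shortFamily_vertical {g : ℂ → ℂ} {U : Set ℂ} (hU : IsOpen U) (hg : DifferentiableOn ℂ g U)
    (hinj : InjOn g U) {a b : ℝ} (hab : a < b) {l u : ℝ → ℝ} (hl : Continuous l)
    (hu : Continuous u) (hlu : ∀ s ∈ Icc a b, u s - l s ≤ 3 * (b - a))
    (hsub : ∀ s ∈ Icc a b, ∀ y ∈ Ioo (l s) (u s), (⟨s, y⟩ : ℂ) ∈ U) :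
    ShortFamily g (Icc a b) fun s => (fun y => (⟨s, y⟩ : ℂ)) '' Ioo (l s) (u s) := by
  classical
  intro c r hr hnear
  by_contra! hcon
  set R := dilFactor * r with hR
  have hrR : r < R := by nlinarith [one_lt_dilFactor]
  have hlog : Real.log (R / r) = 20 := by
    rw [hR, mul_div_cancel_right₀ _ hr.ne', dilFactor, Real.log_exp]
  set A : Set ℂ := {ζ | (ζ.re ∈ Ioo a b ∧ l ζ.re < ζ.im ∧ ζ.im < u ζ.re) ∧
    (r < ‖g ζ - c‖ ∧ ‖g ζ - c‖ < R)} with hA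
  have hWo : IsOpen {ζ : ℂ | ζ.re ∈ Ioo a b ∧ l ζ.re < ζ.im ∧ ζ.im < u ζ.re} :=
    (isOpen_Ioo.preimage Complex.continuous_re).inter
      ((isOpen_lt (hl.comp Complex.continuous_re) Complex.continuous_im).inter
        (isOpen_lt Complex.continuous_im (hu.comp Complex.continuous_re)))
  have hWU : {ζ : ℂ | ζ.re ∈ Ioo a b ∧ l ζ.re < ζ.im ∧ ζ.im < u ζ.re} ⊆ U := fun ζ hζ =>
    hsub ζ.re (Ioo_subset_Icc_self hζ.1) ζ.im hζ.2
  have hAo : IsOpen A := by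
    have h1 : ContinuousOn (fun ζ => ‖g ζ - c‖)
        {ζ : ℂ | ζ.re ∈ Ioo a b ∧ l ζ.re < ζ.im ∧ ζ.im < u ζ.re} :=
      ((hg.continuousOn.mono hWU).sub continuousOn_const).norm
    exact h1.isOpen_inter_preimage hWo (isOpen_Ioo (a := r) (b := R))
  have hAU : A ⊆ U := fun ζ hζ => hWU hζ.1
  set φ : ℂ → ℝ := fun ζ => ‖deriv g ζ‖ / ‖g ζ - c‖ with hφ
  set Φ : ℂ → ENNReal := A.indicator fun ζ => ENNReal.ofReal (φ ζ ^ 2) with hΦ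
  have hgA : ∀ ζ ∈ U, HasDerivAt g (deriv g ζ) ζ := fun ζ hζ =>
    (hg.differentiableAt (hU.mem_nhds hζ)).hasDerivAt
  have hderivc : ContinuousOn (deriv g) U := (hg.deriv hU).continuousOn
  have hφc : ContinuousOn φ A := by
    refine ContinuousOn.div (hderivc.mono hAU).norm
      ((hg.continuousOn.mono hAU).sub continuousOn_const).norm fun ζ hζ => ?_
    exact (hr.trans hζ.2.1).ne'
  have hΦm : Measurable Φ := by
    have h1 : ContinuousOn (fun ζ => ENNReal.ofReal (φ ζ ^ 2)) A :=
      ENNReal.continuous_ofReal.comp_continuousOn (hφc.pow 2)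
    have h2 := h1.measurable_piecewise (g := 0) continuousOn_const hAo.measurableSet
    rwa [Set.piecewise_eq_indicator] at h2
  -- the area
  have harea : ∫⁻ ζ, Φ ζ ≤ ENNReal.ofReal (2 * Real.pi * 20) := by
    rw [lintegral_indicator hAo.measurableSet]
    have h1 : ∀ ζ ∈ A, ENNReal.ofReal (φ ζ ^ 2) =
        ENNReal.ofReal |(((ContinuousLinearMap.toSpanSingleton ℂ (deriv g ζ)).restrictScalars
          ℝ)).det| * ENNReal.ofReal (1 / ‖g ζ - c‖ ^ 2) := by
      intro ζ hζ
      rw [abs_det_restrictScalars_smulRight, ← ENNReal.ofReal_mul (by positivity)]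
      congr 1
      simp only [hφ]
      rw [div_pow, mul_one_div]
    -- The Jacobian of `g` is ‖g'‖², so by injectivity the integral of φ² is the logarithmic area of
    -- the image, a subset of the annulus.
    rw [setLIntegral_congr_fun hAo.measurableSet h1,
      ← lintegral_image_eq_lintegral_abs_det_fderiv_mul volume hAo.measurableSet
        (fun ζ hζ => ((hgA ζ (hAU hζ)).hasFDerivAt.restrictScalars ℝ).hasFDerivWithinAt)
        (hinj.mono hAU) (fun w => ENNReal.ofReal (1 / ‖w - c‖ ^ 2)), ← hlog]
    refine (lintegral_mono_set ?_).trans (lintegral_annulus_le c hr hrR)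
    rintro _ ⟨ζ, hζ, rfl⟩
    exact hζ.2
  -- the lengths
  set ℓ : ℝ := 3 * (b - a) with hℓ
  have hℓ0 : 0 < ℓ := by simp only [hℓ]; linarith
  have hlen : ∀ s ∈ Ioo a b, ENNReal.ofReal 10 ≤
      ENNReal.ofReal (ℓ / 40) * ∫⁻ y, Φ ⟨s, y⟩ := by
    intro s hs
    have hsI : s ∈ Icc a b := Ioo_subset_Icc_self hs
    obtain ⟨_, ⟨y₁, hy₁, rfl⟩, h1⟩ := hnear s hsI
    obtain ⟨_, ⟨y₂, hy₂, rfl⟩, h2⟩ := hcon s hsI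
    have hpath : ∀ y : ℝ, HasDerivAt (fun y : ℝ => (⟨s, y⟩ : ℂ)) Complex.I y := by
      intro y
      have h3 : (fun y : ℝ => (⟨s, y⟩ : ℂ)) = fun y : ℝ => (s : ℂ) + (y : ℂ) * Complex.I := by
        ext y
        exact Complex.mk_eq_add_mul_I s y
      rw [h3]
      have h4 := ((Complex.ofRealCLM.hasDerivAt (x := y)).mul_const Complex.I).const_add (s : ℂ)
      simpa using h4
    have hpathc : Continuous fun y : ℝ => (⟨s, y⟩ : ℂ) :=
      continuous_iff_continuousAt.2 fun y => (hpath y).continuousAt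
    have hd : ∀ y ∈ Ioo (l s) (u s), HasDerivAt (fun y : ℝ => g ⟨s, y⟩ - c)
        (deriv g ⟨s, y⟩ * Complex.I) y := fun y hy =>
      ((hgA _ (hsub s hsI y hy)).comp y (hpath y)).sub_const c
    have hc : ContinuousOn (fun y : ℝ => deriv g ⟨s, y⟩ * Complex.I) (Ioo (l s) (u s)) :=
      (hderivc.comp hpathc.continuousOn fun y hy => hsub s hsI y hy).mul continuousOn_const
    have h3 := log_div_le_lintegral_of_crossing hr hrR hd hc hy₁ hy₂ h1 h2.le
    rw [hlog] at h3
    -- The arithmetic-geometric mean inequality φ ≤ (ℓ/40) φ² + 10/ℓ replaces Cauchy-Schwarz. Over a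
    -- length of at most ℓ the constant term uses up 10 of the crossing length 20.
    have hptw : ∀ y ∈ Ioo (l s) (u s), {y : ℝ | r < ‖g ⟨s, y⟩ - c‖ ∧ ‖g ⟨s, y⟩ - c‖ < R}.indicator
        (fun y => ENNReal.ofReal (‖deriv g ⟨s, y⟩ * Complex.I‖ / ‖g ⟨s, y⟩ - c‖)) y ≤
        ENNReal.ofReal (ℓ / 40) * Φ ⟨s, y⟩ + ENNReal.ofReal (10 / ℓ) := by
      intro y hy
      by_cases hy' : r < ‖g ⟨s, y⟩ - c‖ ∧ ‖g ⟨s, y⟩ - c‖ < R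
      · have hmem : (⟨s, y⟩ : ℂ) ∈ A := ⟨⟨hs, hy⟩, hy'⟩
        rw [indicator_of_mem (by exact hy'), hΦ, indicator_of_mem hmem,
          ← ENNReal.ofReal_mul (by positivity), ← ENNReal.ofReal_add (by positivity)
            (by positivity)]
        refine ENNReal.ofReal_le_ofReal ?_
        rw [norm_mul, Complex.norm_I, mul_one]
        change φ ⟨s, y⟩ ≤ _
        have h4 : ℓ / 40 * φ ⟨s, y⟩ ^ 2 + 10 / ℓ - φ ⟨s, y⟩ =
            (ℓ * φ ⟨s, y⟩ - 20) ^ 2 / (40 * ℓ) := by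
          field_simp
          ring
        have h5 : 0 ≤ (ℓ * φ ⟨s, y⟩ - 20) ^ 2 / (40 * ℓ) := by positivity
        linarith
      · rw [indicator_of_notMem (by exact hy')]
        exact zero_le
    have h4 := h3.trans (setLIntegral_mono' measurableSet_Ioo hptw)
    have hΦs : Measurable fun y : ℝ => Φ ⟨s, y⟩ := hΦm.comp hpathc.measurable
    rw [lintegral_add_right _ measurable_const, lintegral_const_mul _ hΦs, setLIntegral_const,
      Real.volume_Ioo, ← ENNReal.ofReal_mul (by positivity)] at h4
    have h5 : ENNReal.ofReal (10 / ℓ * (u s - l s)) ≤ ENNReal.ofReal 10 := by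
      refine ENNReal.ofReal_le_ofReal ?_
      have h6 := mul_le_mul_of_nonneg_left (hlu s hsI) (by positivity : 0 ≤ 10 / ℓ)
      rwa [div_mul_cancel₀ _ hℓ0.ne'] at h6
    have h6 : (20 : ℝ) = 10 + 10 := by norm_num
    rw [h6, ENNReal.ofReal_add (by norm_num) (by norm_num)] at h4
    have h7 := (h4.trans (add_le_add_right h5 _))
    have h8 := (ENNReal.add_le_add_iff_right ENNReal.ofReal_ne_top).1 h7
    refine h8.trans ?_
    gcongr
    exact Measure.restrict_le_self
  -- integration over the segments
  have htotal : ENNReal.ofReal (10 * (b - a)) ≤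
      ENNReal.ofReal (ℓ / 40) * ∫⁻ ζ, Φ ζ := by
    have h1 : ∫⁻ ζ, Φ ζ = ∫⁻ s : ℝ, ∫⁻ y : ℝ, Φ ⟨s, y⟩ := by
      rw [← (Complex.volume_preserving_equiv_real_prod.symm).lintegral_comp_emb
        Complex.measurableEquivRealProd.symm.measurableEmbedding, Measure.volume_eq_prod,
        lintegral_prod (fun p => Φ (Complex.measurableEquivRealProd.symm p))
          (hΦm.comp Complex.measurableEquivRealProd.symm.measurable).aemeasurable]
      rfl
    rw [h1]
    calc ENNReal.ofReal (10 * (b - a)) = ∫⁻ _s in Ioo a b, ENNReal.ofReal 10 := by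
          rw [setLIntegral_const, Real.volume_Ioo, ← ENNReal.ofReal_mul (by norm_num)]
      _ ≤ ∫⁻ s in Ioo a b, ENNReal.ofReal (ℓ / 40) * ∫⁻ y, Φ ⟨s, y⟩ :=
          setLIntegral_mono' measurableSet_Ioo hlen
      _ = ENNReal.ofReal (ℓ / 40) * ∫⁻ s in Ioo a b, ∫⁻ y, Φ ⟨s, y⟩ :=
          lintegral_const_mul' _ _ ENNReal.ofReal_ne_top
      _ ≤ _ := by
          gcongr
          exact Measure.restrict_le_self
  -- With ℓ = 3(b - a) this reads 10(b - a) ≤ (ℓ/40) · 40π = 3π(b - a), which is false because 3π <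
  -- 10.
  have hfin := htotal.trans (mul_le_mul_right harea (ENNReal.ofReal (ℓ / 40)))
  rw [← ENNReal.ofReal_mul (by positivity), ENNReal.ofReal_le_ofReal_iff (by positivity)] at hfin
  have hpi := Real.pi_lt_d2
  simp only [hℓ] at hfin
  nlinarith

/-- Horizontal segments filling a region whose width is at most three times its height. -/
theorem shortFamily_horizontal {g : ℂ → ℂ} {U : Set ℂ} (hU : IsOpen U)
    (hg : DifferentiableOn ℂ g U) (hinj : InjOn g U) {a b : ℝ} (hab : a < b) {l u : ℝ → ℝ}
    (hl : Continuous l) (hu : Continuous u) (hlu : ∀ s ∈ Icc a b, u s - l s ≤ 3 * (b - a))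
    (hsub : ∀ s ∈ Icc a b, ∀ x ∈ Ioo (l s) (u s), (⟨x, s⟩ : ℂ) ∈ U) :
    ShortFamily g (Icc a b) fun s => (fun x => (⟨x, s⟩ : ℂ)) '' Ioo (l s) (u s) := by
  have hrot : ∀ s y : ℝ, Complex.I * (⟨s, y⟩ : ℂ) = ⟨-y, s⟩ := by
    intro s y
    apply Complex.ext <;> simp
  -- Multiplication by i turns vertical segments into horizontal ones and reverses their direction,
  -- so the two end functions are negated and exchanged.
  have key := shortFamily_vertical (g := fun ζ => g (Complex.I * ζ))
    (U := (fun ζ => Complex.I * ζ) ⁻¹' U) (hU.preimage (by fun_prop))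
    (hg.comp (by fun_prop) fun ζ hζ => hζ)
    (hinj.comp (fun x _ y _ h => mul_left_cancel₀ Complex.I_ne_zero h) fun ζ hζ => hζ) hab
    (l := fun s => -u s) (u := fun s => -l s) hu.neg hl.neg
    (fun s hs => by have := hlu s hs; linarith)
    (fun s hs y hy => by
      rw [mem_preimage, hrot]
      exact hsub s hs (-y) ⟨by linarith [hy.2], by linarith [hy.1]⟩)
  intro c r hr hnear
  obtain ⟨s, hs, h⟩ := key c r hr (fun s hs => by
    obtain ⟨_, ⟨x, hx, rfl⟩, h⟩ := hnear s hs
    refine ⟨_, ⟨-x, ⟨by linarith [hx.2], by linarith [hx.1]⟩, rfl⟩, ?_⟩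
    simp only [hrot, neg_neg]
    exact h)
  refine ⟨s, hs, ?_⟩
  rintro _ ⟨x, hx, rfl⟩
  have := h _ ⟨-x, ⟨by linarith [hx.2], by linarith [hx.1]⟩, rfl⟩
  simpa only [hrot, neg_neg] using this

end RigidCircle
end

/-! ### Conformal maps of the sphere are open and have continuous inverses. -/

noncomputable section
namespace RigidCircle
open Set Filter OnePoint

/-! ### Conformal maps of the sphere -/

@[simp] theorem toComplex_coe (z : ℂ) : toComplex (z : OnePoint ℂ) = z := rfl

theorem coe_toComplex {x : OnePoint ℂ} (hx : x ≠ ∞) : (toComplex x : OnePoint ℂ) = x := by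
  lift x to ℂ using hx
  rfl

theorem sphereInv_infty : sphereInv ∞ = ((0 : ℂ) : OnePoint ℂ) := rfl

theorem sphereInv_zero : sphereInv ((0 : ℂ) : OnePoint ℂ) = ∞ := if_pos rfl

theorem sphereInv_coe {z : ℂ} (hz : z ≠ 0) : sphereInv (z : OnePoint ℂ) = ((z⁻¹ : ℂ) : OnePoint ℂ) :=
  if_neg hz

theorem sphereInv_sphereInv (x : OnePoint ℂ) : sphereInv (sphereInv x) = x := by
  induction x using OnePoint.rec with
  | infty => rw [sphereInv_infty, sphereInv_zero]
  | coe z =>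
    by_cases hz : z = 0
    · rw [hz, sphereInv_zero, sphereInv_infty]
    · rw [sphereInv_coe hz, sphereInv_coe (inv_ne_zero hz), inv_inv]

theorem continuous_sphereInv : Continuous sphereInv := by
  have hcob : coclosedCompact ℂ = Bornology.cobounded ℂ := by
    rw [coclosedCompact_eq_cocompact, Metric.cobounded_eq_cocompact]
  rw [OnePoint.continuous_iff]
  constructor
  · rw [hcob, sphereInv_infty]
    refine ((continuous_coe.tendsto (0 : ℂ)).comp tendsto_inv₀_cobounded).congr' ?_
    filter_upwards [Bornology.eventually_ne_cobounded (0 : ℂ)] with z hz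
    exact (sphereInv_coe hz).symm
  · rw [continuous_iff_continuousAt]
    intro z
    by_cases hz : z = 0
    · subst hz
      rw [ContinuousAt, sphereInv_zero, ← pure_sup_nhdsNE, tendsto_sup]
      refine ⟨?_, ?_⟩
      · rw [tendsto_pure_left]
        intro s hs
        rw [sphereInv_zero]
        exact mem_of_mem_nhds hs
      · have h1 : Tendsto (fun z : ℂ => ((z⁻¹ : ℂ) : OnePoint ℂ)) (𝓝[≠] 0) (𝓝 ∞) :=
          (hcob ▸ tendsto_coe_infty (X := ℂ)).comp tendsto_inv₀_nhdsNE_zero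
        refine h1.congr' ?_
        filter_upwards [self_mem_nhdsWithin] with w hw
        exact (sphereInv_coe hw).symm
    · have h1 : ContinuousAt (fun z : ℂ => ((z⁻¹ : ℂ) : OnePoint ℂ)) z :=
        continuous_coe.continuousAt.comp (continuousAt_inv₀ hz)
      refine h1.congr ?_
      filter_upwards [eventually_ne_nhds hz] with w hw
      exact (sphereInv_coe hw).symm

/-- The inversion as a homeomorphism of the sphere. -/
def sphereInvHomeomorph : OnePoint ℂ ≃ₜ OnePoint ℂ where
  toFun := sphereInv
  invFun := sphereInv
  left_inv := sphereInv_sphereInv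
  right_inv := sphereInv_sphereInv
  continuous_toFun := continuous_sphereInv
  continuous_invFun := continuous_sphereInv

theorem map_sphereInv_nhds (x : OnePoint ℂ) : map sphereInv (𝓝 x) = 𝓝 (sphereInv x) :=
  sphereInvHomeomorph.map_nhds_eq x

/-- The local open mapping theorem on the sphere, at finite points with finite values. -/
theorem nhds_le_map_of_analyticAt {k : OnePoint ℂ → OnePoint ℂ} {z w : ℂ}
    (hkz : k z = w) (hk : ContinuousAt k z)
    (han : AnalyticAt ℂ (fun ζ : ℂ => toComplex (k ζ)) z) {G : Set (OnePoint ℂ)}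
    (hG : G ∈ 𝓝 (z : OnePoint ℂ)) (hinj : InjOn k G) :
    𝓝 (k z) ≤ map k (𝓝 (z : OnePoint ℂ)) := by
  have hcoe : Tendsto ((↑) : ℂ → OnePoint ℂ) (𝓝 z) (𝓝 (z : OnePoint ℂ)) :=
    continuous_coe.tendsto z
  have hne : ∀ᶠ ζ : ℂ in 𝓝 z, ((toComplex (k ζ) : ℂ) : OnePoint ℂ) = k ζ := by
    have h1 : ∀ᶠ x in 𝓝 (z : OnePoint ℂ), k x ≠ ∞ :=
      hk.eventually_ne (by rw [hkz]; exact coe_ne_infty w)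
    exact (hcoe.eventually h1).mono fun ζ hζ => coe_toComplex hζ
  -- The locally constant alternative contradicts injectivity at any nearby point different from
  -- `z`.
  rcases han.eventually_constant_or_nhds_le_map_nhds with hconst | hopen
  · exfalso
    have h1 : ∀ᶠ ζ : ℂ in 𝓝[≠] z, False := by
      have h2 := (hconst.and (hne.and (hcoe.eventually hG))).filter_mono
        (nhdsWithin_le_nhds (s := {z}ᶜ))
      filter_upwards [h2, self_mem_nhdsWithin] with ζ hζ hζz
      obtain ⟨h3, h4, h5⟩ := hζ
      apply hζz
      have h6 : k ζ = k z := by rw [← h4, h3, hkz, toComplex_coe]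
      have := hinj h5 (mem_of_mem_nhds hG) h6
      exact OnePoint.coe_injective this
    exact h1.exists.choose_spec
  · rw [hkz, OnePoint.nhds_coe_eq, OnePoint.nhds_coe_eq, map_map]
    have h1 : toComplex (k z) = w := by rw [hkz, toComplex_coe]
    rw [h1] at hopen
    refine (map_mono hopen).trans ?_
    rw [map_map]
    exact (map_congr hne).le

variable {G G' : Set (OnePoint ℂ)} {f : OnePoint ℂ → OnePoint ℂ}

theorem ne_infty_of_mem (hf : InjOn f G) (hinfG : ∞ ∈ G) (hinf : f ∞ = ∞) {z : ℂ}
    (hz : (z : OnePoint ℂ) ∈ G) : f z ≠ ∞ := by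
  intro h
  exact coe_ne_infty z (hf hz hinfG (h.trans hinf.symm))

theorem analyticAt_of_holomorphicAt {z : ℂ} (hfz : f z ≠ ∞) (h : HolomorphicAt f z) :
    AnalyticAt ℂ (fun ζ : ℂ => toComplex (f ζ)) z := by
  have h2 := h.2
  have h3 : chartMap (z : OnePoint ℂ) = id := if_neg (coe_ne_infty z)
  have h4 : chartMap (f z) = id := if_neg hfz
  simpa only [h3, h4, id, toComplex_coe] using h2

/-- Openness of f is what makes its inverse continuous. At ∞, conjugation by the inversion reduces
the claim to the finite point 0. -/
theorem nhds_le_map_of_isConformalOnto (hG : IsOpen G) (hinfG : ∞ ∈ G)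
    (hf : IsConformalOnto f G G') (hinf : f ∞ = ∞) {x : OnePoint ℂ} (hx : x ∈ G) :
    𝓝 (f x) ≤ map f (𝓝 x) := by
  obtain ⟨hbij, hhol⟩ := hf
  induction x using OnePoint.rec with
  | coe z =>
    have hne := ne_infty_of_mem hbij.injOn hinfG hinf hx
    exact nhds_le_map_of_analyticAt (coe_toComplex hne).symm (hhol _ hx).1
      (analyticAt_of_holomorphicAt hne (hhol _ hx)) (hG.mem_nhds hx) hbij.injOn
  | infty =>
    obtain ⟨hcont, han⟩ := hhol _ hx
    set k : OnePoint ℂ → OnePoint ℂ := fun x => sphereInv (f (sphereInv x)) with hk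
    have hk0 : k ((0 : ℂ) : OnePoint ℂ) = ((0 : ℂ) : OnePoint ℂ) := by
      simp only [hk, sphereInv_zero, hinf, sphereInv_infty]
    have hchart : chartMap ∞ = sphereInv := if_pos rfl
    rw [hinf, hchart, sphereInv_infty, toComplex_coe] at han
    have hkc : ContinuousAt k ((0 : ℂ) : OnePoint ℂ) := by
      refine continuous_sphereInv.continuousAt.comp (ContinuousAt.comp ?_
        continuous_sphereInv.continuousAt)
      rw [sphereInv_zero]
      exact hcont
    have h0 := nhds_le_map_of_analyticAt (k := k) hk0 hkc han (G := sphereInv ⁻¹' G)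
      (continuous_sphereInv.continuousAt.preimage_mem_nhds (by
        rw [sphereInv_zero]
        exact hG.mem_nhds hx)) (by
        intro a ha b hb hab
        have h1 := congrArg sphereInv hab
        simp only [hk, sphereInv_sphereInv] at h1
        have h2 := congrArg sphereInv (hbij.injOn ha hb h1)
        simpa only [sphereInv_sphereInv] using h2)
    have h1 := map_mono (m := sphereInv) h0
    rw [hk0, map_sphereInv_nhds, sphereInv_zero, map_map] at h1
    have h2 : 𝓝 ((0 : ℂ) : OnePoint ℂ) = map sphereInv (𝓝 ∞) := by
      rw [map_sphereInv_nhds, sphereInv_infty]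
    rw [h2, map_map] at h1
    have h3 : (sphereInv ∘ k) ∘ sphereInv = f := by
      ext1 y
      simp only [Function.comp_apply, hk, sphereInv_sphereInv]
    rw [h3] at h1
    rwa [hinf]

theorem continuousOn_of_isConformalOnto (hf : IsConformalOnto f G G') : ContinuousOn f G :=
  fun x hx => (hf.2 x hx).1.continuousWithinAt

theorem continuousOn_invFunOn (hG : IsOpen G) (hinfG : ∞ ∈ G) (hf : IsConformalOnto f G G')
    (hinf : f ∞ = ∞) : ContinuousOn (Function.invFunOn f G) G' := by
  intro y hy
  obtain ⟨x, hx, rfl⟩ := hf.1.surjOn hy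
  have hleft : LeftInvOn (Function.invFunOn f G) f G := hf.1.injOn.leftInvOn_invFunOn
  refine ContinuousAt.continuousWithinAt ?_
  rw [ContinuousAt, hleft hx]
  have h1 := nhds_le_map_of_isConformalOnto hG hinfG hf hinf hx
  refine (map_mono h1).trans ?_
  rw [map_map]
  have h2 : Function.invFunOn f G ∘ f =ᶠ[𝓝 x] id := by
    filter_upwards [hG.mem_nhds hx] with z hz
    exact hleft hz
  rw [map_congr h2, Filter.map_id]

/-- Connectedness of the source is inherited from the target through the continuous inverse, so no
geometric argument is needed for it. -/
theorem isConnected_of_isConformalOnto (hG : IsOpen G) (hinfG : ∞ ∈ G)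
    (hf : IsConformalOnto f G G') (hinf : f ∞ = ∞) (hG' : IsConnected G') : IsConnected G := by
  have h1 := hG'.image _ (continuousOn_invFunOn hG hinfG hf hinf)
  rwa [(hf.1.invOn_invFunOn.symm.bijOn hf.1.surjOn.mapsTo_invFunOn hf.1.mapsTo).image_eq] at h1

/-- A conformal map extends to a homeomorphism of the collapsed spaces. -/
theorem exists_extends_of_isConformalOnto (hG : IsOpen G) (hinfG : ∞ ∈ G)
    (hf : IsConformalOnto f G G') (hinf : f ∞ = ∞) (hG' : IsOpen G') (hGc' : IsConnected G') :
    ∃ F : Collapse G ≃ₜ Collapse G', Extends f F :=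
  exists_homeomorph_collapse_extension hG (isConnected_of_isConformalOnto hG hinfG hf hinf hGc') hG'
    hGc' (continuousOn_of_isConformalOnto hf) (continuousOn_invFunOn hG hinfG hf hinf)
    hf.1.mapsTo hf.1.surjOn.mapsTo_invFunOn hf.1.injOn.leftInvOn_invFunOn
    hf.1.surjOn.rightInvOn_invFunOn

end RigidCircle
end

/-! ### Images of complementary components under the extended map. -/

noncomputable section
namespace RigidCircle
open Set Filter OnePoint

/-! ### Conformal maps onto circle domains and their extensions -/

/-- The finite points of a subset of the sphere. -/
def finitePart (G : Set (OnePoint ℂ)) : Set ℂ := {z | (z : OnePoint ℂ) ∈ G}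

/-- A self-map of the sphere read in the finite coordinate. -/
def finiteMap (f : OnePoint ℂ → OnePoint ℂ) (z : ℂ) : ℂ := toComplex (f z)

/-- `F` is an extension of the conformal map `f` of `G` onto the circle domain `G'`, where `f` fixes
the point at infinity. -/
structure ConformalExtension (G G' : Set (OnePoint ℂ)) (f : OnePoint ℂ → OnePoint ℂ)
    (F : Collapse G ≃ₜ Collapse G') : Prop where
  isOpen : IsOpen G
  infty_mem : ∞ ∈ G
  circle : IsCircleDomain G'
  conf : IsConformalOnto f G G'
  map_infty : f ∞ = ∞
  ext : Extends f F

variable {G G' : Set (OnePoint ℂ)} {f : OnePoint ℂ → OnePoint ℂ} {F : Collapse G ≃ₜ Collapse G'}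

namespace ConformalExtension

theorem coe_finiteMap (h : ConformalExtension G G' f F) {z : ℂ} (hz : z ∈ finitePart G) :
    (finiteMap f z : OnePoint ℂ) = f z :=
  coe_toComplex (ne_infty_of_mem h.conf.1.injOn h.infty_mem h.map_infty hz)

theorem isOpen_finitePart (h : ConformalExtension G G' f F) : IsOpen (finitePart G) :=
  h.isOpen.preimage continuous_coe

theorem differentiableOn (h : ConformalExtension G G' f F) :
    DifferentiableOn ℂ (finiteMap f) (finitePart G) := fun _ hz =>
  (analyticAt_of_holomorphicAt (ne_infty_of_mem h.conf.1.injOn h.infty_mem h.map_infty hz)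
    (h.conf.2 _ hz)).differentiableAt.differentiableWithinAt

theorem injOn (h : ConformalExtension G G' f F) : InjOn (finiteMap f) (finitePart G) := by
  intro z hz w hw hzw
  have h1 : f z = f w := by rw [← h.coe_finiteMap hz, ← h.coe_finiteMap hw, hzw]
  exact OnePoint.coe_injective (h.conf.1.injOn hz hw h1)

theorem infty_mem' (h : ConformalExtension G G' f F) : ∞ ∈ G' := by
  have := h.conf.1.mapsTo h.infty_mem
  rwa [h.map_infty] at this

theorem exists_hatImage_eq (h : ConformalExtension G G' f F) {D : Set ℂ}
    (hD : onSphere D ∈ complComponents G) :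
    ∃ (c : ℂ) (ρ : ℝ), 0 ≤ ρ ∧ hatImage F (onSphere D) = onSphere (Metric.closedBall c ρ) := by
  have hD' := hD
  obtain ⟨x, hx, hxD⟩ := hD'
  have hxm : x ∈ onSphere D := hxD ▸ mem_connectedComponentIn hx
  refine exists_eq_closedBall_of_isCircleDomain h.circle h.infty_mem' ?_
  rw [hatImage_component hD hxm]
  exact preimage_extension_mem_complComponents h.ext h.conf.1 hx

/-- Along a curve that accumulates at a point of `D`, continuity of the extension at the class of
`D` drives the images towards the image disk. -/
theorem exists_near (h : ConformalExtension G G' f F) {D : Set ℂ}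
    (hD : onSphere D ∈ complComponents G) {c : ℂ} {ρ : ℝ}
    (himg : hatImage F (onSphere D) = onSphere (Metric.closedBall c ρ)) {γ : Set ℂ}
    (hγ : γ ⊆ finitePart G) {e : ℂ} (heD : e ∈ D) (he : e ∈ closure γ) {η : ℝ} (hη : 0 < η) :
    ∃ p ∈ γ, ‖finiteMap f p - c‖ ≤ ρ + η := by
  have hV : IsOpen (onSphere (Metric.ball c (ρ + η))) := isOpenMap_coe _ Metric.isOpen_ball
  have h1 := eventually_mem_of_extends h.circle.1 h.ext (x := (e : OnePoint ℂ)) hV (by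
    rw [← hatImage_component hD (coe_mem_onSphere.2 heD), himg]
    exact image_mono (Metric.closedBall_subset_ball (by linarith)))
  have h2 := (continuous_coe.tendsto e).eventually h1
  obtain ⟨p, hpγ, hp⟩ := (mem_closure_iff_frequently.1 he |>.and_eventually h2).exists
  refine ⟨p, hpγ, ?_⟩
  have h3 := hp (hγ hpγ)
  rw [← h.coe_finiteMap (hγ hpγ), coe_mem_onSphere, mem_ball_iff_norm] at h3
  exact h3.le

/-- A complementary component that is joined to another one by a short family is mapped to a
nondegenerate disk. -/
theorem radius_pos (h : ConformalExtension G G' f F) {D₁ D₂ : Set ℂ}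
    (hD₁ : onSphere D₁ ∈ complComponents G) (hD₂ : onSphere D₂ ∈ complComponents G)
    (hne : Disjoint D₁ D₂) {c₁ : ℂ} {ρ₁ : ℝ} (hρ₁ : 0 ≤ ρ₁)
    (h₁ : hatImage F (onSphere D₁) = onSphere (Metric.closedBall c₁ ρ₁))
    {I : Set ℝ} {γ : ℝ → Set ℂ} (hs : ShortFamily (finiteMap f) I γ)
    (hγ : ∀ s ∈ I, γ s ⊆ finitePart G) (ht₁ : ∀ s ∈ I, (D₁ ∩ closure (γ s)).Nonempty)
    (ht₂ : ∀ s ∈ I, (D₂ ∩ closure (γ s)).Nonempty) : 0 < ρ₁ := by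
  refine hρ₁.lt_of_ne fun h0 => ?_
  subst h0
  obtain ⟨c₂, ρ₂, hρ₂, h₂⟩ := h.exists_hatImage_eq hD₂
  -- Distinct components have disjoint images because `F` is injective, so the point `c₁` has
  -- positive distance from the image of `D₂`.
  have hd : ρ₂ < ‖c₁ - c₂‖ := by
    by_contra hcon
    have h3 : (c₁ : OnePoint ℂ) ∈ hatImage F (onSphere D₁) := by
      rw [h₁, coe_mem_onSphere]
      exact Metric.mem_closedBall_self le_rfl
    have h4 : (c₁ : OnePoint ℂ) ∈ hatImage F (onSphere D₂) := by
      rw [h₂, coe_mem_onSphere, mem_closedBall_iff_norm]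
      exact not_lt.1 hcon
    obtain ⟨_, ⟨x, hx, rfl⟩, h5⟩ := h3
    obtain ⟨_, ⟨y, hy, rfl⟩, h6⟩ := h4
    have h7 := F.injective (h5.trans h6.symm)
    rw [collapseMap_eq_iff] at h7
    rcases h7 with ⟨-, hxG⟩ | ⟨p, hp, hxp, hyp⟩
    · exact mem_complComponents_subset hD₁ hx hxG
    · have h8 : onSphere D₁ = onSphere D₂ := by
        rw [eq_of_mem_complComponents hD₁ hx, eq_of_mem_complComponents hD₂ hy,
          ← eq_of_mem_complComponents hp hxp, ← eq_of_mem_complComponents hp hyp]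
      obtain ⟨z, hz, rfl⟩ := hx
      have hz2 : (z : OnePoint ℂ) ∈ onSphere D₂ := h8 ▸ coe_mem_onSphere.2 hz
      exact disjoint_left.1 hne hz (coe_mem_onSphere.1 hz2)
  have hR := one_lt_dilFactor
  -- All the curves come as close as desired to the point `c₁`. With the radius d / (4 `dilFactor`),
  -- some curve stays within d/4 of `c₁`, yet it also comes within d/4 of the image of `D₂`, which
  -- is at distance d.
  set d := ‖c₁ - c₂‖ - ρ₂ with hd'
  have hd0 : 0 < d := by linarith
  obtain ⟨s, hsI, hall⟩ := hs c₁ (d / (4 * dilFactor)) (by positivity) (fun s hsI => by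
    obtain ⟨e, heD, he⟩ := ht₁ s hsI
    obtain ⟨p, hp, hle⟩ := h.exists_near hD₁ h₁ (hγ s hsI) heD he
      (η := d / (4 * dilFactor)) (by positivity)
    exact ⟨p, hp, by simpa using hle⟩)
  obtain ⟨e, heD, he⟩ := ht₂ s hsI
  obtain ⟨p, hp, hle⟩ := h.exists_near hD₂ h₂ (hγ s hsI) heD he (η := d / 4) (by positivity)
  have h5 := hall p hp
  have h6 : dilFactor * (d / (4 * dilFactor)) = d / 4 := by field_simp
  rw [h6] at h5
  have h7 : ‖c₁ - c₂‖ ≤ ‖finiteMap f p - c₁‖ + ‖finiteMap f p - c₂‖ := by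
    have := norm_sub_le (finiteMap f p - c₂) (finiteMap f p - c₁)
    rw [show finiteMap f p - c₂ - (finiteMap f p - c₁) = c₁ - c₂ by ring] at this
    linarith
  linarith

/-- A short family touching a component has a member whose image stays near the image disk. -/
theorem exists_short (h : ConformalExtension G G' f F) {D : Set ℂ}
    (hD : onSphere D ∈ complComponents G) {c : ℂ} {ρ : ℝ} (hρ : 0 < ρ)
    (himg : hatImage F (onSphere D) = onSphere (Metric.closedBall c ρ))
    {I : Set ℝ} {γ : ℝ → Set ℂ} (hs : ShortFamily (finiteMap f) I γ)
    (hγ : ∀ s ∈ I, γ s ⊆ finitePart G) (ht : ∀ s ∈ I, (D ∩ closure (γ s)).Nonempty) :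
    ∃ s ∈ I, ∀ p ∈ γ s, ‖finiteMap f p - c‖ ≤ dilFactor * (2 * ρ) := by
  refine hs c (2 * ρ) (by positivity) fun s hsI => ?_
  obtain ⟨e, heD, he⟩ := ht s hsI
  obtain ⟨p, hp, hle⟩ := h.exists_near hD himg (hγ s hsI) heD he hρ
  exact ⟨p, hp, by linarith⟩

/-- Two disks joined by a short family have images at a controlled distance. -/
theorem exists_short_link (h : ConformalExtension G G' f F) {D₁ D₂ : Set ℂ}
    (hD₁ : onSphere D₁ ∈ complComponents G) (hD₂ : onSphere D₂ ∈ complComponents G)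
    {c₁ c₂ : ℂ} {ρ₁ ρ₂ : ℝ} (hρ₁ : 0 < ρ₁) (hρ₂ : 0 < ρ₂)
    (h₁ : hatImage F (onSphere D₁) = onSphere (Metric.closedBall c₁ ρ₁))
    (h₂ : hatImage F (onSphere D₂) = onSphere (Metric.closedBall c₂ ρ₂))
    {I : Set ℝ} {γ : ℝ → Set ℂ} (hs : ShortFamily (finiteMap f) I γ)
    (hγ : ∀ s ∈ I, γ s ⊆ finitePart G) (ht₁ : ∀ s ∈ I, (D₁ ∩ closure (γ s)).Nonempty)
    (ht₂ : ∀ s ∈ I, (D₂ ∩ closure (γ s)).Nonempty) :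
    ‖c₁ - c₂‖ ≤ dilFactor * (2 * ρ₁) + 2 * ρ₂ ∧
      ∃ s ∈ I, ∀ p ∈ γ s, ‖finiteMap f p - c₁‖ ≤ dilFactor * (2 * ρ₁) := by
  obtain ⟨s, hsI, hall⟩ := h.exists_short hD₁ hρ₁ h₁ hs hγ ht₁
  refine ⟨?_, s, hsI, hall⟩
  obtain ⟨e, heD, he⟩ := ht₂ s hsI
  obtain ⟨p, hp, hle⟩ := h.exists_near hD₂ h₂ (hγ s hsI) heD he hρ₂
  have := norm_sub_le (finiteMap f p - c₂) (finiteMap f p - c₁)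
  rw [show finiteMap f p - c₂ - (finiteMap f p - c₁) = c₁ - c₂ by ring] at this
  linarith [hall p hp]

/-- A point inside a box whose boundary has its image in a closed disk has its image there. -/
theorem preimage_subset_of_box (h : ConformalExtension G G' f F) {T : Set ℂ} (hT : IsCompact T)
    (hTsat : ∀ p ∈ complComponents G, (p ∩ onSphere T).Nonempty → p ⊆ onSphere T)
    {xL xR yB yT : ℝ} {c : ℂ} {ρ : ℝ} (hρ : 0 ≤ ρ)
    (hbd : ∀ u ∈ Icc xL xR ×ℂ Icc yB yT, u ∉ Ioo xL xR ×ℂ Ioo yB yT → u ∉ T →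
      u ∈ finitePart G ∧ ‖finiteMap f u - c‖ ≤ ρ)
    (hTimg : ∀ u ∈ T, collapseMap G' ⁻¹' {F (collapseMap G u)} ⊆
      onSphere (Metric.closedBall c ρ))
    {z : ℂ} (hz : z ∈ Ioo xL xR ×ℂ Ioo yB yT) (hzT : z ∉ T) :
    collapseMap G' ⁻¹' {F (collapseMap G z)} ⊆ onSphere (Metric.closedBall c ρ) := by
  have hQo : IsOpen (Ioo xL xR ×ℂ Ioo yB yT) := isOpen_Ioo.reProdIm isOpen_Ioo
  have hQc : IsCompact (Icc xL xR ×ℂ Icc yB yT) := isCompact_Icc.reProdIm isCompact_Icc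
  have hQsub : Ioo xL xR ×ℂ Ioo yB yT ⊆ Icc xL xR ×ℂ Icc yB yT := fun u hu =>
    ⟨Ioo_subset_Icc_self hu.1, Ioo_subset_Icc_self hu.2⟩
  -- Apart from `T` and the boundary of the box, whose images lie in the closed disk of radius `ρ`
  -- about `c`, the sphere consists of these two disjoint open sets.
  set Uin : Set (OnePoint ℂ) := onSphere ((Ioo xL xR ×ℂ Ioo yB yT) \ T) with hUin
  set Uout : Set (OnePoint ℂ) := (onSphere (Icc xL xR ×ℂ Icc yB yT))ᶜ \ onSphere T with hUout
  have hcov : ∀ x : OnePoint ℂ, x ∈ Uin ∨ x ∈ Uout ∨ x ∈ onSphere T ∨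
      ∃ u : ℂ, x = u ∧ u ∈ finitePart G ∧ ‖finiteMap f u - c‖ ≤ ρ := by
    intro x
    by_cases hxT : x ∈ onSphere T
    · exact Or.inr (Or.inr (Or.inl hxT))
    by_cases hxQ : x ∈ onSphere (Icc xL xR ×ℂ Icc yB yT)
    · obtain ⟨u, hu, rfl⟩ := hxQ
      have huT : u ∉ T := fun h => hxT (coe_mem_onSphere.2 h)
      by_cases huQ : u ∈ Ioo xL xR ×ℂ Ioo yB yT
      · exact Or.inl (coe_mem_onSphere.2 ⟨huQ, huT⟩)
      · exact Or.inr (Or.inr (Or.inr ⟨u, rfl, hbd u hu huQ huT⟩))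
    · exact Or.inr (Or.inl ⟨hxQ, hxT⟩)
  have hdisj : Disjoint Uin Uout := by
    rw [disjoint_left]
    rintro _ ⟨u, hu, rfl⟩ hx
    exact hx.1 (coe_mem_onSphere.2 (hQsub hu.1))
  have hUino : IsOpen Uin := isOpenMap_coe _ (hQo.sdiff hT.isClosed)
  have hUouto : IsOpen Uout := (hQc.image continuous_coe).isClosed.isOpen_compl.sdiff
    (hT.image continuous_coe).isClosed
  -- complementary components do not cross the boundary
  have hcomp : ∀ x y, CollapseRel G x y → (x ∈ Uin → y ∈ Uin) ∧ (x ∈ Uout → y ∈ Uout) := by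
    rintro x y (⟨rfl, -⟩ | ⟨p, hp, hx, hy⟩)
    · exact ⟨id, id⟩
    by_cases hpT : (p ∩ onSphere T).Nonempty
    · have hxT := hTsat p hp hpT hx
      refine ⟨fun hx' => ?_, fun hx' => absurd hxT hx'.2⟩
      obtain ⟨u, hu, rfl⟩ := hx'
      exact absurd (coe_mem_onSphere.1 hxT) hu.2
    · have hpsub : p ⊆ Uin ∪ Uout := by
        intro w hw
        rcases hcov w with h1 | h1 | h1 | ⟨u, rfl, huG, -⟩
        · exact Or.inl h1
        · exact Or.inr h1
        · exact absurd ⟨w, hw, h1⟩ hpT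
        · exact absurd huG (mem_complComponents_subset hp hw)
      rcases (isPreconnected_of_mem_complComponents hp).subset_or_subset hUino hUouto hdisj hpsub
        with h1 | h1
      · exact ⟨fun _ => h1 hy, fun hx' => absurd hx' (disjoint_left.1 hdisj (h1 hx))⟩
      · exact ⟨fun hx' => absurd (h1 hx) (disjoint_left.1 hdisj hx'), fun _ => h1 hy⟩
  have hopen : ∀ V : Set (OnePoint ℂ), IsOpen V → (∀ x y, CollapseRel G x y → x ∈ V → y ∈ V) →
      IsOpen {y | F.symm (collapseMap G' y) ∈ collapseMap G '' V} := by
    intro V hV hsat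
    have h1 : IsOpen (collapseMap G '' V) := by
      rw [isOpen_collapse_iff]
      convert hV using 1
      refine Subset.antisymm ?_ (subset_preimage_image _ _)
      rintro y ⟨x, hx, hxy⟩
      exact hsat x y (collapseMap_eq_iff.1 hxy) hx
    exact h1.preimage (F.symm.continuous.comp (continuous_collapseMap G'))
  -- The exterior of the closed disk is connected and is covered by the disjoint open images of the
  -- inside and the outside of the box, so it lies in one of them. The point ∞, fixed by f, decides
  -- for the outside.
  have hE := isPreconnected_exterior c hρ
  have hEsub : (onSphere (Metric.closedBall c ρ))ᶜ ⊆
      {y | F.symm (collapseMap G' y) ∈ collapseMap G '' Uin} ∪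
      {y | F.symm (collapseMap G' y) ∈ collapseMap G '' Uout} := by
    intro y hy
    obtain ⟨x, hx⟩ := surjective_collapseMap G (F.symm (collapseMap G' y))
    have hFx : F (collapseMap G x) = collapseMap G' y := by rw [hx, F.apply_symm_apply]
    rcases hcov x with h1 | h1 | h1 | ⟨u, rfl, huG, hu⟩
    · exact Or.inl ⟨x, h1, hx⟩
    · exact Or.inr ⟨x, h1, hx⟩
    · obtain ⟨u, hu, rfl⟩ := h1
      exact absurd (hTimg u hu hFx.symm) hy
    · rw [h.ext _ huG, collapseMap_eq_iff,
        collapseRel_iff_of_mem (h.conf.1.mapsTo huG)] at hFx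
      refine absurd ?_ hy
      rw [← hFx, ← h.coe_finiteMap huG, coe_mem_onSphere, mem_closedBall_iff_norm]
      exact hu
  have hEdisj : Disjoint {y | F.symm (collapseMap G' y) ∈ collapseMap G '' Uin}
      {y | F.symm (collapseMap G' y) ∈ collapseMap G '' Uout} := by
    rw [disjoint_left]
    rintro y ⟨x₁, hx₁, h1⟩ ⟨x₂, hx₂, h2⟩
    have h3 := (hcomp x₁ x₂ (collapseMap_eq_iff.1 (h1.trans h2.symm))).1 hx₁
    exact disjoint_left.1 hdisj h3 hx₂
  have hsub := hE.subset_or_subset (hopen Uin hUino fun x y hxy => (hcomp x y hxy).1)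
    (hopen Uout hUouto fun x y hxy => (hcomp x y hxy).2) hEdisj hEsub
  have hout : (onSphere (Metric.closedBall c ρ))ᶜ ⊆
      {y | F.symm (collapseMap G' y) ∈ collapseMap G '' Uout} := by
    refine hsub.resolve_left fun hcon => ?_
    have h1 := hcon (infty_notMem_onSphere _)
    refine disjoint_left.1 hEdisj h1 ⟨∞, ⟨infty_notMem_onSphere _, infty_notMem_onSphere _⟩, ?_⟩
    rw [F.eq_symm_apply, h.ext _ h.infty_mem, h.map_infty]
  intro q hq
  by_contra hqB
  have hq' : F (collapseMap G z) = collapseMap G' q := hq.symm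
  refine disjoint_left.1 hEdisj ⟨z, coe_mem_onSphere.2 ⟨hz, hzT⟩, ?_⟩ (hout hqB)
  rw [← hq', F.symm_apply_apply]

end ConformalExtension

end RigidCircle
end

/-! ### Sizes of the parameters and separation of the centers. -/

noncomputable section
namespace RigidCircle
open Set Filter

/-! ### The parameters -/

/-- The inequalities between the parameters of one level. -/
structure Level.Good (P : Level) : Prop where
  r_pos : 0 < P.r
  δ_pos : 0 < P.δ
  t_pos : 0 < P.t
  δ_le : P.δ ≤ P.r / 1000
  t_le : P.t ≤ P.δ / 100

/-- The relations between the parameters of consecutive levels. -/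
structure Level.Next (P Q : Level) : Prop where
  L_eq : Q.L = P.half
  r_le : Q.r ≤ P.t / 200
  t_le : Q.t ≤ P.t / 100
  N_eq : Q.N = 2 * (Q.N / 2)
  fill : ((Q.N / 2 : ℕ) : ℝ) * (2 * Q.r + Q.δ) - Q.δ = P.half

theorem Level.Good.half_pos {P : Level} (h : P.Good) : 0 < P.half := by
  have := h.r_pos
  have := h.δ_le
  rw [Level.half]
  linarith

theorem firstLevel_good : firstLevel.Good := by
  constructor <;> norm_num [firstLevel, Level.r, Level.δ, Level.t]

theorem gapRatio_pos (k N : ℕ) : 0 < gapRatio k N := by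
  rw [gapRatio]
  positivity

/-- Besides positivity, this crude bound is all that the later estimates need about the tiny gap
ratio; e^x ≥ x + 1 suffices. -/
theorem gapRatio_le {k N : ℕ} (hk : 1 ≤ k) (hN : 500 ≤ N) : gapRatio k N ≤ 1 / 1000 := by
  rw [gapRatio]
  refine one_div_le_one_div_of_le (by norm_num) ?_
  have hN' : (500 : ℝ) ≤ N := by exact_mod_cast hN
  have h1 : (2 * (N : ℝ)) ≤ (2 * (N : ℝ)) ^ (2 * k) :=
    le_self_pow₀ (by linarith) (by omega)
  have h2 := Real.add_one_le_exp ((2 * (N : ℝ)) ^ (2 * k))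
  linarith

/-- From t ≤ δ/100 and δ ≤ r/1000 one gets ε̂ ≤ 1/10, so M = ⌈100/ε̂⌉ is at least 1000. The filling
relation gives 2Ms ≤ 1; together with Mε̂ ≥ 100 this yields 200 s ≤ ε̂, which is the bound on the
new radius after scaling. -/
theorem Level.Good.next {P : Level} (h : P.Good) {k : ℕ} (hk : 1 ≤ k) :
    (nextLevel k P).Good ∧ P.Next (nextLevel k P) := by
  obtain ⟨hr, hδ, ht, hδr, htδ⟩ := h
  have hhalf : P.r / 2 ≤ P.half := by
    rw [Level.half]; linarith
  have hhalf0 : 0 < P.half := by linarith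
  have hhalf1 : P.half ≤ P.r := by
    rw [Level.half]; linarith
  set e := P.epsHat with he
  have heq : P.half * e = P.t := by
    rw [he, Level.epsHat]; field_simp
  have he0 : 0 < e := by
    rw [he, Level.epsHat]; positivity
  have he1 : e ≤ 1 / 10 := by
    rw [he, Level.epsHat, div_le_iff₀ hhalf0]
    linarith
  set M := ⌈100 / e⌉₊ with hM
  have hM1 : 100 / e ≤ (M : ℝ) := Nat.le_ceil _
  have hM2 : (1000 : ℝ) ≤ M := by
    refine le_trans ?_ hM1
    rw [le_div_iff₀ he0]
    linarith
  have hM3 : 1000 ≤ M := by exact_mod_cast hM2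
  have hN : nextN P = 2 * M := rfl
  set q := gapRatio k (2 * M) with hq
  have hq0 : 0 < q := gapRatio_pos _ _
  have hq1 : q ≤ 1 / 1000 := gapRatio_le hk (by omega)
  set s := nextS k (2 * M) with hs
  have hs' : s = 1 / (2 * M + ((M : ℝ) - 1) * q) := by
    rw [hs, nextS]
    push_cast
    congr 2
    ring
  have hden : 0 < 2 * M + ((M : ℝ) - 1) * q := by nlinarith
  have hs0 : 0 < s := by rw [hs']; positivity
  have hfill : s * (2 * M + ((M : ℝ) - 1) * q) = 1 := by
    rw [hs']; field_simp
  have hsM : 200 * s ≤ e := by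
    have h1 : 100 ≤ M * e := by rwa [div_le_iff₀ he0] at hM1
    have h2 : s * (2 * M) ≤ 1 := by
      rw [← hfill]
      have : 0 ≤ ((M : ℝ) - 1) * q := by
        have : (0 : ℝ) ≤ M - 1 := by linarith
        positivity
      nlinarith
    nlinarith
  have hrQ : (nextLevel k P).r = P.half * s := rfl
  have hδQ : (nextLevel k P).δ = P.half * (q * s) := rfl
  have htQ : (nextLevel k P).t = P.half * min (e / 100) (q * s / 100) := rfl
  have hNQ : (nextLevel k P).N / 2 = M := by
    change (2 * M) / 2 = M
    omega
  refine ⟨⟨?_, ?_, ?_, ?_, ?_⟩, ⟨rfl, ?_, ?_, ?_, ?_⟩⟩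
  · rw [hrQ]; positivity
  · rw [hδQ]; positivity
  · rw [htQ]
    have : 0 < min (e / 100) (q * s / 100) := lt_min (by positivity) (by positivity)
    positivity
  · rw [hδQ, hrQ]
    have : 0 < P.half * s := by positivity
    nlinarith
  · rw [htQ, hδQ]
    have := mul_le_mul_of_nonneg_left (min_le_right (e / 100) (q * s / 100)) hhalf0.le
    linarith
  · rw [hrQ, ← heq]
    nlinarith
  · rw [htQ, ← heq]
    have := mul_le_mul_of_nonneg_left (min_le_left (e / 100) (q * s / 100)) hhalf0.le
    linarith
  · rw [hNQ]; exact hN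
  · rw [hNQ, hrQ, hδQ]
    linear_combination P.half * hfill

theorem level_succ {k : ℕ} (hk : 1 ≤ k) : level (k + 1) = nextLevel (k + 1) (level k) := by
  obtain ⟨j, rfl⟩ := Nat.exists_eq_add_of_le' hk
  rfl

theorem level_good (k : ℕ) : (level k).Good := by
  induction k with
  | zero => exact firstLevel_good
  | succ k ih =>
    rcases Nat.eq_zero_or_pos k with rfl | hk
    · exact firstLevel_good
    · rw [level_succ hk]
      exact (ih.next (by omega)).1

theorem level_next {k : ℕ} (hk : 1 ≤ k) : (level k).Next (level (k + 1)) := by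
  rw [level_succ hk]
  exact ((level_good k).next (by omega)).2

/-! ### Coordinates of the centers -/

theorem sign_cases (σ : Side) : σ.sign = -1 ∨ σ.sign = 1 := by
  cases σ
  · exact Or.inl rfl
  · exact Or.inr rfl

theorem xCoord_cons {m : Side} {p : List Side} {k : ℕ} (hk : 1 ≤ k) (hp : p.length = k) :
    xCoord (m :: p) = xCoord p + m.sign * ((level k).t / 2) := by
  obtain ⟨a, q, rfl⟩ := List.exists_cons_of_length_pos (l := p) (by omega)
  have hk' : q.length + 1 = k := by simpa using hp
  change xCoord (a :: q) + (level (q.length + 1)).half *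
    (m.sign * ((level (q.length + 1)).epsHat / 2)) = _
  rw [hk']
  have h := (level_good k).half_pos
  rw [Level.epsHat]
  field_simp

/-- Siblings are t_k apart, while 6(t_{k+1} + r_{k+1}) is at most 9 t_k / 100. Columns with
different parents lose at most t_k of their parents' distance 6(t_k + r_k). -/
theorem xCoord_sep {k : ℕ} (hk : 1 ≤ k) {m m' : List Side} (hm : m.length = k)
    (hm' : m'.length = k) (hne : m ≠ m') :
    6 * ((level k).t + (level k).r) ≤ |xCoord m - xCoord m'| := by
  induction k, hk using Nat.le_induction generalizing m m' with
  | base =>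
    obtain ⟨a, rfl⟩ := List.length_eq_one_iff.1 hm
    obtain ⟨b, rfl⟩ := List.length_eq_one_iff.1 hm'
    change 6 * (1 * (1 / 400100) + 1 * (1000 / 4001)) ≤ |a.sign * 2 - b.sign * 2|
    cases a <;> cases b
    · exact absurd rfl hne
    · norm_num [Side.sign]
    · norm_num [Side.sign]
    · exact absurd rfl hne
  | succ k hk ih =>
    obtain ⟨a, p, rfl⟩ := List.exists_cons_of_length_pos (l := m) (by omega)
    obtain ⟨b, p', rfl⟩ := List.exists_cons_of_length_pos (l := m') (by omega)
    have hp : p.length = k := by simpa using hm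
    have hp' : p'.length = k := by simpa using hm'
    rw [xCoord_cons hk hp, xCoord_cons hk hp']
    have hg := level_good k
    have hn := level_next hk
    have := hg.t_pos
    have := hg.r_pos
    have := hn.r_le
    have := hn.t_le
    by_cases hpp : p = p'
    · subst hpp
      cases a <;> cases b
      · exact absurd rfl hne
      · rw [abs_of_nonpos (by simp only [Side.sign]; linarith)]
        simp only [Side.sign]
        linarith
      · rw [abs_of_nonneg (by simp only [Side.sign]; linarith)]
        simp only [Side.sign]
        linarith
      · exact absurd rfl hne
    · have h1 := ih hp hp' hpp
      have h2 : |a.sign * ((level k).t / 2) - b.sign * ((level k).t / 2)| ≤ (level k).t := by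
        rw [abs_le]
        rcases sign_cases a with h | h <;> rcases sign_cases b with h' | h' <;> rw [h, h'] <;>
          constructor <;> linarith
      have h3 := abs_sub_abs_le_abs_sub (xCoord p - xCoord p')
        (-(a.sign * ((level k).t / 2) - b.sign * ((level k).t / 2)))
      rw [abs_neg] at h3
      have h4 : xCoord p - xCoord p' - -(a.sign * ((level k).t / 2) - b.sign * ((level k).t / 2)) =
          xCoord p + a.sign * ((level k).t / 2) - (xCoord p' + b.sign * ((level k).t / 2)) := by ring
      rw [h4] at h3
      linarith

theorem yCoord_singleton (n : ℕ) :
    yCoord [n] = ((n : ℝ) - 1) * (2 * (level 1).r + (level 1).δ) + (level 1).r := by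
  change blockCenter (level 1).s (level 1).a n = _
  have h1 : (level 1).r = (level 1).s := one_mul _
  have h2 : (level 1).δ = (level 1).a := one_mul _
  rw [blockCenter, h1, h2]

theorem yCoord_cons_lower {n : ℕ} {p : List ℕ} {k : ℕ} (hk : 1 ≤ k) (hp : p.length = k)
    (hn : n ≤ (level (k + 1)).N / 2) :
    yCoord (n :: p) = yCoord p - (level k).r +
      (((n : ℝ) - 1) * (2 * (level (k + 1)).r + (level (k + 1)).δ) + (level (k + 1)).r) := by
  obtain ⟨a, q, rfl⟩ := List.exists_cons_of_length_pos (l := p) (by omega)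
  have hk' : q.length + 1 = k := by simpa using hp
  subst hk'
  have h : yCoord (n :: a :: q) = yCoord (a :: q) - (level (q.length + 1)).r +
      (level (q.length + 1)).half *
        blockCenter (level (q.length + 2)).s (level (q.length + 2)).a n := if_pos hn
  rw [h, ← (level_next hk).L_eq, blockCenter, Level.r, Level.r, Level.δ]
  ring

theorem yCoord_cons_upper {n : ℕ} {p : List ℕ} {k : ℕ} (hk : 1 ≤ k) (hp : p.length = k)
    (hn : (level (k + 1)).N / 2 < n) :
    yCoord (n :: p) = yCoord p + (level k).δ / 2 +
      (((n : ℝ) - ((level (k + 1)).N / 2 : ℕ) - 1) *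
        (2 * (level (k + 1)).r + (level (k + 1)).δ) + (level (k + 1)).r) := by
  obtain ⟨a, q, rfl⟩ := List.exists_cons_of_length_pos (l := p) (by omega)
  have hk' : q.length + 1 = k := by simpa using hp
  subst hk'
  have h : yCoord (n :: a :: q) = yCoord (a :: q) + (level (q.length + 1)).δ / 2 +
      (level (q.length + 1)).half * blockCenter (level (q.length + 2)).s (level (q.length + 2)).a
        (n - (level (q.length + 2)).N / 2) := if_neg (not_le.2 hn)
  rw [h, ← (level_next hk).L_eq, blockCenter, Nat.cast_sub hn.le]
  simp only [Level.r, Level.δ]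
  ring

theorem yCoord_child_lower {n : ℕ} {p : List ℕ} {k : ℕ} (hk : 1 ≤ k) (hp : p.length = k)
    (h1 : 1 ≤ n) (hn : n ≤ (level (k + 1)).N / 2) :
    yCoord p - (level k).r + (level (k + 1)).r ≤ yCoord (n :: p) ∧
      yCoord (n :: p) ≤ yCoord p - (level k).δ / 2 - (level (k + 1)).r := by
  rw [yCoord_cons_lower hk hp hn]
  have hg := level_good (k + 1)
  have hfill := (level_next hk).fill
  have h1' : (1 : ℝ) ≤ n := by exact_mod_cast h1
  have hn' : (n : ℝ) ≤ ((level (k + 1)).N / 2 : ℕ) := by exact_mod_cast hn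
  have hpos : 0 < 2 * (level (k + 1)).r + (level (k + 1)).δ := by
    linarith [hg.r_pos, hg.δ_pos]
  have h2 := mul_le_mul_of_nonneg_right hn' hpos.le
  have h3 := mul_le_mul_of_nonneg_right h1' hpos.le
  rw [Level.half] at hfill
  constructor <;> linarith

theorem yCoord_child_upper {n : ℕ} {p : List ℕ} {k : ℕ} (hk : 1 ≤ k) (hp : p.length = k)
    (h1 : (level (k + 1)).N / 2 < n) (hn : n ≤ (level (k + 1)).N) :
    yCoord p + (level k).δ / 2 + (level (k + 1)).r ≤ yCoord (n :: p) ∧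
      yCoord (n :: p) ≤ yCoord p + (level k).r - (level (k + 1)).r := by
  rw [yCoord_cons_upper hk hp h1]
  have hg := level_good (k + 1)
  have hfill := (level_next hk).fill
  have hN := (level_next hk).N_eq
  have h1' : (((level (k + 1)).N / 2 : ℕ) : ℝ) + 1 ≤ n := by exact_mod_cast h1
  have hn' : (n : ℝ) ≤ 2 * ((level (k + 1)).N / 2 : ℕ) := by
    rw [hN] at hn
    exact_mod_cast hn
  have hpos : 0 < 2 * (level (k + 1)).r + (level (k + 1)).δ := by
    linarith [hg.r_pos, hg.δ_pos]
  have h2 := mul_le_mul_of_nonneg_right hn' hpos.le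
  have h3 := mul_le_mul_of_nonneg_right h1' hpos.le
  rw [Level.half] at hfill
  constructor <;> linarith

/-- The intervals of the children avoid the middle gap of the interval of the parent. -/
theorem yCoord_child {n : ℕ} {p : List ℕ} {k : ℕ} (hk : 1 ≤ k) (hp : p.length = k)
    (h1 : 1 ≤ n) (hn : n ≤ (level (k + 1)).N) :
    |yCoord (n :: p) - yCoord p| ≤ (level k).r - (level (k + 1)).r ∧
      (level k).δ / 2 + (level (k + 1)).r ≤ |yCoord (n :: p) - yCoord p| := by
  have hg := level_good (k + 1)
  have := hg.r_pos
  have := (level_good k).δ_pos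
  rcases le_or_gt n ((level (k + 1)).N / 2) with h | h
  · have h2 := yCoord_child_lower hk hp h1 h
    rw [abs_of_nonpos (by linarith)]
    constructor <;> linarith
  · have h2 := yCoord_child_upper hk hp h hn
    rw [abs_of_nonneg (by linarith)]
    constructor <;> linarith

/-- Two letters belong to the same block of the level `k`. -/
def SameBlock (k a b : ℕ) : Prop := 2 ≤ k → (a ≤ (level k).N / 2 ↔ b ≤ (level k).N / 2)

theorem yCoord_sub_of_sameBlock {a b : ℕ} {p : List ℕ}
    (h : SameBlock (p.length + 1) a b) :
    yCoord (a :: p) - yCoord (b :: p) = ((a : ℝ) - b) *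
      (2 * (level (p.length + 1)).r + (level (p.length + 1)).δ) := by
  rcases Nat.eq_zero_or_pos p.length with hp | hp
  · obtain rfl := List.eq_nil_of_length_eq_zero hp
    simp only [yCoord_singleton, List.length_nil, zero_add]
    ring
  · have h' := h (by omega)
    rcases le_or_gt a ((level (p.length + 1)).N / 2) with ha | ha
    · rw [yCoord_cons_lower hp rfl ha, yCoord_cons_lower hp rfl (h'.1 ha)]
      ring
    · have hb : (level (p.length + 1)).N / 2 < b := not_le.1 fun hb => not_le.2 ha (h'.2 hb)
      rw [yCoord_cons_upper hp rfl ha, yCoord_cons_upper hp rfl hb]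
      ring

theorem validLetters_cons {a : ℕ} {p : List ℕ} :
    ValidLetters (a :: p) ↔ (1 ≤ a ∧ a ≤ (level (p.length + 1)).N) ∧ ValidLetters p := Iff.rfl

/-- Distinct intervals of the same level are far apart, unless they belong to the same block. -/
theorem yCoord_sep_cases {k : ℕ} {a b : ℕ} {p p' : List ℕ} (hp : p.length = k) (hp' : p'.length = k)
    (hv : ValidLetters (a :: p)) (hv' : ValidLetters (b :: p')) :
    (1 ≤ k ∧ 2 * (level (k + 1)).r + (level k).δ ≤ |yCoord (a :: p) - yCoord (b :: p')|) ∨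
      (p = p' ∧ SameBlock (k + 1) a b) := by
  induction k generalizing a b p p' with
  | zero =>
    right
    rw [List.eq_nil_of_length_eq_zero hp, List.eq_nil_of_length_eq_zero hp']
    exact ⟨rfl, fun h => absurd h (by norm_num)⟩
  | succ k ih =>
    rw [validLetters_cons, hp] at hv
    rw [validLetters_cons, hp'] at hv'
    have hk : 1 ≤ k + 1 := by omega
    obtain ⟨⟨ha1, ha2⟩, hvp⟩ := hv
    obtain ⟨⟨hb1, hb2⟩, hvp'⟩ := hv'
    have hg := level_good (k + 1)
    have hg2 := level_good (k + 1 + 1)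
    by_cases hpp : p = p'
    · subst hpp
      by_cases hs : SameBlock (k + 1 + 1) a b
      · exact Or.inr ⟨rfl, hs⟩
      · left
        refine ⟨hk, ?_⟩
        have hs' : ¬ (a ≤ (level (k + 1 + 1)).N / 2 ↔ b ≤ (level (k + 1 + 1)).N / 2) :=
          fun h => hs fun _ => h
        rcases le_or_gt a ((level (k + 1 + 1)).N / 2) with ha | ha
        · have hb : (level (k + 1 + 1)).N / 2 < b := not_le.1 fun hb => hs' ⟨fun _ => hb, fun _ => ha⟩
          have h1 := yCoord_child_lower hk hp ha1 ha
          have h2 := yCoord_child_upper hk hp hb hb2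
          rw [abs_sub_comm]
          refine le_trans ?_ (le_abs_self _)
          linarith
        · have hb : b ≤ (level (k + 1 + 1)).N / 2 :=
            not_lt.1 fun hb => hs' ⟨fun h => absurd h (not_le.2 ha), fun h => absurd h (not_le.2 hb)⟩
          have h1 := yCoord_child_upper hk hp ha ha2
          have h2 := yCoord_child_lower hk hp hb1 hb
          refine le_trans ?_ (le_abs_self _)
          linarith
    · left
      refine ⟨hk, ?_⟩
      have hparent : 2 * (level (k + 1)).r + (level (k + 1)).δ ≤ |yCoord p - yCoord p'| := by
        obtain ⟨c, q, rfl⟩ := List.exists_cons_of_length_pos (l := p) (by omega)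
        obtain ⟨d, q', rfl⟩ := List.exists_cons_of_length_pos (l := p') (by omega)
        have hq : q.length = k := by simpa using hp
        have hq' : q'.length = k := by simpa using hp'
        rcases ih hq hq' hvp hvp' with ⟨hk1, h⟩ | ⟨rfl, h⟩
        · have hn := level_next hk1
          have := hn.r_le
          have := (level_good k).t_le
          have := (level_good k).δ_pos
          have := hg.δ_le
          have := hg.r_pos
          linarith
        · rw [yCoord_sub_of_sameBlock (hq ▸ h), hq, abs_mul]
          have hcd : c ≠ d := fun h => hpp (h ▸ rfl)
          have h1 : (1 : ℝ) ≤ |(c : ℝ) - d| := by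
            have h2 : (1 : ℤ) ≤ |(c : ℤ) - d| := Int.one_le_abs (sub_ne_zero.2 (by exact_mod_cast hcd))
            exact_mod_cast h2
          have h3 : 0 < 2 * (level (k + 1)).r + (level (k + 1)).δ := by
            linarith [hg.r_pos, hg.δ_pos]
          rw [abs_of_pos h3]
          nlinarith
      have h1 := (yCoord_child hk hp ha1 ha2).1
      have h2 := (yCoord_child hk hp' hb1 hb2).1
      have h3 : |yCoord p - yCoord p'| ≤ |yCoord (a :: p) - yCoord p| +
          |yCoord (a :: p) - yCoord (b :: p')| + |yCoord (b :: p') - yCoord p'| := by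
        have := abs_add_three (-(yCoord (a :: p) - yCoord p)) (yCoord (a :: p) - yCoord (b :: p'))
          (yCoord (b :: p') - yCoord p')
        rw [abs_neg] at this
        have e : yCoord p - yCoord p' = -(yCoord (a :: p) - yCoord p) +
            (yCoord (a :: p) - yCoord (b :: p')) + (yCoord (b :: p') - yCoord p') := by ring
        rwa [← e] at this
      linarith

/-- The middle gap of a parent is enormous compared with the disks of its children, since δ ≥ 100 t
and t ≥ 200 r at the next level. This leaves the free room beyond bottoms and tops. -/
theorem δ_level_ge {k : ℕ} (hk : 1 ≤ k) : 20000 * (level (k + 1)).r ≤ (level k).δ := by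
  have := (level_next hk).r_le
  have := (level_good k).t_le
  linarith

theorem yCoord_sep {k : ℕ} {n n' : List ℕ} (hn : n.length = k) (hn' : n'.length = k)
    (hv : ValidLetters n) (hv' : ValidLetters n') (hne : n ≠ n') :
    2 * (level k).r + (level k).δ ≤ |yCoord n - yCoord n'| := by
  rcases n with - | ⟨a, p⟩
  · subst hn
    exact absurd (List.eq_nil_of_length_eq_zero hn').symm hne
  rcases n' with - | ⟨b, p'⟩
  · subst hn'
    exact absurd (List.eq_nil_of_length_eq_zero hn) hne
  obtain ⟨k, rfl⟩ : ∃ j, k = j + 1 := ⟨p.length, by simpa using hn.symm⟩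
  have hp : p.length = k := by simpa using hn
  have hp' : p'.length = k := by simpa using hn'
  have hg := level_good (k + 1)
  rcases yCoord_sep_cases hp hp' hv hv' with ⟨hk, h⟩ | ⟨rfl, h⟩
  · linarith [δ_level_ge hk, hg.δ_le, hg.r_pos]
  · rw [yCoord_sub_of_sameBlock (hp ▸ h), hp, abs_mul]
    have hcd : a ≠ b := fun h => hne (h ▸ rfl)
    have h1 : (1 : ℝ) ≤ |(a : ℝ) - b| := by
      have h2 : (1 : ℤ) ≤ |(a : ℤ) - b| := Int.one_le_abs (sub_ne_zero.2 (by exact_mod_cast hcd))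
      exact_mod_cast h2
    have h3 : 0 < 2 * (level (k + 1)).r + (level (k + 1)).δ := by
      linarith [hg.r_pos, hg.δ_pos]
    rw [abs_of_pos h3]
    nlinarith

/-- The excluded letter is the last one below the middle gap of the parent, where the next center
jumps by more; the first level has no such gap. -/
theorem yCoord_succ {a : ℕ} {p : List ℕ}
    (ha : 2 ≤ p.length + 1 → a ≠ (level (p.length + 1)).N / 2) :
    yCoord ((a + 1) :: p) = yCoord (a :: p) +
      (2 * (level (p.length + 1)).r + (level (p.length + 1)).δ) := by
  have h := yCoord_sub_of_sameBlock (a := a + 1) (b := a) (p := p) (fun h2 => by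
    have := ha h2
    omega)
  push_cast at h
  linarith

/-- There is room below a bottom. -/
theorem yCoord_bottom {k a b : ℕ} {p p' : List ℕ} (hp : p.length = k) (hp' : p'.length = k)
    (hv : ValidLetters (a :: p)) (hv' : ValidLetters (b :: p')) (ha : IsBottom (k + 1) a) :
    yCoord (a :: p) ≤ yCoord (b :: p') ∨
      yCoord (b :: p') ≤ yCoord (a :: p) - 6 * (level (k + 1)).r := by
  have hg := level_good (k + 1)
  rcases yCoord_sep_cases hp hp' hv hv' with ⟨hk, h⟩ | ⟨rfl, h⟩
  · have h1 := δ_level_ge hk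
    rcases le_abs'.1 h with h2 | h2
    · left; linarith [hg.r_pos, (level_good k).δ_pos]
    · right; linarith [hg.r_pos]
  · left
    have h1 := yCoord_sub_of_sameBlock (hp ▸ h)
    rw [hp] at h1
    rw [validLetters_cons] at hv'
    have hab : a ≤ b := by
      rcases ha with rfl | ⟨h2, rfl⟩
      · exact hv'.1.1
      · have := h h2
        omega
    have hab' : (a : ℝ) ≤ b := by exact_mod_cast hab
    have h3 : 0 < 2 * (level (k + 1)).r + (level (k + 1)).δ := by
      linarith [hg.r_pos, hg.δ_pos]
    nlinarith

/-- There is room above a top. -/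
theorem yCoord_top {k a b : ℕ} {p p' : List ℕ} (hp : p.length = k) (hp' : p'.length = k)
    (hv : ValidLetters (a :: p)) (hv' : ValidLetters (b :: p')) (ha : IsTop (k + 1) a) :
    yCoord (b :: p') ≤ yCoord (a :: p) ∨
      yCoord (a :: p) + 6 * (level (k + 1)).r ≤ yCoord (b :: p') := by
  have hg := level_good (k + 1)
  rcases yCoord_sep_cases hp hp' hv hv' with ⟨hk, h⟩ | ⟨rfl, h⟩
  · have h1 := δ_level_ge hk
    rcases le_abs'.1 h with h2 | h2
    · right; linarith [hg.r_pos]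
    · left; linarith [hg.r_pos, (level_good k).δ_pos]
  · left
    have h1 := yCoord_sub_of_sameBlock (hp ▸ h)
    rw [hp] at h1
    rw [validLetters_cons, hp] at hv'
    have hab : b ≤ a := by
      rcases ha with ⟨h2, rfl⟩ | rfl
      · exact (h h2).1 le_rfl
      · exact hv'.1.2
    have hab' : (b : ℝ) ≤ a := by exact_mod_cast hab
    have h3 : 0 < 2 * (level (k + 1)).r + (level (k + 1)).δ := by
      linarith [hg.r_pos, hg.δ_pos]
    nlinarith

end RigidCircle
end

/-! ### The complement of Ω: isolation of the disks and free channels. -/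

noncomputable section
namespace RigidCircle
open Set Filter

/-! ### Disks, rectangles and the complement of the domain -/

/-- The finite part of the complement of `Omega`. -/
def complementSet : Set ℂ := diskUnion ∪ cantorProduct

theorem Omega_compl : Omegaᶜ = onSphere complementSet := compl_compl _

theorem mem_finitePart_Omega {u : ℂ} : u ∈ finitePart Omega ↔ u ∉ complementSet := by
  change (u : OnePoint ℂ) ∈ (onSphere complementSet)ᶜ ↔ _
  rw [mem_compl_iff, coe_mem_onSphere]

theorem mem_disk {k : ℕ} {w : Word} {σ : Side} {u : ℂ} : u ∈ (disk k w σ).toSet ↔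
    (u.re - (xCoord w.m + σ.sign * (2 * (level k).t + (level k).r))) ^ 2 +
      (u.im - yCoord w.n) ^ 2 ≤ (level k).r ^ 2 := by
  have hr := (level_good k).r_pos
  rw [Disk.toSet, mem_closedBall_iff_norm, ← abs_of_nonneg (norm_nonneg _),
    ← abs_of_pos (show 0 < (disk k w σ).radius from hr), ← sq_le_sq, ← Complex.normSq_eq_norm_sq,
    Complex.normSq_apply]
  simp only [disk, Complex.sub_re, Complex.sub_im, pow_two]

theorem abs_le_of_mem_disk {k : ℕ} {w : Word} {σ : Side} {u : ℂ} (hu : u ∈ (disk k w σ).toSet) :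
    |u.re - (xCoord w.m + σ.sign * (2 * (level k).t + (level k).r))| ≤ (level k).r ∧
      |u.im - yCoord w.n| ≤ (level k).r := by
  rw [mem_disk] at hu
  have hr := (level_good k).r_pos
  exact ⟨abs_le_of_sq_le_sq (by nlinarith) hr.le, abs_le_of_sq_le_sq (by nlinarith) hr.le⟩

theorem mem_rect {k : ℕ} {w : Word} {u : ℂ} : u ∈ rect k w ↔
    |u.re - xCoord w.m| ≤ (level k).t ∧ |u.im - yCoord w.n| ≤ (level k).r := by
  rw [rect, Complex.mem_reProdIm, mem_Icc, mem_Icc, abs_le, abs_le]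
  constructor <;> rintro ⟨⟨h1, h2⟩, h3, h4⟩ <;> refine ⟨⟨?_, ?_⟩, ?_, ?_⟩ <;> linarith

/-- The rectangle spanned by a rectangle and its two disks. -/
def hull (k : ℕ) (w : Word) : Set ℂ :=
  {u | |u.re - xCoord w.m| ≤ 2 * (level k).t + 2 * (level k).r ∧
    |u.im - yCoord w.n| ≤ (level k).r}

theorem disk_subset_hull (k : ℕ) (w : Word) (σ : Side) : (disk k w σ).toSet ⊆ hull k w := by
  intro u hu
  obtain ⟨h1, h2⟩ := abs_le_of_mem_disk hu
  have hg := level_good k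
  have := hg.r_pos
  have := hg.t_pos
  refine ⟨?_, h2⟩
  rw [abs_le] at h1 ⊢
  rcases sign_cases σ with h | h <;> rw [h] at h1 <;> constructor <;> linarith

theorem rect_subset_hull (k : ℕ) (w : Word) : rect k w ⊆ hull k w := by
  intro u hu
  obtain ⟨h1, h2⟩ := mem_rect.1 hu
  have hg := level_good k
  have := hg.r_pos
  have := hg.t_pos
  exact ⟨by linarith, h2⟩

/-- A point of a rectangle which avoids the middle gap of its vertical sides. -/
def InHalves (k : ℕ) (w : Word) (u : ℂ) : Prop :=
  u ∈ rect k w ∧ (level k).δ / 2 ≤ |u.im - yCoord w.n|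

theorem exists_parent {k : ℕ} {w : Word} (hw : w ∈ words (k + 1)) :
    ∃ w' ∈ words k, ∃ (a : Side) (b : ℕ), w = ⟨a :: w'.m, b :: w'.n⟩ ∧ 1 ≤ b ∧
      b ≤ (level (k + 1)).N := by
  obtain ⟨m, n⟩ := w
  obtain ⟨h1, h2, h3⟩ := hw
  obtain ⟨a, p, rfl⟩ := List.exists_cons_of_length_pos (l := m) (by simp only at h1; omega)
  obtain ⟨b, q, rfl⟩ := List.exists_cons_of_length_pos (l := n) (by simp only at h2; omega)
  have hp : p.length = k := by simpa using h1
  have hq : q.length = k := by simpa using h2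
  have h3' := validLetters_cons.1 h3
  rw [hq] at h3'
  exact ⟨⟨p, q⟩, ⟨hp, hq, h3'.2⟩, a, b, rfl, h3'.1.1, h3'.1.2⟩

/-- A child and its disks reach at most t_k/2 + 2 t_{k+1} + 2 r_{k+1} < t_k from the axis of the
parent, and vertically they stay on one side of its middle gap. -/
theorem exists_inHalves_parent {k : ℕ} (hk : 1 ≤ k) {w : Word} (hw : w ∈ words (k + 1)) {u : ℂ}
    (hu : u ∈ hull (k + 1) w) : ∃ w' ∈ words k, InHalves k w' u := by
  obtain ⟨w', hw', a, b, rfl, hb1, hb2⟩ := exists_parent hw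
  refine ⟨w', hw', ?_⟩
  obtain ⟨h1, h2⟩ := hu
  rw [xCoord_cons hk hw'.1] at h1
  obtain ⟨h3, h4⟩ := yCoord_child hk hw'.2.1 hb1 hb2
  have hn := level_next hk
  have := hn.r_le
  have := hn.t_le
  have := (level_good k).t_pos
  refine ⟨mem_rect.2 ⟨?_, ?_⟩, ?_⟩
  · rw [abs_le] at h1 ⊢
    rcases sign_cases a with h | h <;> rw [h] at h1 <;> constructor <;> linarith
  · have h5 := abs_add_le (u.im - yCoord (b :: w'.n)) (yCoord (b :: w'.n) - yCoord w'.n)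
    rw [sub_add_sub_cancel] at h5
    linarith
  · have h5 := abs_sub_abs_le_abs_sub (yCoord (b :: w'.n) - yCoord w'.n)
      (yCoord (b :: w'.n) - u.im)
    rw [sub_sub_sub_cancel_left, abs_sub_comm _ u.im] at h5
    linarith

theorem exists_inHalves_of_lt {j k : ℕ} (hk : 1 ≤ k) (hkj : k + 1 ≤ j) {w : Word}
    (hw : w ∈ words j) {u : ℂ} (hu : u ∈ hull j w) : ∃ w' ∈ words k, InHalves k w' u := by
  induction j, hkj using Nat.le_induction generalizing w with
  | base => exact exists_inHalves_parent hk hw hu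
  | succ j hj ih =>
    obtain ⟨w', hw', h⟩ := exists_inHalves_parent (by omega) hw hu
    exact ih hw' (rect_subset_hull _ _ h.1)

theorem mem_diskUnion {u : ℂ} : u ∈ diskUnion ↔ ∃ k, 1 ≤ k ∧ ∃ w ∈ words k, ∃ σ,
    u ∈ (disk k w σ).toSet := by
  simp only [diskUnion, mem_iUnion, mem_Ici, exists_prop]

theorem mem_cantorProduct {u : ℂ} : u ∈ cantorProduct ↔ ∀ k, 1 ≤ k → ∃ w ∈ words k,
    u ∈ rect k w := by
  simp only [cantorProduct, mem_iInter, mem_iUnion, mem_Ici, exists_prop]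

theorem exists_inHalves_of_mem_cantorProduct {u : ℂ} (hu : u ∈ cantorProduct) {k : ℕ}
    (hk : 1 ≤ k) : ∃ w ∈ words k, InHalves k w u := by
  obtain ⟨w, hw, h⟩ := mem_cantorProduct.1 hu (k + 1) (by omega)
  exact exists_inHalves_parent hk hw (rect_subset_hull _ _ h)

/-- The complement of Ω as seen at the scale k: everything belonging to later levels is hidden in
the halves of the rectangles of level k. -/
theorem mem_complementSet_cases {u : ℂ} (hu : u ∈ complementSet) {k : ℕ} (hk : 1 ≤ k) :
    (∃ j, 1 ≤ j ∧ j < k ∧ ∃ w ∈ words j, ∃ σ, u ∈ (disk j w σ).toSet) ∨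
      ∃ w ∈ words k, (∃ σ, u ∈ (disk k w σ).toSet) ∨ InHalves k w u := by
  rcases hu with hu | hu
  · obtain ⟨j, hj, w, hw, σ, h⟩ := mem_diskUnion.1 hu
    rcases lt_trichotomy j k with hjk | rfl | hjk
    · exact Or.inl ⟨j, hj, hjk, w, hw, σ, h⟩
    · exact Or.inr ⟨w, hw, Or.inl ⟨σ, h⟩⟩
    · obtain ⟨w', hw', h'⟩ := exists_inHalves_of_lt hk hjk hw (disk_subset_hull _ _ _ h)
      exact Or.inr ⟨w', hw', Or.inr h'⟩
  · obtain ⟨w, hw, h⟩ := exists_inHalves_of_mem_cantorProduct hu hk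
    exact Or.inr ⟨w, hw, Or.inr h⟩

/-- The shift by t/2 from parent to child, enlarged by the width of the child's strip, stays below
t, so the whole strip sits strictly inside the column of the ancestor's rectangle. -/
theorem exists_ancestor {j k : ℕ} (hj : 1 ≤ j) (hjk : j + 1 ≤ k) {m : List Side}
    (hm : m.length = k) {x : ℝ}
    (hx : |x - xCoord m| ≤ 3 * (level k).t + 3 * (level k).r) :
    ∃ m' : List Side, m'.length = j ∧ |x - xCoord m'| < (level j).t := by
  induction k, hjk using Nat.le_induction generalizing m with
  | base =>
    obtain ⟨a, p, rfl⟩ := List.exists_cons_of_length_pos (l := m) (by omega)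
    have hp : p.length = j := by simpa using hm
    refine ⟨p, hp, ?_⟩
    rw [xCoord_cons hj hp] at hx
    have hn := level_next hj
    have := hn.r_le
    have := hn.t_le
    have := (level_good j).t_pos
    rw [abs_le] at hx
    rw [abs_lt]
    rcases sign_cases a with h | h <;> rw [h] at hx <;> constructor <;> linarith
  | succ k hk ih =>
    obtain ⟨a, p, rfl⟩ := List.exists_cons_of_length_pos (l := m) (by omega)
    have hp : p.length = k := by simpa using hm
    refine ih hp ?_
    have hk1 : 1 ≤ k := by omega
    rw [xCoord_cons hk1 hp] at hx
    have hn := level_next hk1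
    have := hn.r_le
    have := hn.t_le
    have := (level_good k).t_pos
    have := (level_good k).r_pos
    rw [abs_le] at hx ⊢
    rcases sign_cases a with h | h <;> rw [h] at hx <;> constructor <;> linarith

/-- A disk of level j stays at distance at least 2 t_j from the axis of its own column, whereas the
strip lies within t_j of the axis of its ancestor. Other columns are excluded by `xCoord_sep`. -/
theorem notMem_disk_of_lt {j k : ℕ} (hj : 1 ≤ j) (hjk : j < k) {m : List Side}
    (hm : m.length = k) {u : ℂ} (hu : |u.re - xCoord m| ≤ 3 * (level k).t + 3 * (level k).r)
    {w : Word} (hw : w ∈ words j) (σ : Side) : u ∉ (disk j w σ).toSet := by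
  intro h
  obtain ⟨m', hm', hx⟩ := exists_ancestor hj hjk hm hu
  have h1 := (abs_le_of_mem_disk h).1
  have hg := level_good j
  have := hg.t_pos
  have := hg.r_pos
  by_cases hmm : w.m = m'
  · rw [hmm] at h1
    rw [abs_le] at h1
    rw [abs_lt] at hx
    rcases sign_cases σ with h | h <;> rw [h] at h1 <;> linarith
  · have h2 := xCoord_sep hj hw.1 hm' hmm
    have h3 := (disk_subset_hull _ _ _ h).1
    have h4 := abs_sub_le (xCoord w.m) u.re (xCoord m')
    rw [abs_sub_comm _ u.re] at h4
    linarith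

/-- The complement of `Omega` in the vertical strip around a rectangle and its disks. -/
theorem mem_complementSet_strip {k : ℕ} (hk : 1 ≤ k) {m : List Side} (hm : m.length = k) {u : ℂ}
    (hx : |u.re - xCoord m| ≤ 3 * (level k).t + 3 * (level k).r) (hu : u ∈ complementSet) :
    ∃ n, ⟨m, n⟩ ∈ words k ∧ ((∃ σ, u ∈ (disk k ⟨m, n⟩ σ).toSet) ∨ InHalves k ⟨m, n⟩ u) := by
  rcases mem_complementSet_cases hu hk with ⟨j, hj, hjk, w, hw, σ, h⟩ | ⟨⟨m', n⟩, hw, h⟩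
  · exact absurd h (notMem_disk_of_lt hj hjk hm hx hw σ)
  · have h1 : u ∈ hull k ⟨m', n⟩ := by
      rcases h with ⟨σ, h⟩ | h
      · exact disk_subset_hull _ _ _ h
      · exact rect_subset_hull _ _ h.1
    have hmm : m' = m := by
      by_contra hne
      have h2 := xCoord_sep hk hw.1 hm hne
      have h3 := h1.1
      have h4 := abs_sub_le (xCoord m') u.re (xCoord m)
      rw [abs_sub_comm _ u.re] at h4
      simp only at h3 h2
      have := (level_good k).t_pos
      have := (level_good k).r_pos
      linarith
    subst hmm
    exact ⟨n, hw, h⟩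

/-! ### The domain is open -/

theorem Side.finite_univ : (univ : Set Side).Finite :=
  ((finite_singleton Side.Le).insert Side.Ri).subset fun σ _ => by
    cases σ
    · exact Or.inr rfl
    · exact Or.inl rfl

instance : Finite Side := finite_univ_iff.1 Side.finite_univ

theorem finite_words (k : ℕ) : (words k).Finite := by
  have hn : {n : List ℕ | n.length = k ∧ ValidLetters n}.Finite := by
    induction k with
    | zero => exact (finite_singleton []).subset fun n hn => List.eq_nil_of_length_eq_zero hn.1
    | succ k ih =>
      refine (((finite_Icc 1 (level (k + 1)).N).prod ih).image fun q => q.1 :: q.2).subset ?_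
      rintro n ⟨h1, h2⟩
      obtain ⟨b, q, rfl⟩ := List.exists_cons_of_length_pos (l := n) (by omega)
      have hq : q.length = k := by simpa using h1
      have h3 := validLetters_cons.1 h2
      rw [hq] at h3
      exact ⟨(b, q), ⟨⟨h3.1.1, h3.1.2⟩, hq, h3.2⟩, rfl⟩
  refine (((List.finite_length_eq Side k).prod hn).image fun q => ⟨q.1, q.2⟩).subset ?_
  rintro ⟨m, n⟩ ⟨h1, h2, h3⟩
  exact ⟨(m, n), ⟨h1, h2, h3⟩, rfl⟩

/-- The disks of the levels up to `k` and the rectangles of the level `k`. -/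
def approximation (k : ℕ) : Set ℂ :=
  (⋃ j ∈ Icc 1 k, ⋃ w ∈ words j, ⋃ σ : Side, (disk j w σ).toSet) ∪ ⋃ w ∈ words k, rect k w

theorem isCompact_approximation (k : ℕ) : IsCompact (approximation k) := by
  refine IsCompact.union ?_ ?_
  · exact (finite_Icc 1 k).isCompact_biUnion fun j _ => (finite_words j).isCompact_biUnion
      fun w _ => isCompact_iUnion fun σ => isCompact_closedBall _ _
  · exact (finite_words k).isCompact_biUnion fun w _ => isCompact_Icc.reProdIm isCompact_Icc

/-- The union of infinitely many disks with E × F is not visibly closed. The approximations are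
finite unions of compact sets, and this yields that Ω is open. -/
theorem complementSet_eq_iInter : complementSet = ⋂ k ∈ Ici 1, approximation k := by
  ext u
  simp only [mem_iInter, mem_Ici, approximation, mem_union, mem_iUnion, mem_Icc, exists_prop]
  constructor
  · intro hu k hk
    rcases mem_complementSet_cases hu hk with ⟨j, hj, hjk, w, hw, σ, h⟩ | ⟨w, hw, ⟨σ, h⟩ | h⟩
    · exact Or.inl ⟨j, ⟨hj, hjk.le⟩, w, hw, σ, h⟩
    · exact Or.inl ⟨k, ⟨hk, le_rfl⟩, w, hw, σ, h⟩
    · exact Or.inr ⟨w, hw, h.1⟩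
  · intro h
    by_cases hd : u ∈ diskUnion
    · exact Or.inl hd
    · right
      rw [mem_cantorProduct]
      intro k hk
      rcases h k hk with ⟨j, ⟨hj, -⟩, w, hw, σ, h1⟩ | h1
      · exact absurd (mem_diskUnion.2 ⟨j, hj, w, hw, σ, h1⟩) hd
      · exact h1

theorem isCompact_complementSet : IsCompact complementSet := by
  rw [complementSet_eq_iInter]
  refine (isCompact_approximation 1).of_isClosed_subset
    (isClosed_biInter fun k _ => (isCompact_approximation k).isClosed) ?_
  exact biInter_subset_of_mem (mem_Ici.2 le_rfl)

theorem isOpen_Omega : IsOpen Omega :=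
  (isCompact_complementSet.image OnePoint.continuous_coe).isClosed.isOpen_compl

theorem infty_mem_Omega : OnePoint.infty ∈ Omega := infty_notMem_onSphere _

/-! ### The disks are complementary components -/

/-- Each disk is isolated: its own rectangle is t_k away, the rectangles and disks of other words in
the column are at least δ_k > t_k away vertically, and the larger disks avoid the strip. -/
theorem mem_disk_of_near {k : ℕ} (hk : 1 ≤ k) {w : Word} (hw : w ∈ words k) {σ : Side} {u : ℂ}
    (hx : |u.re - (xCoord w.m + σ.sign * (2 * (level k).t + (level k).r))| <
      (level k).r + (level k).t) (hy : |u.im - yCoord w.n| < (level k).r + (level k).t)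
    (hu : u ∈ complementSet) : u ∈ (disk k w σ).toSet := by
  have hg := level_good k
  have ht := hg.t_pos
  have hr := hg.r_pos
  have hx' : (level k).t < σ.sign * (u.re - xCoord w.m) ∧
      σ.sign * (u.re - xCoord w.m) ≤ 3 * (level k).t + 2 * (level k).r := by
    rw [abs_lt] at hx
    rcases sign_cases σ with h | h <;> rw [h] at hx ⊢ <;> constructor <;> linarith
  have hx2 : |u.re - xCoord w.m| ≤ 3 * (level k).t + 3 * (level k).r := by
    rw [abs_le]
    rcases sign_cases σ with h | h <;> rw [h] at hx' <;> constructor <;> linarith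
  obtain ⟨n, hn, h⟩ := mem_complementSet_strip hk hw.1 hx2 hu
  by_cases hne : n = w.n
  · subst hne
    rcases h with ⟨σ', h⟩ | h
    · have h1 := (abs_le_of_mem_disk h).1
      rw [abs_le] at h1
      have : σ' = σ := by
        cases σ <;> cases σ' <;> simp only [Side.sign] at h1 hx' <;> first | rfl | (exfalso; linarith)
      rwa [this] at h
    · have h1 := (mem_rect.1 h.1).1
      rw [abs_le] at h1
      simp only at h1
      exfalso
      rcases sign_cases σ with h | h <;> rw [h] at hx' <;> linarith
  · exfalso
    have h1 := yCoord_sep hn.2.1 hw.2.1 hn.2.2 hw.2.2 hne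
    have h2 : |u.im - yCoord n| ≤ (level k).r := by
      rcases h with ⟨σ', h⟩ | h
      · exact (abs_le_of_mem_disk h).2
      · exact (mem_rect.1 h.1).2
    have h3 := abs_sub_le (yCoord n) u.im (yCoord w.n)
    rw [abs_sub_comm _ u.im] at h3
    simp only at h1
    linarith [hg.t_le, hg.δ_pos]

theorem onSphere_disk_mem_complComponents {k : ℕ} (hk : 1 ≤ k) {w : Word} (hw : w ∈ words k)
    (σ : Side) : onSphere (disk k w σ).toSet ∈ complComponents Omega := by
  have hg := level_good k
  have ht := hg.t_pos
  have hr := hg.r_pos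
  set D := disk k w σ with hD
  have hDr : D.radius = (level k).r := rfl
  have hc : D.center ∈ D.toSet := Metric.mem_closedBall_self hr.le
  have hDK : D.toSet ⊆ complementSet := fun u hu =>
    Or.inl (mem_diskUnion.2 ⟨k, hk, w, hw, σ, hu⟩)
  have hDO : onSphere D.toSet ⊆ Omegaᶜ := by
    rw [Omega_compl]
    exact image_mono hDK
  have hcO : (D.center : OnePoint ℂ) ∈ Omegaᶜ := hDO (mem_image_of_mem _ hc)
  refine ⟨D.center, hcO, Subset.antisymm ?_ ?_⟩
  · refine IsPreconnected.subset_connectedComponentIn ?_ (mem_image_of_mem _ hc) hDO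
    exact (convex_closedBall _ _).isPreconnected.image _ OnePoint.continuous_coe.continuousOn
  · have hpre := isPreconnected_connectedComponentIn (F := Omegaᶜ) (x := (D.center : OnePoint ℂ))
    have hsub := connectedComponentIn_subset Omegaᶜ (D.center : OnePoint ℂ)
    have hnear : ∀ u ∈ complementSet, u ∈ Metric.ball D.center (D.radius + (level k).t) →
        u ∈ D.toSet := by
      intro u hu hub
      rw [mem_ball_iff_norm] at hub
      refine mem_disk_of_near hk hw ?_ ?_ hu
      · exact (Complex.abs_re_le_norm (u - D.center)).trans_lt hub
      · exact (Complex.abs_im_le_norm (u - D.center)).trans_lt hub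
    have h1 : IsOpen (onSphere (Metric.ball D.center (D.radius + (level k).t))) :=
      OnePoint.isOpenMap_coe _ Metric.isOpen_ball
    have h2 : IsOpen (onSphere D.toSet)ᶜ :=
      ((isCompact_closedBall _ _).image OnePoint.continuous_coe).isClosed.isOpen_compl
    intro x hx
    by_contra hxD
    obtain ⟨y, hyC, hy1, hy2⟩ := hpre _ _ h1 h2 (by
      intro y hy
      by_cases hyD : y ∈ onSphere D.toSet
      · left
        exact image_mono (Metric.closedBall_subset_ball (by linarith)) hyD
      · exact Or.inr hyD) ⟨D.center, mem_connectedComponentIn hcO,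
        mem_image_of_mem _ (Metric.mem_ball_self (by linarith))⟩ ⟨x, hx, hxD⟩
    obtain ⟨v, hv, rfl⟩ := hy1
    have hvK := hsub hyC
    rw [Omega_compl, coe_mem_onSphere] at hvK
    exact hy2 (mem_image_of_mem _ (hnear v hvK hv))

/-! ### Regions of the domain near a rectangle -/

/-- The channel between the two disks of a word. -/
theorem mem_Omega_of_mid {k : ℕ} (hk : 1 ≤ k) {w : Word} (hw : w ∈ words k) {u : ℂ}
    (hx : |u.re - xCoord w.m| ≤ 3 * (level k).t + 3 * (level k).r)
    (hy : |u.im - yCoord w.n| < (level k).δ / 2) (hd : ∀ σ, u ∉ (disk k w σ).toSet) :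
    u ∈ finitePart Omega := by
  rw [mem_finitePart_Omega]
  intro hu
  obtain ⟨n, hn, h⟩ := mem_complementSet_strip hk hw.1 hx hu
  by_cases hne : n = w.n
  · subst hne
    rcases h with ⟨σ, h⟩ | h
    · exact hd σ h
    · exact not_lt.2 h.2 hy
  · have h1 := yCoord_sep hn.2.1 hw.2.1 hn.2.2 hw.2.2 hne
    have h2 : |u.im - yCoord n| ≤ (level k).r := by
      rcases h with ⟨σ', h⟩ | h
      · exact (abs_le_of_mem_disk h).2
      · exact (mem_rect.1 h.1).2
    have h3 := abs_sub_le (yCoord n) u.im (yCoord w.n)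
    rw [abs_sub_comm _ u.im] at h3
    simp only at h1
    linarith [(level_good k).δ_pos, (level_good k).r_pos]

/-- The channel between the disks of two consecutive words. -/
theorem mem_Omega_of_gap {k : ℕ} (hk : 1 ≤ k) {v v' : Word} (hv : v ∈ words k) (hv' : v' ∈ words k)
    (hm : v'.m = v.m) (hn : yCoord v'.n = yCoord v.n + (2 * (level k).r + (level k).δ)) {u : ℂ}
    (hx : |u.re - xCoord v.m| ≤ 3 * (level k).t + 3 * (level k).r)
    (hx' : (level k).t < |u.re - xCoord v.m|) (hy : yCoord v.n ≤ u.im) (hy' : u.im ≤ yCoord v'.n)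
    (hd : ∀ σ, u ∉ (disk k v σ).toSet) (hd' : ∀ σ, u ∉ (disk k v' σ).toSet) :
    u ∈ finitePart Omega := by
  obtain ⟨m, n⟩ := v
  obtain ⟨m', n'⟩ := v'
  simp only at hm hn hx hx' hy hy'
  subst hm
  rw [mem_finitePart_Omega]
  intro hu
  obtain ⟨q, hq, h⟩ := mem_complementSet_strip hk hv.1 hx hu
  rcases h with ⟨σ, h⟩ | h
  · have h0 := (abs_le_of_mem_disk h).2
    have hne : q ≠ n := fun hqn => hd σ (hqn ▸ h)
    have hne' : q ≠ n' := fun hqn => hd' σ (hqn ▸ h)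
    have h1 := yCoord_sep hq.2.1 hv.2.1 hq.2.2 hv.2.2 hne
    have h2 := yCoord_sep hq.2.1 hv'.2.1 hq.2.2 hv'.2.2 hne'
    simp only at h0 h1 h2
    have := (level_good k).δ_pos
    have := (level_good k).r_pos
    rw [abs_le] at h0
    rcases le_abs'.1 h1 with h1 | h1 <;> rcases le_abs'.1 h2 with h2 | h2 <;> linarith
  · exact not_le.2 hx' (mem_rect.1 h.1).1

/-- `e = -1`: a bottom, with room below; `e = 1`: a top, with room above. -/
def IsExtremal (k n : ℕ) (e : ℝ) : Prop := (e = -1 ∧ IsBottom k n) ∨ (e = 1 ∧ IsTop k n)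

/-- The region next to a bottom or a top. -/
theorem mem_Omega_of_extremal {k : ℕ} {m : List Side} {a : ℕ} {p : List ℕ}
    (hw : ⟨m, a :: p⟩ ∈ words (k + 1)) {e : ℝ} (he : IsExtremal (k + 1) a e) {u : ℂ}
    (hx : |u.re - xCoord m| ≤ 3 * (level (k + 1)).t + 3 * (level (k + 1)).r)
    (hy : 0 ≤ e * (u.im - yCoord (a :: p)))
    (hy' : e * (u.im - yCoord (a :: p)) ≤ 4 * (level (k + 1)).r)
    (hor : (level (k + 1)).t < |u.re - xCoord m| ∨
      (level (k + 1)).r < e * (u.im - yCoord (a :: p)))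
    (hd : ∀ σ, u ∉ (disk (k + 1) ⟨m, a :: p⟩ σ).toSet) : u ∈ finitePart Omega := by
  rw [mem_finitePart_Omega]
  intro hu
  obtain ⟨q, hq, h⟩ := mem_complementSet_strip (by omega) hw.1 hx hu
  have h0 : |u.im - yCoord q| ≤ (level (k + 1)).r := by
    rcases h with ⟨σ', h⟩ | h
    · exact (abs_le_of_mem_disk h).2
    · exact (mem_rect.1 h.1).2
  have hr := (level_good (k + 1)).r_pos
  have hδ := (level_good (k + 1)).δ_pos
  by_cases hne : q = a :: p
  · subst hne
    rcases h with ⟨σ, h⟩ | h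
    · exact hd σ h
    · have h1 := (mem_rect.1 h.1).1
      rcases hor with h2 | h2
      · exact not_le.2 h2 h1
      · rw [abs_le] at h0
        rcases he with ⟨rfl, -⟩ | ⟨rfl, -⟩ <;> linarith
  · have h1 := yCoord_sep hq.2.1 hw.2.1 hq.2.2 hw.2.2 hne
    obtain ⟨b, p', rfl⟩ := List.exists_cons_of_length_pos (l := q) (by
      have := hq.2.1; simp only at this; omega)
    have hp : p.length = k := by simpa using hw.2.1
    have hp' : p'.length = k := by simpa using hq.2.1
    simp only at h1
    rw [abs_le] at h0
    -- Another word either lies on the far side of the center of `a :: p`, or its center is at least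
    -- 6r beyond it. In the second case its parts reach no closer than 5r, while the region ends at
    -- 4r.
    rcases he with ⟨rfl, hb⟩ | ⟨rfl, hb⟩
    · rcases yCoord_bottom hp hp' hw.2.2 hq.2.2 hb with h2 | h2
      · rw [abs_of_nonneg (by linarith)] at h1
        linarith
      · linarith
    · rcases yCoord_top hp hp' hw.2.2 hq.2.2 hb with h2 | h2
      · rw [abs_of_nonpos (by linarith)] at h1
        linarith
      · linarith

end RigidCircle
end

/-! ### The four families of segments in the channels of Ω. -/

noncomputable section
namespace RigidCircle
open Set Filter

/-! ### Families of segments joining the disks -/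

/-- Half the length of the chord at the distance `x` from the center of a disk of radius `r`. -/
def chord (r x : ℝ) : ℝ := √(r ^ 2 - x ^ 2)

theorem continuous_chord (r : ℝ) : Continuous (chord r) := by
  unfold chord
  fun_prop

theorem chord_nonneg (r x : ℝ) : 0 ≤ chord r x := Real.sqrt_nonneg _

theorem chord_le {r : ℝ} (hr : 0 ≤ r) (x : ℝ) : chord r x ≤ r := by
  rw [chord]
  exact Real.sqrt_le_iff.2 ⟨hr, by nlinarith [sq_nonneg x]⟩

theorem chord_sq {r x : ℝ} (hx : |x| ≤ r) : x ^ 2 + chord r x ^ 2 = r ^ 2 := by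
  rw [chord, Real.sq_sqrt]
  · ring
  · have := sq_le_sq' (neg_le_of_abs_le hx) (le_of_abs_le hx)
    linarith

theorem abs_le_chord {r x y : ℝ} (h : x ^ 2 + y ^ 2 ≤ r ^ 2) : |y| ≤ chord r x :=
  Real.abs_le_sqrt (by linarith)

theorem chord_lt_abs {r x y : ℝ} (hx : |x| ≤ r) (h : ¬ x ^ 2 + y ^ 2 ≤ r ^ 2) : chord r x < |y| := by
  rw [← Real.sqrt_sq_eq_abs, chord]
  have := sq_le_sq' (neg_le_of_abs_le hx) (le_of_abs_le hx)
  exact Real.sqrt_lt_sqrt (by linarith) (by linarith)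

/-- The vertical segment over `s` between the heights `a` and `b`. -/
def vSeg (s a b : ℝ) : Set ℂ := (fun y => (⟨s, y⟩ : ℂ)) '' Ioo a b

/-- The horizontal segment at the height `s` between `a` and `b`. -/
def hSeg (s a b : ℝ) : Set ℂ := (fun x => (⟨x, s⟩ : ℂ)) '' Ioo a b

theorem mem_vSeg {s a b : ℝ} {u : ℂ} : u ∈ vSeg s a b ↔ u.re = s ∧ a < u.im ∧ u.im < b := by
  constructor
  · rintro ⟨y, hy, rfl⟩
    exact ⟨rfl, hy⟩
  · rintro ⟨rfl, h⟩
    exact ⟨u.im, h, rfl⟩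

theorem mem_hSeg {s a b : ℝ} {u : ℂ} : u ∈ hSeg s a b ↔ u.im = s ∧ a < u.re ∧ u.re < b := by
  constructor
  · rintro ⟨y, hy, rfl⟩
    exact ⟨rfl, hy⟩
  · rintro ⟨rfl, h⟩
    exact ⟨u.re, h, rfl⟩

theorem mem_closure_vSeg {s a b y : ℝ} (hab : a < b) (hy : y ∈ Icc a b) :
    (⟨s, y⟩ : ℂ) ∈ closure (vSeg s a b) := by
  have hc : Continuous fun y : ℝ => (⟨s, y⟩ : ℂ) :=
    Complex.equivRealProdCLM.symm.continuous.comp (Continuous.prodMk continuous_const continuous_id)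
  refine image_closure_subset_closure_image hc ⟨y, ?_, rfl⟩
  rwa [closure_Ioo hab.ne]

theorem mem_closure_hSeg {s a b x : ℝ} (hab : a < b) (hx : x ∈ Icc a b) :
    (⟨x, s⟩ : ℂ) ∈ closure (hSeg s a b) := by
  have hc : Continuous fun x : ℝ => (⟨x, s⟩ : ℂ) :=
    Complex.equivRealProdCLM.symm.continuous.comp (Continuous.prodMk continuous_id continuous_const)
  refine image_closure_subset_closure_image hc ⟨x, ?_, rfl⟩
  rwa [closure_Ioo hab.ne]

/-- The first coordinate of the center of a disk. -/
def diskX (k : ℕ) (m : List Side) (σ : Side) : ℝ :=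
  xCoord m + σ.sign * (2 * (level k).t + (level k).r)

/-- Horizontal segments between the two disks of a word. -/
def midSeg (k : ℕ) (w : Word) (s : ℝ) : Set ℂ :=
  hSeg s (xCoord w.m - (2 * (level k).t + (level k).r) + chord (level k).r (s - yCoord w.n))
    (xCoord w.m + (2 * (level k).t + (level k).r) - chord (level k).r (s - yCoord w.n))

/-- The heights of the segments between the two disks of a word. -/
def midRange (k : ℕ) (w : Word) : Set ℝ :=
  Icc (yCoord w.n - (level k).δ / 4) (yCoord w.n + (level k).δ / 4)

/-- The first coordinates of the vertical segments which start in a disk. -/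
def sideRange (k : ℕ) (m : List Side) (σ : Side) : Set ℝ :=
  Icc (diskX k m σ - (level k).r / 2) (diskX k m σ + (level k).r / 2)

/-- Vertical segments between a disk of `w` and the disk above it. -/
def gapSeg (k : ℕ) (w : Word) (σ : Side) (s : ℝ) : Set ℂ :=
  vSeg s (yCoord w.n + chord (level k).r (s - diskX k w.m σ))
    (yCoord w.n + (2 * (level k).r + (level k).δ) - chord (level k).r (s - diskX k w.m σ))

/-- Vertical segments leaving a disk of `w` downwards (`e = -1`) or upwards (`e = 1`). -/
def freeSeg (k : ℕ) (w : Word) (e : ℝ) (σ : Side) (s : ℝ) : Set ℂ :=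
  vSeg s (yCoord w.n + e * ((3 * (level k).r + chord (level k).r (s - diskX k w.m σ)) / 2) -
      (3 * (level k).r - chord (level k).r (s - diskX k w.m σ)) / 2)
    (yCoord w.n + e * ((3 * (level k).r + chord (level k).r (s - diskX k w.m σ)) / 2) +
      (3 * (level k).r - chord (level k).r (s - diskX k w.m σ)) / 2)

/-- Horizontal segments below (`e = -1`) or above (`e = 1`) the disks of `w`. -/
def capSeg (k : ℕ) (w : Word) (s : ℝ) : Set ℂ :=
  hSeg s (xCoord w.m - 2 * (level k).r) (xCoord w.m + 2 * (level k).r)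

/-- The heights of the segments below or above the disks of `w`. -/
def capRange (k : ℕ) (w : Word) (e : ℝ) : Set ℝ :=
  Icc (yCoord w.n + e * (2 * (level k).r) - 3 * (level k).r / 4)
    (yCoord w.n + e * (2 * (level k).r) + 3 * (level k).r / 4)

theorem abs_sub_le_of_mem_midRange {k : ℕ} {w : Word} {s : ℝ} (hs : s ∈ midRange k w) :
    |s - yCoord w.n| ≤ (level k).δ / 4 := by
  rw [abs_le]
  exact ⟨by linarith [hs.1], by linarith [hs.2]⟩

theorem abs_sub_le_of_mem_sideRange {k : ℕ} {m : List Side} {σ : Side} {s : ℝ}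
    (hs : s ∈ sideRange k m σ) : |s - diskX k m σ| ≤ (level k).r / 2 := by
  rw [abs_le]
  exact ⟨by linarith [hs.1], by linarith [hs.2]⟩

theorem side_bounds {k : ℕ} {m : List Side} {σ : Side} {s : ℝ} (hs : s ∈ sideRange k m σ) :
    (level k).t < |s - xCoord m| ∧ |s - xCoord m| ≤ 2 * (level k).t + 3 * (level k).r / 2 := by
  have hg := level_good k
  have := hg.r_pos
  have := hg.t_pos
  obtain ⟨h1, h2⟩ := hs
  rw [diskX] at h1 h2
  rcases sign_cases σ with h | h <;> rw [h] at h1 h2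
  · rw [abs_of_nonpos (by linarith)]
    constructor <;> linarith
  · rw [abs_of_nonneg (by linarith)]
    constructor <;> linarith

theorem chord_bounds {k : ℕ} {x : ℝ} (hx : |x| ≤ (level k).r / 2) :
    3 * (level k).r / 4 ≤ chord (level k).r x := by
  have hr := (level_good k).r_pos
  refine Real.le_sqrt_of_sq_le ?_
  have := sq_le_sq' (neg_le_of_abs_le hx) (le_of_abs_le hx)
  nlinarith

/-- The deficit r - chord is of order δ²/(32 r), far below δ/100 because δ ≤ r/1000. Hence the
segments between the two disks have length at most 4t + δ/50, while their family has width δ/2. -/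
theorem chord_bounds_mid {k : ℕ} {x : ℝ} (hx : |x| ≤ (level k).δ / 4) :
    (level k).r - (level k).δ / 100 ≤ chord (level k).r x := by
  have hg := level_good k
  have hr := hg.r_pos
  have hδ := hg.δ_pos
  have hδr := hg.δ_le
  refine Real.le_sqrt_of_sq_le ?_
  have := sq_le_sq' (neg_le_of_abs_le hx) (le_of_abs_le hx)
  nlinarith

theorem chord_lt_of_notMem {k : ℕ} {w : Word} {σ : Side} {u : ℂ}
    (hx : |u.re - diskX k w.m σ| ≤ (level k).r) (hu : u ∉ (disk k w σ).toSet) :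
    chord (level k).r (u.re - diskX k w.m σ) < |u.im - yCoord w.n| :=
  chord_lt_abs hx (by rwa [mem_disk] at hu)

theorem chord_lt_of_notMem' {k : ℕ} {w : Word} {σ : Side} {u : ℂ}
    (hy : |u.im - yCoord w.n| ≤ (level k).r) (hu : u ∉ (disk k w σ).toSet) :
    chord (level k).r (u.im - yCoord w.n) < |u.re - diskX k w.m σ| :=
  chord_lt_abs hy (by rw [mem_disk] at hu; rwa [add_comm])

theorem notMem_disk_of_chord_lt {k : ℕ} {w : Word} {σ : Side} {u : ℂ}
    (h : chord (level k).r (u.re - diskX k w.m σ) < |u.im - yCoord w.n|) :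
    u ∉ (disk k w σ).toSet := by
  rw [mem_disk]
  exact fun h1 => not_le.2 h (abs_le_chord h1)

theorem notMem_disk_of_chord_lt' {k : ℕ} {w : Word} {σ : Side} {u : ℂ}
    (h : chord (level k).r (u.im - yCoord w.n) < |u.re - diskX k w.m σ|) :
    u ∉ (disk k w σ).toSet := by
  rw [mem_disk]
  exact fun h1 => not_le.2 h (abs_le_chord (by rwa [add_comm]))

theorem notMem_disk_of_side_ne {k : ℕ} {w : Word} {σ τ : Side} (hne : τ ≠ σ) {u : ℂ}
    (hu : u.re ∈ sideRange k w.m σ) : u ∉ (disk k w τ).toSet := by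
  intro h
  have h1 := (abs_le_of_mem_disk h).1
  obtain ⟨h2, h3⟩ := hu
  rw [diskX] at h2 h3
  rw [abs_le] at h1
  have := (level_good k).r_pos
  have := (level_good k).t_pos
  cases σ <;> cases τ <;> simp only [Side.sign, ne_eq, not_true_eq_false] at h1 h2 h3 hne <;>
    linarith

theorem notMem_disk_of_abs_le {k : ℕ} {w : Word} {u : ℂ} (hu : |u.re - xCoord w.m| ≤ (level k).t)
    (σ : Side) : u ∉ (disk k w σ).toSet := by
  intro h
  have h1 := (abs_le_of_mem_disk h).1
  rw [abs_le] at h1 hu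
  have := (level_good k).r_pos
  have := (level_good k).t_pos
  rcases sign_cases σ with h | h <;> rw [h] at h1 <;> linarith

/-! #### The segments between the two disks of a word -/

theorem midSeg_subset {k : ℕ} (hk : 1 ≤ k) {w : Word} (hw : w ∈ words k) {s : ℝ}
    (hs : s ∈ midRange k w) : midSeg k w s ⊆ finitePart Omega := by
  intro u hu
  obtain ⟨rfl, h1, h2⟩ := mem_hSeg.1 hu
  have h3 := abs_sub_le_of_mem_midRange hs
  have hg := level_good k
  have := hg.r_pos
  have := hg.t_pos
  have := hg.δ_pos
  have hc := chord_nonneg (level k).r (u.im - yCoord w.n)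
  refine mem_Omega_of_mid hk hw ?_ (by linarith) fun σ => notMem_disk_of_chord_lt' ?_
  · rw [abs_le]
    constructor <;> linarith
  · rw [diskX, lt_abs]
    rcases sign_cases σ with h | h <;> rw [h]
    · left; linarith
    · right; linarith

/-- With this converse, a horizontal side of a box decomposes into one segment and parts of the
disks. The bound 3r/2 keeps the point from passing beyond the far side of a disk. -/
theorem mem_midSeg {k : ℕ} {w : Word} {u : ℂ} (hu : u.im ∈ midRange k w)
    (hx : |u.re - xCoord w.m| ≤ 2 * (level k).t + 3 * (level k).r / 2)
    (hd : ∀ σ, u ∉ (disk k w σ).toSet) : u ∈ midSeg k w u.im := by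
  have h3 := abs_sub_le_of_mem_midRange hu
  have hg := level_good k
  have := hg.r_pos
  have := hg.δ_le
  have := hg.δ_pos
  have hc := chord_bounds_mid h3
  have h1 := chord_lt_of_notMem' (by linarith) (hd Side.Le)
  have h2 := chord_lt_of_notMem' (by linarith) (hd Side.Ri)
  rw [abs_le] at hx
  simp only [lt_abs, diskX, Side.sign] at h1 h2
  refine mem_hSeg.2 ⟨rfl, ?_, ?_⟩
  · rcases h1 with h1 | h1 <;> linarith
  · rcases h2 with h2 | h2 <;> linarith

theorem touch_midSeg {k : ℕ} {w : Word} {s : ℝ} (hs : s ∈ midRange k w) (σ : Side) :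
    ((disk k w σ).toSet ∩ closure (midSeg k w s)).Nonempty := by
  have h3 := abs_sub_le_of_mem_midRange hs
  have hg := level_good k
  have := hg.r_pos
  have := hg.t_pos
  have := hg.δ_le
  have := hg.δ_pos
  have hc := chord_le hg.r_pos.le (s - yCoord w.n)
  have hsq := chord_sq (r := (level k).r) (x := s - yCoord w.n) (by linarith)
  refine ⟨⟨diskX k w.m σ - σ.sign * chord (level k).r (s - yCoord w.n), s⟩, ?_, ?_⟩
  · rw [mem_disk]
    rw [diskX]
    rcases sign_cases σ with h | h <;> rw [h] <;> nlinarith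
  · refine mem_closure_hSeg (by linarith) ?_
    rw [diskX]
    rcases sign_cases σ with h | h <;> rw [h] <;> constructor <;> linarith

theorem touch_vSeg {k : ℕ} {w : Word} {σ : Side} {s a b y : ℝ} (hs : s ∈ sideRange k w.m σ)
    (hab : a < b) (hy : y ∈ Icc a b)
    (h : (y - yCoord w.n) ^ 2 = chord (level k).r (s - diskX k w.m σ) ^ 2) :
    ((disk k w σ).toSet ∩ closure (vSeg s a b)).Nonempty := by
  refine ⟨⟨s, y⟩, ?_, mem_closure_vSeg hab hy⟩
  have h3 := abs_sub_le_of_mem_sideRange hs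
  have := (level_good k).r_pos
  have hsq := chord_sq (r := (level k).r) (x := s - diskX k w.m σ) (by linarith)
  rw [mem_disk]
  change (s - diskX k w.m σ) ^ 2 + (y - yCoord w.n) ^ 2 ≤ _
  linarith

/-! #### The segments between the disks of two consecutive words -/

section gap

variable {k : ℕ} {v v' : Word}

theorem gapSeg_subset (hk : 1 ≤ k) (hv : v ∈ words k) (hv' : v' ∈ words k)
    (hm : v'.m = v.m) (hn : yCoord v'.n = yCoord v.n + (2 * (level k).r + (level k).δ))
    {σ : Side} {s : ℝ} (hs : s ∈ sideRange k v.m σ) : gapSeg k v σ s ⊆ finitePart Omega := by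
  intro u hu
  obtain ⟨rfl, h1, h2⟩ := mem_vSeg.1 hu
  have hb := side_bounds hs
  have hg := level_good k
  have := hg.r_pos
  have := hg.t_pos
  have hc := chord_nonneg (level k).r (u.re - diskX k v.m σ)
  refine mem_Omega_of_gap hk hv hv' hm hn (by linarith) hb.1 (by linarith) (by linarith) ?_ ?_
  · intro τ
    by_cases h : τ = σ
    · subst h
      refine notMem_disk_of_chord_lt ?_
      rw [lt_abs]
      left; linarith
    · exact notMem_disk_of_side_ne h hs
  · intro τ
    by_cases h : τ = σ
    · subst h
      refine notMem_disk_of_chord_lt ?_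
      rw [lt_abs, hm]
      right; linarith
    · refine notMem_disk_of_side_ne h ?_
      rwa [hm]

/-- The slack δ/4 is needed because the corners of a box may lie slightly beyond the heights of the
centers. The half chord is at least 3r/4, so such points are still in the disks and never behind
them. -/
theorem mem_gapSeg (hm : v'.m = v.m)
    (hn : yCoord v'.n = yCoord v.n + (2 * (level k).r + (level k).δ))
    {σ : Side} {u : ℂ} (hu : u.re ∈ sideRange k v.m σ)
    (h1 : yCoord v.n - (level k).δ / 4 ≤ u.im) (h2 : u.im ≤ yCoord v'.n + (level k).δ / 4)
    (hd : u ∉ (disk k v σ).toSet) (hd' : u ∉ (disk k v' σ).toSet) : u ∈ gapSeg k v σ u.re := by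
  have h3 := abs_sub_le_of_mem_sideRange hu
  have hg := level_good k
  have := hg.r_pos
  have := hg.δ_le
  have hc := chord_bounds h3
  have h4 := chord_lt_of_notMem (by linarith) hd
  have h5 := chord_lt_of_notMem (by rw [hm]; linarith) hd'
  rw [hm] at h5
  rw [lt_abs] at h4 h5
  refine mem_vSeg.2 ⟨rfl, ?_, ?_⟩
  · rcases h4 with h4 | h4 <;> linarith
  · rcases h5 with h5 | h5 <;> linarith

theorem touch_gapSeg (hm : v'.m = v.m)
    (hn : yCoord v'.n = yCoord v.n + (2 * (level k).r + (level k).δ))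
    {σ : Side} {s : ℝ} (hs : s ∈ sideRange k v.m σ) :
    ((disk k v σ).toSet ∩ closure (gapSeg k v σ s)).Nonempty ∧
      ((disk k v' σ).toSet ∩ closure (gapSeg k v σ s)).Nonempty := by
  have hg := level_good k
  have := hg.δ_pos
  have hc := chord_le hg.r_pos.le (s - diskX k v.m σ)
  constructor
  · refine touch_vSeg hs (by linarith) (left_mem_Icc.2 (by linarith)) ?_
    ring
  · refine touch_vSeg (by rwa [hm]) (by linarith) (right_mem_Icc.2 (by linarith)) ?_
    rw [hm, hn]
    ring

end gap

/-! #### The segments next to a bottom or a top -/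

section extremal

variable {k : ℕ} {m : List Side} {a : ℕ} {p : List ℕ} {e : ℝ}

theorem IsExtremal.eq_or_eq {k n : ℕ} (he : IsExtremal k n e) : e = -1 ∨ e = 1 :=
  he.imp And.left And.left

/-- Writing the endpoints as midpoint plus or minus half the length lets both orientations be
handled by one inequality for e · (Im u - y). -/
theorem mem_freeSeg_iff (he : e = -1 ∨ e = 1) {w : Word} {σ : Side} {s : ℝ} {u : ℂ} :
    u ∈ freeSeg k w e σ s ↔ u.re = s ∧
      chord (level k).r (s - diskX k w.m σ) < e * (u.im - yCoord w.n) ∧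
      e * (u.im - yCoord w.n) < 3 * (level k).r := by
  rw [freeSeg, mem_vSeg]
  rcases he with rfl | rfl <;>
  · constructor <;> rintro ⟨h1, h2, h3⟩ <;> refine ⟨h1, ?_, ?_⟩ <;> linarith

theorem freeSeg_subset (hw : ⟨m, a :: p⟩ ∈ words (k + 1)) (he : IsExtremal (k + 1) a e)
    {σ : Side} {s : ℝ} (hs : s ∈ sideRange (k + 1) m σ) :
    freeSeg (k + 1) ⟨m, a :: p⟩ e σ s ⊆ finitePart Omega := by
  intro u hu
  obtain ⟨rfl, h1, h2⟩ := (mem_freeSeg_iff he.eq_or_eq).1 hu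
  have hb := side_bounds hs
  have hg := level_good (k + 1)
  have := hg.r_pos
  have := hg.t_pos
  have hc := chord_nonneg (level (k + 1)).r (u.re - diskX (k + 1) m σ)
  simp only at h1 h2
  refine mem_Omega_of_extremal hw he (by linarith) (by linarith) (by linarith) (Or.inl hb.1) ?_
  intro τ
  by_cases h : τ = σ
  · subst h
    refine notMem_disk_of_chord_lt ?_
    rw [lt_abs]
    simp only
    rcases he.eq_or_eq with rfl | rfl
    · right; linarith
    · left; linarith
  · exact notMem_disk_of_side_ne h hs

theorem mem_freeSeg (he : e = -1 ∨ e = 1) {w : Word} {σ : Side} {u : ℂ}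
    (hu : u.re ∈ sideRange k w.m σ) (h1 : -((level k).δ / 4) ≤ e * (u.im - yCoord w.n))
    (h2 : e * (u.im - yCoord w.n) < 3 * (level k).r)
    (hd : u ∉ (disk k w σ).toSet) : u ∈ freeSeg k w e σ u.re := by
  have h3 := abs_sub_le_of_mem_sideRange hu
  have hg := level_good k
  have := hg.r_pos
  have := hg.δ_le
  have hc := chord_bounds h3
  have h4 := chord_lt_of_notMem (by linarith) hd
  rw [lt_abs] at h4
  refine (mem_freeSeg_iff he).2 ⟨rfl, ?_, h2⟩
  rcases he with rfl | rfl <;> rcases h4 with h4 | h4 <;> linarith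

theorem touch_freeSeg (he : e = -1 ∨ e = 1) {w : Word} {σ : Side} {s : ℝ}
    (hs : s ∈ sideRange k w.m σ) :
    ((disk k w σ).toSet ∩ closure (freeSeg k w e σ s)).Nonempty := by
  have hg := level_good k
  have := hg.r_pos
  have hc := chord_le hg.r_pos.le (s - diskX k w.m σ)
  refine touch_vSeg (y := yCoord w.n + e * chord (level k).r (s - diskX k w.m σ)) hs
    (by linarith) ?_ ?_
  · rcases he with rfl | rfl <;> constructor <;> linarith
  · rcases he with rfl | rfl <;> ring

theorem capRange_bounds (he : e = -1 ∨ e = 1) {w : Word} {s : ℝ} (hs : s ∈ capRange k w e) :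
    5 * (level k).r / 4 ≤ e * (s - yCoord w.n) ∧ e * (s - yCoord w.n) ≤ 11 * (level k).r / 4 := by
  obtain ⟨h1, h2⟩ := hs
  rcases he with rfl | rfl <;> constructor <;> linarith

theorem capSeg_subset (hw : ⟨m, a :: p⟩ ∈ words (k + 1)) (he : IsExtremal (k + 1) a e)
    {s : ℝ} (hs : s ∈ capRange (k + 1) ⟨m, a :: p⟩ e) :
    capSeg (k + 1) ⟨m, a :: p⟩ s ⊆ finitePart Omega := by
  intro u hu
  obtain ⟨rfl, h1, h2⟩ := mem_hSeg.1 hu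
  obtain ⟨h3, h4⟩ := capRange_bounds he.eq_or_eq hs
  have hg := level_good (k + 1)
  have := hg.r_pos
  have := hg.t_pos
  simp only at h1 h2 h3 h4
  refine mem_Omega_of_extremal hw he ?_ (by linarith) (by linarith) (Or.inr (by linarith)) ?_
  · rw [abs_le]
    constructor <;> linarith
  · intro τ hτ
    have h5 := (abs_le_of_mem_disk hτ).2
    simp only at h5
    rw [abs_le] at h5
    rcases he.eq_or_eq with rfl | rfl <;> linarith

/-- The segments on the two sides of the disks cross the segments below or above them. -/
theorem crossing_mem (he : e = -1 ∨ e = 1) {w : Word} {σ : Side} {s s' : ℝ}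
    (hs : s ∈ sideRange k w.m σ) (hs' : s' ∈ capRange k w e) :
    (⟨s, s'⟩ : ℂ) ∈ freeSeg k w e σ s ∧ (⟨s, s'⟩ : ℂ) ∈ capSeg k w s' := by
  obtain ⟨h3, h4⟩ := capRange_bounds he hs'
  have hg := level_good k
  have := hg.r_pos
  have := hg.t_le
  have := hg.δ_le
  have hb := (side_bounds hs).2
  have hc := chord_le hg.r_pos.le (s - diskX k w.m σ)
  rw [abs_le] at hb
  refine ⟨(mem_freeSeg_iff he).2 ⟨rfl, ?_, ?_⟩, mem_hSeg.2 ⟨rfl, ?_, ?_⟩⟩ <;> simp only <;> linarith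

end extremal

/-! ### The families are short -/

section short

variable {G' : Set (OnePoint ℂ)} {f : OnePoint ℂ → OnePoint ℂ}
  {F : Collapse Omega ≃ₜ Collapse G'} {k : ℕ}

theorem shortFamily_midSeg (h : ConformalExtension Omega G' f F) (hk : 1 ≤ k) {w : Word}
    (hw : w ∈ words k) : ShortFamily (finiteMap f) (midRange k w) (midSeg k w) := by
  have hg := level_good k
  have := hg.δ_pos
  have := hg.t_le
  have hc := continuous_chord (level k).r
  refine shortFamily_horizontal h.isOpen_finitePart h.differentiableOn h.injOn (by linarith)
    (by fun_prop) (by fun_prop) ?_ ?_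
  · intro s hs
    have := chord_bounds_mid (abs_sub_le_of_mem_midRange hs)
    linarith
  · intro s hs x hx
    exact midSeg_subset hk hw hs (mem_image_of_mem _ hx)

theorem shortFamily_gapSeg (h : ConformalExtension Omega G' f F) (hk : 1 ≤ k) {v v' : Word}
    (hv : v ∈ words k) (hv' : v' ∈ words k) (hm : v'.m = v.m)
    (hn : yCoord v'.n = yCoord v.n + (2 * (level k).r + (level k).δ)) (σ : Side) :
    ShortFamily (finiteMap f) (sideRange k v.m σ) (gapSeg k v σ) := by
  have hg := level_good k
  have := hg.δ_le
  have := hg.r_pos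
  have hc := continuous_chord (level k).r
  refine shortFamily_vertical h.isOpen_finitePart h.differentiableOn h.injOn (by linarith)
    (by fun_prop) (by fun_prop) ?_ ?_
  · intro s hs
    have := chord_bounds (abs_sub_le_of_mem_sideRange hs)
    linarith
  · intro s hs x hx
    exact gapSeg_subset hk hv hv' hm hn hs (mem_image_of_mem _ hx)

variable {m : List Side} {a : ℕ} {p : List ℕ} {e : ℝ}

theorem shortFamily_freeSeg (h : ConformalExtension Omega G' f F)
    (hw : ⟨m, a :: p⟩ ∈ words (k + 1)) (he : IsExtremal (k + 1) a e) (σ : Side) :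
    ShortFamily (finiteMap f) (sideRange (k + 1) m σ) (freeSeg (k + 1) ⟨m, a :: p⟩ e σ) := by
  have hg := level_good (k + 1)
  have := hg.r_pos
  have hc := continuous_chord (level (k + 1)).r
  refine shortFamily_vertical h.isOpen_finitePart h.differentiableOn h.injOn (by linarith)
    (by fun_prop) (by fun_prop) ?_ ?_
  · intro s hs
    have := chord_nonneg (level (k + 1)).r (s - diskX (k + 1) m σ)
    simp only
    linarith
  · intro s hs x hx
    exact freeSeg_subset hw he hs (mem_image_of_mem _ hx)

theorem shortFamily_capSeg (h : ConformalExtension Omega G' f F)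
    (hw : ⟨m, a :: p⟩ ∈ words (k + 1)) (he : IsExtremal (k + 1) a e) :
    ShortFamily (finiteMap f) (capRange (k + 1) ⟨m, a :: p⟩ e) (capSeg (k + 1) ⟨m, a :: p⟩) := by
  have hg := level_good (k + 1)
  have := hg.r_pos
  refine shortFamily_horizontal h.isOpen_finitePart h.differentiableOn h.injOn (by linarith)
    (by fun_prop) (by fun_prop) ?_ ?_
  -- The length is 4r and the width of the family is 3r/2, just within the ratio 3.
  · intro s hs
    linarith
  · intro s hs x hx
    exact capSeg_subset hw he hs (mem_image_of_mem _ hx)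

end short

end RigidCircle
end

/-! ### Control of the image of a point by a neighboring disk. -/

noncomputable section
namespace RigidCircle
open Set Filter

/-- The crude bound e < 3 is enough: at most three factors `dilFactor` are ever multiplied, and 2 ·
3^60 < 10^30. -/
theorem dilFactor_le : dilFactor ≤ 3 ^ 20 := by
  have h : dilFactor = Real.exp 1 ^ 20 := by
    rw [dilFactor, ← Real.exp_nat_mul]
    norm_num
  rw [h]
  exact pow_le_pow_left₀ (Real.exp_pos _).le (Real.exp_one_lt_d9.le.trans (by norm_num)) _

/-! ### The images of the neighbors -/

section images

variable {G' : Set (OnePoint ℂ)} {f : OnePoint ℂ → OnePoint ℂ}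
  {F : Collapse Omega ≃ₜ Collapse G'} {k : ℕ}

/-- The image of `D` is a nondegenerate disk, which controls the image of the point `z`. -/
def Controls (F : Collapse Omega ≃ₜ Collapse G') (D : Disk) (z : ℂ) : Prop :=
  ∃ D' : Disk, 0 < D'.radius ∧ hatImage F (onSphere D.toSet) = onSphere D'.toSet ∧
    hatImage F (onSphere {z}) ⊆ onSphere (D'.dilate (10 ^ 30)).toSet

theorem disjoint_disk (w : Word) {σ τ : Side} (hne : σ ≠ τ) :
    Disjoint (disk k w σ).toSet (disk k w τ).toSet := by
  rw [disjoint_left]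
  intro u h1 h2
  have h3 := (abs_le_of_mem_disk h1).1
  have h4 := (abs_le_of_mem_disk h2).1
  rw [abs_le] at h3 h4
  have := (level_good k).r_pos
  have := (level_good k).t_pos
  cases σ <;> cases τ <;> simp only [Side.sign, ne_eq, not_true_eq_false] at h3 h4 hne <;>
    linarith

theorem exists_side_ne (σ : Side) : ∃ τ, σ ≠ τ := by
  cases σ
  · exact ⟨Side.Ri, by simp⟩
  · exact ⟨Side.Le, by simp⟩

/-- The two disks of a word are disjoint components joined by the short family `midSeg`, so neither
image can be a point. -/
theorem exists_disk_image (h : ConformalExtension Omega G' f F) (hk : 1 ≤ k) {w : Word}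
    (hw : w ∈ words k) (σ : Side) : ∃ (c : ℂ) (ρ : ℝ), 0 < ρ ∧
      hatImage F (onSphere (disk k w σ).toSet) = onSphere (Metric.closedBall c ρ) := by
  obtain ⟨c, ρ, hρ, himg⟩ := h.exists_hatImage_eq (onSphere_disk_mem_complComponents hk hw σ)
  obtain ⟨τ, hτ⟩ := exists_side_ne σ
  exact ⟨c, ρ, h.radius_pos (onSphere_disk_mem_complComponents hk hw σ)
    (onSphere_disk_mem_complComponents hk hw τ) (disjoint_disk w hτ) hρ himg
    (shortFamily_midSeg h hk hw) (fun s hs => midSeg_subset hk hw hs)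
    (fun s hs => touch_midSeg hs σ) (fun s hs => touch_midSeg hs τ), himg⟩

/-- A point enclosed by a box, whose boundary consists of curves with images near the image of the
disk `D i₀` and of parts of the disks `D i`, is controlled by `D i₀`. -/
theorem controls_of_box (h : ConformalExtension Omega G' f F) {ι : Type*} [Finite ι] {D : ι → Disk}
    (hD : ∀ i, onSphere (D i).toSet ∈ complComponents Omega) {c : ι → ℂ} {ρ : ι → ℝ}
    (hρ : ∀ i, 0 < ρ i)
    (himg : ∀ i, hatImage F (onSphere (D i).toSet) = onSphere (Metric.closedBall (c i) (ρ i)))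
    (i₀ : ι) (hdist : ∀ i, ‖c i - c i₀‖ + ρ i ≤ 10 ^ 30 * ρ i₀) {xL xR y₀ y₁ e : ℝ}
    (he : e = -1 ∨ e = 1)
    (hbd : ∀ u : ℂ, xL ≤ u.re → u.re ≤ xR → e * y₀ ≤ e * u.im → e * u.im ≤ e * y₁ →
      (∀ i, u ∉ (D i).toSet) → (u.re = xL ∨ u.re = xR ∨ u.im = y₀ ∨ u.im = y₁) →
      u ∈ finitePart Omega ∧ ‖finiteMap f u - c i₀‖ ≤ 10 ^ 30 * ρ i₀) {z : ℂ}
    (hxL : xL < z.re) (hxR : z.re < xR) (hy₀ : e * y₀ < e * z.im) (hy₁ : e * z.im < e * y₁)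
    (hz : ∀ i, z ∉ (D i).toSet) : Controls F (D i₀) z := by
  refine ⟨⟨c i₀, ρ i₀⟩, hρ i₀, himg i₀, ?_⟩
  have hhat : hatImage F (onSphere {z}) = collapseMap G' ⁻¹' {F (collapseMap Omega z)} := by
    rw [hatImage, onSphere, image_singleton, image_singleton, image_singleton]
  rw [hhat]
  have hpos : 0 ≤ 10 ^ 30 * ρ i₀ := by
    have := hρ i₀
    positivity
  have hT : IsCompact (⋃ i, (D i).toSet) := isCompact_iUnion fun i => isCompact_closedBall _ _
  have hTsat : ∀ q ∈ complComponents Omega, (q ∩ onSphere (⋃ i, (D i).toSet)).Nonempty →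
      q ⊆ onSphere (⋃ i, (D i).toSet) := by
    rintro q hq ⟨_, hx, u, hu, rfl⟩
    obtain ⟨i, hi⟩ := mem_iUnion.1 hu
    have hqD : q = onSphere (D i).toSet := by
      rw [eq_of_mem_complComponents hq hx,
        eq_of_mem_complComponents (hD i) (mem_image_of_mem _ hi)]
    rw [hqD]
    exact image_mono (subset_iUnion (fun i => (D i).toSet) i)
  have hTimg : ∀ u ∈ ⋃ i, (D i).toSet, collapseMap G' ⁻¹' {F (collapseMap Omega u)} ⊆
      onSphere (Metric.closedBall (c i₀) (10 ^ 30 * ρ i₀)) := by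
    intro u hu
    obtain ⟨i, hi⟩ := mem_iUnion.1 hu
    rw [← hatImage_component (hD i) (mem_image_of_mem _ hi), himg i]
    refine image_mono (Metric.closedBall_subset_closedBall' ?_)
    rw [dist_eq_norm]
    linarith [hdist i]
  have hzT : z ∉ ⋃ i, (D i).toSet := by
    simpa using hz
  have hmem : ∀ {s t : Set ℝ} {u : ℂ}, u ∈ s ×ℂ t ↔ u.re ∈ s ∧ u.im ∈ t :=
    fun {_ _ _} => Complex.mem_reProdIm
  change _ ⊆ onSphere (Metric.closedBall (c i₀) (10 ^ 30 * ρ i₀))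
  -- For e = -1 the inner side `y₀` is the upper side of the box and `y₁` the lower one.
  rcases he with rfl | rfl
  · refine h.preimage_subset_of_box (xL := xL) (xR := xR) (yB := y₁) (yT := y₀) hT hTsat hpos ?_
      hTimg (hmem.2 ⟨⟨hxL, hxR⟩, by linarith, by linarith⟩) hzT
    intro u hu hu' huT
    rw [hmem] at hu hu'
    refine hbd u hu.1.1 hu.1.2 (by linarith [hu.2.2]) (by linarith [hu.2.1])
      (by simpa using huT) ?_
    by_contra! hcon
    exact hu' ⟨⟨hu.1.1.lt_of_ne' hcon.1, hu.1.2.lt_of_ne hcon.2.1⟩,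
      hu.2.1.lt_of_ne' hcon.2.2.2, hu.2.2.lt_of_ne hcon.2.2.1⟩
  · refine h.preimage_subset_of_box (xL := xL) (xR := xR) (yB := y₀) (yT := y₁) hT hTsat hpos ?_
      hTimg (hmem.2 ⟨⟨hxL, hxR⟩, by linarith, by linarith⟩) hzT
    intro u hu hu' huT
    rw [hmem] at hu hu'
    refine hbd u hu.1.1 hu.1.2 (by linarith [hu.2.1]) (by linarith [hu.2.2])
      (by simpa using huT) ?_
    by_contra! hcon
    exact hu' ⟨⟨hu.1.1.lt_of_ne' hcon.1, hu.1.2.lt_of_ne hcon.2.1⟩,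
      hu.2.1.lt_of_ne' hcon.2.2.1, hu.2.2.lt_of_ne hcon.2.2.2⟩

/-- A point next to a bottom or a top is controlled by one of its two disks. -/
theorem controls_of_extremal (h : ConformalExtension Omega G' f F) {m : List Side} {a : ℕ}
    {p : List ℕ} {e : ℝ} (hw : ⟨m, a :: p⟩ ∈ words (k + 1)) (he : IsExtremal (k + 1) a e) {z : ℂ}
    (hzx : |z.re - xCoord m| ≤ (level (k + 1)).t)
    (hz1 : (level (k + 1)).δ / 2 ≤ e * (z.im - yCoord (a :: p)))
    (hz2 : e * (z.im - yCoord (a :: p)) ≤ (level (k + 1)).r) :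
    ∃ σ, Controls F (disk (k + 1) ⟨m, a :: p⟩ σ) z := by
  have hk : 1 ≤ k + 1 := by omega
  set w : Word := ⟨m, a :: p⟩ with hwdef
  have hD := onSphere_disk_mem_complComponents hk hw
  choose c ρ hρ himg using exists_disk_image h hk hw
  have : Nonempty Side := ⟨Side.Le⟩
  -- Taking the larger image disk as reference makes every bound a multiple of the single radius ε.
  obtain ⟨σ₀, hσ₀⟩ := Finite.exists_max ρ
  refine ⟨σ₀, ?_⟩
  set R := dilFactor with hR
  have hR1 : 1 < R := one_lt_dilFactor
  set ε := ρ σ₀ with hε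
  have hε0 : 0 < ε := hρ σ₀
  -- a segment between the disks
  have hlink : ∀ σ, ‖c σ₀ - c σ‖ ≤ R * (2 * ε) + 2 * ρ σ := fun σ =>
    (h.exists_short_link (hD σ₀) (hD σ) (hρ σ₀) (hρ σ) (himg σ₀) (himg σ)
      (shortFamily_midSeg h hk hw) (fun s hs => midSeg_subset hk hw hs)
      (fun s hs => touch_midSeg hs σ₀) (fun s hs => touch_midSeg hs σ)).1
  obtain ⟨s₀, hs₀, hmid⟩ := h.exists_short (hD σ₀) (hρ σ₀) (himg σ₀)
    (shortFamily_midSeg h hk hw) (fun s hs => midSeg_subset hk hw hs)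
    (fun s hs => touch_midSeg hs σ₀)
  -- a vertical segment from the larger disk, one crossing it, and two vertical segments
  obtain ⟨s₁, hs₁, hfree⟩ := h.exists_short (hD σ₀) (hρ σ₀) (himg σ₀)
    (shortFamily_freeSeg h hw he σ₀) (fun s hs => freeSeg_subset hw he hs)
    (fun s hs => touch_freeSeg he.eq_or_eq hs)
  obtain ⟨s₂, hs₂, hcap⟩ := shortFamily_capSeg h hw he (c σ₀) (R * (2 * ε)) (by positivity)
    fun s hs => ⟨⟨s₁, s⟩, (crossing_mem he.eq_or_eq hs₁ hs).2,
      hfree _ (crossing_mem he.eq_or_eq hs₁ hs).1⟩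
  have hside : ∀ σ, ∃ s ∈ sideRange (k + 1) m σ, ∀ q ∈ freeSeg (k + 1) w e σ s,
      ‖finiteMap f q - c σ₀‖ ≤ R * (R * (R * (2 * ε))) := fun σ =>
    shortFamily_freeSeg h hw he σ (c σ₀) (R * (R * (2 * ε))) (by positivity)
      fun s hs => ⟨⟨s, s₂⟩, (crossing_mem he.eq_or_eq hs hs₂).1,
        hcap _ (crossing_mem he.eq_or_eq hs hs₂).2⟩
  choose s hs hs' using hside
  have hR3 : R ≤ 3 ^ 20 := dilFactor_le
  have hB1 : R * (2 * ε) ≤ 3 ^ 20 * (2 * ε) := by gcongr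
  have hB2 : R * (R * (2 * ε)) ≤ 3 ^ 20 * (3 ^ 20 * (2 * ε)) := by gcongr
  -- Each change of family costs one factor R: from the larger disk to a free segment, to a cap
  -- crossing it, and to free segments on both sides crossing the cap. This longest chain accounts
  -- for the exponent 30.
  have hB3 : R * (R * (R * (2 * ε))) ≤ 3 ^ 20 * (3 ^ 20 * (3 ^ 20 * (2 * ε))) := by gcongr
  have hg := level_good (k + 1)
  have hr := hg.r_pos
  have ht := hg.t_pos
  have hδ := hg.δ_pos
  have hδr := hg.δ_le
  have htδ := hg.t_le
  have hL := hs Side.Le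
  have hRi := hs Side.Ri
  have hL1 := hL.1
  have hL2 := hL.2
  have hRi1 := hRi.1
  have hRi2 := hRi.2
  rw [diskX, show Side.Le.sign = -1 from rfl] at hL1 hL2
  rw [diskX, show Side.Ri.sign = 1 from rfl] at hRi1 hRi2
  have hzx' := abs_le.1 hzx
  have hm0 := abs_sub_le_of_mem_midRange hs₀
  have hm0' : -((level (k + 1)).δ / 4) ≤ e * (s₀ - yCoord (a :: p)) ∧
      e * (s₀ - yCoord (a :: p)) ≤ (level (k + 1)).δ / 4 := by
    rw [abs_le] at hm0
    rcases he.eq_or_eq with h | h <;> rw [h] <;> constructor <;> linarith [hm0.1, hm0.2]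
  have hc0 := capRange_bounds he.eq_or_eq hs₂
  simp only at hc0
  -- The sides of the box are the free segments on both sides continued into the disks, the segment
  -- between the disks at the height `s₀`, and the cap at the height `s₂`.
  refine controls_of_box h hD hρ himg σ₀ (fun σ => ?_) (xL := s Side.Le) (xR := s Side.Ri)
    (y₀ := s₀) (y₁ := s₂) he.eq_or_eq ?_ (by linarith) (by linarith) (by linarith) (by linarith)
    (notMem_disk_of_abs_le hzx)
  · have h1 := hlink σ
    have h2 := hσ₀ σ
    rw [norm_sub_rev]
    linarith
  · intro u hxL hxR hy₀ hy₁ hd hor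
    have hvert : ∀ σ, u.re = s σ → u ∈ freeSeg (k + 1) w e σ (s σ) := by
      intro σ hσ
      rw [← hσ]
      refine mem_freeSeg he.eq_or_eq (hσ ▸ hs σ) ?_ ?_ (hd σ) <;> simp only [hwdef] <;> linarith
    rcases hor with hu | hu | hu | hu
    · exact ⟨freeSeg_subset hw he (hs _) (hvert _ hu), (hs' _ _ (hvert _ hu)).trans (by linarith)⟩
    · exact ⟨freeSeg_subset hw he (hs _) (hvert _ hu), (hs' _ _ (hvert _ hu)).trans (by linarith)⟩
    · have h1 : u ∈ midSeg (k + 1) w s₀ := by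
        rw [← hu]
        refine mem_midSeg (hu ▸ hs₀) ?_ hd
        rw [abs_le]
        constructor <;> simp only [hwdef] <;> linarith
      exact ⟨midSeg_subset hk hw hs₀ h1, (hmid _ h1).trans (by linarith)⟩
    · have h1 : u ∈ capSeg (k + 1) w s₂ := by
        refine mem_hSeg.2 ⟨hu, ?_, ?_⟩ <;> simp only [hwdef] <;> linarith
      exact ⟨capSeg_subset hw he hs₂ h1, (hcap _ h1).trans (by linarith)⟩

/-- A point between two consecutive words is controlled by one of their four disks. -/
theorem controls_of_gap (h : ConformalExtension Omega G' f F) (hk : 1 ≤ k) {v : Bool → Word}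
    (hv : ∀ b, v b ∈ words k) (hm : (v true).m = (v false).m)
    (hn : yCoord (v true).n = yCoord (v false).n + (2 * (level k).r + (level k).δ)) {z : ℂ}
    (hzx : |z.re - xCoord (v false).m| ≤ (level k).t)
    (hz1 : yCoord (v false).n + (level k).δ / 2 ≤ z.im)
    (hz2 : z.im ≤ yCoord (v true).n - (level k).δ / 2) :
    ∃ b σ, Controls F (disk k (v b) σ) z := by
  have hmb : ∀ b, (v b).m = (v false).m := by
    rintro (- | -)
    · rfl
    · exact hm
  have hD : ∀ i : Bool × Side, onSphere (disk k (v i.1) i.2).toSet ∈ complComponents Omega :=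
    fun i => onSphere_disk_mem_complComponents hk (hv i.1) i.2
  choose c ρ hρ himg using fun i : Bool × Side => exists_disk_image h hk (hv i.1) i.2
  have : Nonempty Side := ⟨Side.Le⟩
  -- Among the four disks the one with the largest image is the reference.
  obtain ⟨i₀, hi₀⟩ := Finite.exists_max ρ
  refine ⟨i₀.1, i₀.2, ?_⟩
  set R := dilFactor with hR
  have hR1 : 1 < R := one_lt_dilFactor
  set ε := ρ i₀ with hε
  have hε0 : 0 < ε := hρ i₀
  have hRle : ∀ i, R * (2 * ρ i) ≤ R * (2 * ε) := fun i => by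
    have := hi₀ i
    gcongr
  have hmid : ∀ b, ‖c (b, Side.Le) - c (b, Side.Ri)‖ ≤ R * (2 * ε) + 2 * ε ∧
      ∃ s ∈ midRange k (v b), ∀ q ∈ midSeg k (v b) s,
        ‖finiteMap f q - c (b, Side.Le)‖ ≤ R * (2 * ε) := by
    intro b
    obtain ⟨h1, s, hs, h2⟩ := h.exists_short_link (hD (b, Side.Le)) (hD (b, Side.Ri))
      (hρ _) (hρ _) (himg _) (himg _) (shortFamily_midSeg h hk (hv b))
      (fun s hs => midSeg_subset hk (hv b) hs) (fun s hs => touch_midSeg hs _)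
      (fun s hs => touch_midSeg hs _)
    exact ⟨by linarith [hRle (b, Side.Le), hi₀ (b, Side.Ri)], s, hs, fun q hq =>
      (h2 q hq).trans (hRle _)⟩
  have hver : ∀ σ, ‖c (false, σ) - c (true, σ)‖ ≤ R * (2 * ε) + 2 * ε ∧
      ∃ s ∈ sideRange k (v false).m σ, ∀ q ∈ gapSeg k (v false) σ s,
        ‖finiteMap f q - c (false, σ)‖ ≤ R * (2 * ε) := by
    intro σ
    obtain ⟨h1, s, hs, h2⟩ := h.exists_short_link (hD (false, σ)) (hD (true, σ))
      (hρ _) (hρ _) (himg _) (himg _)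
      (shortFamily_gapSeg h hk (hv false) (hv true) hm hn σ)
      (fun s hs => gapSeg_subset hk (hv false) (hv true) hm hn hs)
      (fun s hs => (touch_gapSeg hm hn hs).1) (fun s hs => (touch_gapSeg hm hn hs).2)
    exact ⟨by linarith [hRle (false, σ), hi₀ (true, σ)], s, hs, fun q hq =>
      (h2 q hq).trans (hRle _)⟩
  -- all centers are close to each other
  have hΔ : 0 ≤ R * (2 * ε) + 2 * ε := by positivity
  have hmid' : ∀ b σ τ, ‖c (b, σ) - c (b, τ)‖ ≤ R * (2 * ε) + 2 * ε := by
    intro b σ τ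
    have h1 := (hmid b).1
    have h2 := h1
    rw [norm_sub_rev] at h2
    cases σ <;> cases τ <;> first | assumption | (rw [sub_self, norm_zero]; exact hΔ)
  have hver' : ∀ b b' σ, ‖c (b, σ) - c (b', σ)‖ ≤ R * (2 * ε) + 2 * ε := by
    intro b b' σ
    have h1 := (hver σ).1
    have h2 := h1
    rw [norm_sub_rev] at h2
    cases b <;> cases b' <;> first | assumption | (rw [sub_self, norm_zero]; exact hΔ)
  -- Any two of the four disks are linked in at most two steps: across one word, then up or down on
  -- one side.
  have hall : ∀ i, ‖c i - c i₀‖ ≤ 2 * (R * (2 * ε) + 2 * ε) := by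
    rintro ⟨b, σ⟩
    have h1 := norm_sub_le_norm_sub_add_norm_sub (c (b, σ)) (c (b, i₀.2)) (c i₀)
    linarith [hmid' b σ i₀.2, hver' b i₀.1 i₀.2]
  have hB : R * (2 * ε) ≤ 3 ^ 20 * (2 * ε) := by
    have := dilFactor_le
    gcongr
  have hfar : ∀ (q : ℂ) (i : Bool × Side), ‖finiteMap f q - c i‖ ≤ R * (2 * ε) →
      ‖finiteMap f q - c i₀‖ ≤ 10 ^ 30 * ε := by
    intro q i hq
    have h1 := norm_sub_le_norm_sub_add_norm_sub (finiteMap f q) (c i) (c i₀)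
    linarith [hall i]
  choose hmid1 s hs hs' using hmid
  choose hver1 x hx hx' using hver
  have hg := level_good k
  have hr := hg.r_pos
  have ht := hg.t_pos
  have hδ := hg.δ_pos
  have hδr := hg.δ_le
  have htδ := hg.t_le
  have hzx' := abs_le.1 hzx
  have hL1 := (hx Side.Le).1
  have hL2 := (hx Side.Le).2
  have hRi1 := (hx Side.Ri).1
  have hRi2 := (hx Side.Ri).2
  rw [diskX, show Side.Le.sign = -1 from rfl] at hL1 hL2
  rw [diskX, show Side.Ri.sign = 1 from rfl] at hRi1 hRi2
  have hy1 := (hs false).1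
  have hy2 := (hs false).2
  have hy3 := (hs true).1
  have hy4 := (hs true).2
  refine controls_of_box h hD hρ himg i₀ (fun i => ?_) (xL := x Side.Le) (xR := x Side.Ri)
    (y₀ := s false) (y₁ := s true) (Or.inr rfl) ?_ (by linarith) (by linarith) (by linarith)
    (by linarith) (fun i => notMem_disk_of_abs_le (by rwa [hmb]) _)
  · linarith [hall i, hi₀ i]
  · intro u hxL hxR hy₀ hy₁ hd hor
    have hvert : ∀ σ, u.re = x σ → u ∈ gapSeg k (v false) σ (x σ) := by
      intro σ hσ
      rw [← hσ]
      exact mem_gapSeg hm hn (hσ ▸ hx σ) (by linarith) (by linarith) (hd (false, σ)) (hd (true, σ))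
    have hhor : ∀ b, u.im = s b → u ∈ midSeg k (v b) (s b) := by
      intro b hb
      rw [← hb]
      refine mem_midSeg (hb ▸ hs b) ?_ fun σ => hd (b, σ)
      rw [hmb, abs_le]
      constructor <;> linarith
    rcases hor with hu | hu | hu | hu
    · exact ⟨gapSeg_subset hk (hv false) (hv true) hm hn (hx _) (hvert _ hu),
        hfar _ _ (hx' _ _ (hvert _ hu))⟩
    · exact ⟨gapSeg_subset hk (hv false) (hv true) hm hn (hx _) (hvert _ hu),
        hfar _ _ (hx' _ _ (hvert _ hu))⟩
    · exact ⟨midSeg_subset hk (hv _) (hs _) (hhor _ hu), hfar _ _ (hs' _ _ (hhor _ hu))⟩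
    · exact ⟨midSeg_subset hk (hv _) (hs _) (hhor _ hu), hfar _ _ (hs' _ _ (hhor _ hu))⟩

end images

/-! ### The list of neighbors -/

theorem disk_mem_neighborList (k : ℕ) (m : List Side) (a : ℕ) (p : List ℕ) (σ : Side) :
    disk k ⟨m, a :: p⟩ σ ∈ neighborList k ⟨m, a :: p⟩ := by
  simp only [neighborList]
  split_ifs <;> cases σ <;> simp

theorem disk_pred_mem_neighborList {k a : ℕ} (m : List Side) (p : List ℕ) (ha : ¬ IsBottom k a)
    (σ : Side) : disk k ⟨m, (a - 1) :: p⟩ σ ∈ neighborList k ⟨m, a :: p⟩ := by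
  simp only [neighborList, if_neg ha]
  split_ifs <;> cases σ <;> simp

theorem disk_succ_mem_neighborList {k a : ℕ} (m : List Side) (p : List ℕ) (ha : ¬ IsTop k a)
    (σ : Side) : disk k ⟨m, (a + 1) :: p⟩ σ ∈ neighborList k ⟨m, a :: p⟩ := by
  simp only [neighborList, if_neg ha]
  split_ifs <;> cases σ <;> simp

/-- The point is at most 2r away horizontally and 3.1 r vertically from the center, and 2² + 3.1² <
4². -/
theorem mem_dilate_four {k : ℕ} {v : Word} {z : ℂ} (hx : |z.re - xCoord v.m| ≤ (level k).t)
    (hy : |z.im - yCoord v.n| ≤ 3 * (level k).r + (level k).δ) (σ : Side) :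
    z ∈ ((disk k v σ).dilate 4).toSet := by
  have hg := level_good k
  have hr := hg.r_pos
  have ht := hg.t_pos
  have hδr := hg.δ_le
  have htδ := hg.t_le
  have h1 : |z.re - diskX k v.m σ| ≤ 2 * (level k).r := by
    rw [abs_le] at hx ⊢
    rw [diskX]
    rcases sign_cases σ with h | h <;> rw [h] <;> constructor <;> linarith
  have h2 := sq_le_sq' (neg_le_of_abs_le h1) (le_of_abs_le h1)
  have h3 := sq_le_sq' (neg_le_of_abs_le hy) (le_of_abs_le hy)
  have h4 : (3 * (level k).r + (level k).δ) ^ 2 ≤ (3.1 * (level k).r) ^ 2 := by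
    have := hg.δ_pos
    exact pow_le_pow_left₀ (by positivity) (by linarith) 2
  change z ∈ Metric.closedBall (disk k v σ).center (4 * (level k).r)
  rw [mem_closedBall_iff_norm]
  refine abs_le_of_sq_le_sq' ?_ (by positivity) |>.2
  rw [← Complex.normSq_eq_norm_sq, Complex.normSq_apply]
  change (z.re - diskX k v.m σ) * (z.re - diskX k v.m σ) +
    (z.im - yCoord v.n) * (z.im - yCoord v.n) ≤ _
  nlinarith

/-- Every point of `E × F` is controlled by one of its neighbors. -/
theorem exists_neighbor {G' : Set (OnePoint ℂ)} {f : OnePoint ℂ → OnePoint ℂ}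
    {F : Collapse Omega ≃ₜ Collapse G'} (h : ConformalExtension Omega G' f F) {z : ℂ}
    (hz : z ∈ cantorProduct) {k : ℕ} (hk : 1 ≤ k) :
    ∃ D ∈ neighbors k z, z ∈ (D.dilate 4).toSet ∧ Controls F D z := by
  obtain ⟨⟨m, n⟩, hw, hzr, hzy⟩ := exists_inHalves_of_mem_cantorProduct hz hk
  obtain ⟨k, rfl⟩ := Nat.exists_eq_add_of_le' hk
  obtain ⟨a, p, rfl⟩ := List.exists_cons_of_length_pos (l := n) (by
    have := hw.2.1; simp only at this; omega)
  have hp : p.length = k := by simpa using hw.2.1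
  obtain ⟨hx, hy⟩ := mem_rect.1 hzr
  simp only at hx hy hzy
  have hval := validLetters_cons.1 hw.2.2
  rw [hp] at hval
  have hg := level_good (k + 1)
  have hr := hg.r_pos
  have hδ := hg.δ_pos
  have hy' := abs_le.1 hy
  have hcase : ∀ e : ℝ, IsExtremal (k + 1) a e →
      (level (k + 1)).δ / 2 ≤ e * (z.im - yCoord (a :: p)) →
      e * (z.im - yCoord (a :: p)) ≤ (level (k + 1)).r →
      ∃ D ∈ neighbors (k + 1) z, z ∈ (D.dilate 4).toSet ∧ Controls F D z := by
    intro e he h1 h2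
    obtain ⟨σ, hσ⟩ := controls_of_extremal h hw he hx h1 h2
    exact ⟨_, ⟨_, hw, hzr, disk_mem_neighborList _ _ _ _ σ⟩,
      mem_dilate_four hx (by simp only; linarith) σ, hσ⟩
  -- Membership in a child's rectangle forces z off the middle gap, so z lies clearly below or above
  -- the center. The box then encloses that half of the rectangle.
  rcases le_abs'.1 hzy with hlow | hup
  · by_cases hb : IsBottom (k + 1) a
    · exact hcase (-1) (Or.inl ⟨rfl, hb⟩) (by linarith) (by linarith)
    -- Not being a bottom gives both a ≥ 2, so that the truncated `a - 1` is a letter, and b ≠ N/2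
    -- from the second level on, so that the step from b to b + 1 does not cross the middle gap of
    -- the parent.
    · obtain ⟨b, rfl⟩ : ∃ b, a = b + 1 := ⟨a - 1, by omega⟩
      have hb1 : b ≠ 0 := fun h0 => hb (Or.inl (by omega))
      have hN : 2 ≤ p.length + 1 → b ≠ (level (p.length + 1)).N / 2 := by
        rw [hp]
        exact fun h2 h3 => hb (Or.inr ⟨h2, by rw [h3]⟩)
      have hs := yCoord_succ hN
      rw [hp] at hs
      have hvb : (⟨m, b :: p⟩ : Word) ∈ words (k + 1) := by
        refine ⟨hw.1, by simpa using hp, validLetters_cons.2 ⟨?_, hval.2⟩⟩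
        rw [hp]
        exact ⟨by omega, by omega⟩
      obtain ⟨c, σ, hσ⟩ := controls_of_gap h hk
        (v := fun c => cond c ⟨m, (b + 1) :: p⟩ ⟨m, b :: p⟩) (by rintro (- | -) <;> assumption)
        rfl hs hx (by simp only [cond_false]; linarith) (by simp only [cond_true]; linarith)
      cases c
      · refine ⟨_, ⟨_, hw, hzr, disk_pred_mem_neighborList _ _ hb σ⟩, ?_, hσ⟩
        refine mem_dilate_four hx ?_ σ
        rw [abs_le]
        simp only [Nat.add_sub_cancel]
        constructor <;> linarith
      · exact ⟨_, ⟨_, hw, hzr, disk_mem_neighborList _ _ _ _ σ⟩,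
          mem_dilate_four hx (by simp only; linarith) σ, hσ⟩
  · by_cases hb : IsTop (k + 1) a
    · exact hcase 1 (Or.inr ⟨rfl, hb⟩) (by linarith) (by linarith)
    · have hN : 2 ≤ p.length + 1 → a ≠ (level (p.length + 1)).N / 2 := by
        rw [hp]
        exact fun h2 h3 => hb (Or.inl ⟨h2, h3⟩)
      have hN' : a ≠ (level (k + 1)).N := fun h3 => hb (Or.inr h3)
      have hs := yCoord_succ hN
      rw [hp] at hs
      have hvb : (⟨m, (a + 1) :: p⟩ : Word) ∈ words (k + 1) := by
        refine ⟨hw.1, by simpa using hp, validLetters_cons.2 ⟨?_, hval.2⟩⟩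
        rw [hp]
        exact ⟨by omega, by omega⟩
      obtain ⟨c, σ, hσ⟩ := controls_of_gap h hk
        (v := fun c => cond c ⟨m, (a + 1) :: p⟩ ⟨m, a :: p⟩) (by rintro (- | -) <;> assumption)
        rfl hs hx (by simp only [cond_false]; linarith) (by simp only [cond_true]; linarith)
      cases c
      · exact ⟨_, ⟨_, hw, hzr, disk_mem_neighborList _ _ _ _ σ⟩,
          mem_dilate_four hx (by simp only; linarith) σ, hσ⟩
      · refine ⟨_, ⟨_, hw, hzr, disk_succ_mem_neighborList _ _ hb σ⟩, ?_, hσ⟩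
        refine mem_dilate_four hx ?_ σ
        rw [abs_le]
        simp only
        constructor <;> linarith

end RigidCircle
end

theorem proposition3p4 (Ω' : Set (OnePoint ℂ)) (f : OnePoint ℂ → OnePoint ℂ)
    (hΩ' : RigidCircle.IsCircleDomain Ω')
    (hf : RigidCircle.IsConformalOnto f RigidCircle.Omega Ω')
    (hinf : f OnePoint.infty = OnePoint.infty) :
    (∃ F : RigidCircle.Collapse RigidCircle.Omega ≃ₜ RigidCircle.Collapse Ω',
      RigidCircle.Extends f F) ∧
    ∀ F : RigidCircle.Collapse RigidCircle.Omega ≃ₜ RigidCircle.Collapse Ω',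
      RigidCircle.Extends f F →
      ∀ z ∈ RigidCircle.cantorProduct, ∀ k : ℕ, 1 ≤ k →
        ∃ D ∈ RigidCircle.neighbors k z,
          z ∈ (D.dilate 4).toSet ∧
          ∃ D' : RigidCircle.Disk, 0 < D'.radius ∧
            RigidCircle.hatImage F (RigidCircle.onSphere D.toSet) =
              RigidCircle.onSphere D'.toSet ∧
            RigidCircle.hatImage F (RigidCircle.onSphere {z}) ⊆
              RigidCircle.onSphere (D'.dilate (10 ^ 30)).toSet :=
  ⟨RigidCircle.exists_extends_of_isConformalOnto RigidCircle.isOpen_Omega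
      RigidCircle.infty_mem_Omega hf hinf hΩ'.1 hΩ'.2.1,
    fun _ hF _ hz _ hk => RigidCircle.exists_neighbor
      ⟨RigidCircle.isOpen_Omega, RigidCircle.infty_mem_Omega, hΩ', hf, hinf, hF⟩ hz hk⟩
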